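/- Let $n\ge 3$. A *table* of a simple arrangement of $n$ pairwise crossing pseudolines $1,\dots,n$ (no three through a point) consists of $n$ rows; row $r$ is the sequence of the other $n-1$ lines in the order in which line $r$ crosses them. Here all crossings are enclosed in a circle, one end of one line is chosen as the starting point, the lines are numbered $1,\dots,n$ clockwise around the circle beginning there, and each line is directed inwards from the end at which it received its number. Combinatorially, a table is an array of $n$ rows such that row $r$ contains every line $i\neq r$ exactly once and never $r$ itself, and such that for all $a<b<c$ the following three conditions are equivalent: $b$ precedes $c$ in row $a$; $a$ precedes $c$ in row $b$; $a$ precedes $b$ in row $c$. A *triangle* of a table is a set of three lines such that, in the row of each of the three, the other two are consecutive entries (i.e. a triangular cell of the arrangement). A table is *optimal* if it has exactly $n(n-2)/3$ triangles. Two tables are *equivalent* if they arise from one another by a different choice of the starting line and its direction, possibly combined with reflecting the arrangement. Then for $n=3,5,9,15,17$ there is a complete irredundant list of the optimal tables consisting of $1,1,1,4,10$ tables, respectively: every table in the list is optimal, no two tables in the list are equivalent, and every optimal table with $n$ lines is equivalent to a table in the list. Moreover, the list can be chosen so that each of its tables is the table of an arrangement of $n$ straight lines in the plane, so this is at the same time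 a complete enumeration of the simple straight-line arrangements of $n$ pairwise non-parallel lines with $n(n-2)/3$ triangular cells. -/

import Mathlib

/-- An array with one row for each of the `n` lines; row `r` is meant to be the sequence of the
lines that cross line `r`, in the order in which line `r` meets them. The lines are numbered
`0, …, n - 1`. -/
abbrev Table (n : ℕ) : Type := Fin n → List (Fin n)

namespace Table

variable {n : ℕ}

/-- In row `r`, line `j` stands somewhere after line `i`. -/
def After (t : Table n) (r i j : Fin n) : Prop := (t r).idxOf i < (t r).idxOf j

/-- In row `r`, line `j` stands immediately after line `i`. -/
def NextAfter (t : Table n) (r i j : Fin n) : Prop := (t r).idxOf j = (t r).idxOf i + 1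

/-- Lines `i` and `j` are neighbours in row `r`: their crossings with line `r` bound a segment of
line `r` that no other line crosses. -/
def Neighbours (t : Table n) (r i j : Fin n) : Prop := t.NextAfter r i j ∨ t.NextAfter r j i

instance (t : Table n) (r i j : Fin n) : Decidable (t.After r i j) :=
  inferInstanceAs (Decidable (_ < _))

instance (t : Table n) (r i j : Fin n) : Decidable (t.NextAfter r i j) :=
  inferInstanceAs (Decidable (_ = _))

instance (t : Table n) (r i j : Fin n) : Decidable (t.Neighbours r i j) :=
  inferInstanceAs (Decidable (_ ∨ _))

/-- `t` is the table of a simple arrangement of `n` pairwise crossing pseudolines. -/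
structure IsArrangement (t : Table n) : Prop where
  /-- no line occurs in its own row -/
  self_exclusion : ∀ r, r ∉ t r
  /-- no line occurs twice in a row -/
  non_repetition : ∀ r, (t r).Nodup
  /-- every other line occurs in row `r` -/
  completeness : ∀ r i, i ≠ r → i ∈ t r
  /-- The three rows of any three lines agree on which of the two possible ways these lines form a
  triangle. -/
  consistency : ∀ a b c, a < b → b < c →
    (t.After a b c ↔ t.After b a c) ∧ (t.After b a c ↔ t.After c a b)

/-- The triangular cells of the arrangement, each given by its three side lines `a < b < c`: all
three sides are uncrossed segments. -/
def triangles (t : Table n) : Finset (Fin n × Fin n × Fin n) :=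
  Finset.univ.filter fun p => p.1 < p.2.1 ∧ p.2.1 < p.2.2 ∧
    t.Neighbours p.1 p.2.1 p.2.2 ∧ t.Neighbours p.2.1 p.1 p.2.2 ∧ t.Neighbours p.2.2 p.1 p.2.1

/-- An optimal Kobon table: a simple pseudoline arrangement with exactly `n (n - 2) / 3`
triangles. -/
def IsOptimal (t : Table n) : Prop :=
  t.IsArrangement ∧ 3 * t.triangles.card = n * (n - 2)

/-- Start the numbering one line later on the enclosing circle: the lines `1, …, n - 1` become
`0, …, n - 2` with unchanged directions, and line `0`, now entered from its other end, becomes line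
`n - 1`, with its row reversed. -/
def rotate (t : Table n) : Table n := fun r =>
  (if r.val + 1 = n then (t (finRotate n r)).reverse else t (finRotate n r)).map (finRotate n).symm

/-- The table of the mirror image: the lines are numbered in the opposite order around the
circle. -/
def reflect (t : Table n) : Table n := fun r => (t r.rev).map Fin.rev

/-- `s` and `t` are tables of the same arrangement, up to the choice of the line with which the
numbering starts, its direction, and reflection. -/
def SameArrangement (s t : Table n) : Prop :=
  ∃ k : ℕ, t = rotate^[k] s ∨ t = rotate^[k] s.reflect

/-- `t` is the table of the straight lines `y = m i * x + b i`, entered from the right. Clockwise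
from the top right these are met in the order of decreasing slope, and each is followed from right
to left, so row `r` lists the other lines by strictly decreasing abscissa of the crossing with
line `r`. -/
def IsTableOfLines (t : Table n) (m b : Fin n → ℝ) : Prop :=
  StrictAnti m ∧ t.IsArrangement ∧
    ∀ r, (t r).Pairwise fun i j => (b j - b r) / (m r - m j) < (b i - b r) / (m r - m i)

end Table

/-! The lists are certified by a search that the kernel evaluates; the mathematics shows why the
search can be small and why it misses nothing.

Each of the `n` rows has `n - 2` pairs of consecutive crossings, and a pair bounds a side of at most
one triangle. So a table is optimal exactly when every one of these `n (n - 2)` segments is a side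
of a triangle (`IsOptimal.posArrangement`, `IsArrangement.isOptimal`). This has two consequences. At
the ends, neighbouring lines are matched around the circle: for odd `n`, after at most one rotation,
lines `2i` and `2i + 1` meet each other first, lines `2i + 1` and `2i + 2` meet each other last, and
the first crossing of `n - 1` is the last one of `0` (`pos_pair`, `pos_mate`). In the interior, two
lines that have just crossed are next crossed by one and the same line (`next_of_next`).

Now sweep the arrangement. A state of the sweep is a stack of blocks of two lines that have just
crossed, with one single line on top. A block is finished, or its next crossing is upwards or
downwards. An upward block directly below a downward one must exchange lines with it in three forced
crossings (`next_of_up_down`, `StateOk.exchange`); besides, the top line is replaced once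
(`StateOk.exchangeTop`). The only choice is the direction of each block, so `search` branches over
it. Every optimal table follows one of its branches to an accepted leaf (`search_sound`).

To cut down on symmetry, the numbering is started where row `0` begins with the longest possible run
`1, 3, 2, 5, 4, …` (`exists_normalized`). For each length `d` the run is imposed on line `0`, and
branches in which a line is found to complete a longer run are discarded (`sweep_sound`).

At a leaf all rows are known, as numbers in base `64`, and are compared with a rotation of a listed
table or of its mirror image. Optimality and straightness of the listed tables follow from
inequalities between integers, and inequivalence from comparing all `2n` rotations with and without
reflection (`Irredundant`). -/

/-- `pos r i` is the position of line `i` in row `r` of the table of an arrangement of `n`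
pseudolines. -/
structure PosTable (n : ℕ) (pos : ℕ → ℕ → ℕ) : Prop where
  lt : ∀ {r i}, r < n → i < n → i ≠ r → pos r i + 1 < n
  inj : ∀ {r i j}, r < n → i < n → j < n → i ≠ r → j ≠ r → pos r i = pos r j → i = j
  surj : ∀ {r k}, r < n → k + 1 < n → ∃ i, i < n ∧ i ≠ r ∧ pos r i = k
  cons : ∀ {a b c}, a < b → b < c → c < n →
    (pos a b < pos a c ↔ pos b a < pos b c) ∧ (pos b a < pos b c ↔ pos c a < pos c b)

/-- Any two neighbours in a row span a triangle with the line of that row. -/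
structure PosArrangement (n : ℕ) (pos : ℕ → ℕ → ℕ) : Prop extends PosTable n pos where
  adj : ∀ {r i j}, r < n → i < n → j < n → i ≠ r → j ≠ r → pos r j = pos r i + 1 →
    (pos i j = pos i r + 1 ∨ pos i r = pos i j + 1) ∧
      (pos j i = pos j r + 1 ∨ pos j r = pos j i + 1)

/-! ### First and last crossings -/

namespace PosArrangement

variable {n : ℕ} {pos : ℕ → ℕ → ℕ}

theorem ne (h : PosArrangement n pos) {r i j : ℕ} (hr : r < n) (hi : i < n) (hj : j < n)
    (hir : i ≠ r) (hjr : j ≠ r) (hij : i ≠ j) : pos r i ≠ pos r j :=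
  fun e => hij (h.inj hr hi hj hir hjr e)

/-- If `a` had neighbours `u` and `v` on both sides in row `x`, the two triangles there would make
both `u` and `v` neighbours of `x` in row `a`, but an end of a row has only one neighbour. -/
theorem end_of_end (h : PosArrangement n pos) {a x : ℕ} (ha : a < n) (hx : x < n) (hax : x ≠ a)
    (he : pos a x = 0 ∨ pos a x + 2 = n) : pos x a = 0 ∨ pos x a + 2 = n := by
  by_contra hc
  have h1 := h.lt hx ha hax.symm
  obtain ⟨u, hu, hux, pu⟩ := h.surj (k := pos x a - 1) hx (by omega)
  obtain ⟨v, hv, hvx, pv⟩ := h.surj (k := pos x a + 1) hx (by omega)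
  have hua : u ≠ a := by rintro rfl; omega
  have hva : v ≠ a := by rintro rfl; omega
  have huv : u ≠ v := by rintro rfl; omega
  have h2 := (h.adj hx hu ha hux hax.symm (by omega)).2
  have h3 := (h.adj hx ha hv hax.symm hvx (by omega)).1
  have h4 := h.ne ha hu hv hua hva huv
  have h5 := h.lt ha hu hua
  have h6 := h.lt ha hv hva
  omega

/-- A line numbered between `a` and `x` would come after `x` on `a` and after `a` on `x`, against
consistency. -/
theorem first_first (h : PosArrangement n pos) {a x : ℕ} (hax : a < x) (hx : x < n)
    (h1 : pos a x = 0) (h2 : pos x a = 0) : x = a + 1 := by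
  by_contra hc
  have h3 := h.cons (a := a) (b := a + 1) (c := x) (by omega) (by omega) hx
  have h4 := h.ne (r := x) (i := a) (j := a + 1) hx (by omega) (by omega) (by omega) (by omega)
    (by omega)
  omega

theorem last_last (h : PosArrangement n pos) {a x : ℕ} (hax : a < x) (hx : x < n)
    (h1 : pos a x + 2 = n) (h2 : pos x a + 2 = n) : x = a + 1 := by
  by_contra hc
  have h3 := h.cons (a := a) (b := a + 1) (c := x) (by omega) (by omega) hx
  have h4 := h.ne (r := a) (i := x) (j := a + 1) (by omega) (by omega) (by omega) (by omega)
    (by omega) (by omega)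
  have h5 := h.lt (r := a) (i := a + 1) (by omega) (by omega) (by omega)
  have h6 := h.lt (r := x) (i := a + 1) (by omega) (by omega) (by omega)
  omega

/-- Every other line comes after `x` on `a` and before `a` on `x`. Consistency allows this only for
lines numbered between the two, so the two are the extreme lines. -/
theorem first_last (h : PosArrangement n pos) {a x : ℕ} (ha : a < n) (hx : x < n) (hax : a ≠ x)
    (h1 : pos a x = 0) (h2 : pos x a + 2 = n) : (a = 0 ∧ x + 1 = n) ∨ (x = 0 ∧ a + 1 = n) := by
  have key : ∀ y, y < n → y ≠ a → y ≠ x → pos a x < pos a y ∧ pos x y < pos x a := by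
    intro y hy hya hyx
    have h3 := h.ne ha hx hy hax.symm hya hyx.symm
    have h4 := h.ne hx ha hy hax hyx hya.symm
    have h5 := h.lt hx hy hyx
    omega
  rcases lt_or_gt_of_ne hax with hl | hl
  · left
    constructor
    · by_contra hc
      have h3 := h.cons (a := 0) (b := a) (c := x) (by omega) hl hx
      have h4 := key 0 (by omega) (by omega) (by omega)
      omega
    · by_contra hc
      have h3 := h.cons (a := a) (b := x) (c := x + 1) hl (by omega) (by omega)
      have h4 := key (x + 1) (by omega) (by omega) (by omega)
      omega
  · right
    constructor
    · by_contra hc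
      have h3 := h.cons (a := 0) (b := x) (c := a) (by omega) hl ha
      have h4 := key 0 (by omega) (by omega) (by omega)
      omega
    · by_contra hc
      have h3 := h.cons (a := x) (b := a) (c := a + 1) hl (by omega) (by omega)
      have h4 := key (a + 1) (by omega) (by omega) (by omega)
      omega

/-- The line that crosses line `a` first. -/
theorem exists_first (h : PosArrangement n pos) {a : ℕ} (ha : a < n) (hn : 3 ≤ n) :
    ∃ x, x < n ∧ x ≠ a ∧ pos a x = 0 ∧
      ((pos x a = 0 ∧ (x = a + 1 ∨ a = x + 1)) ∨
        (pos x a + 2 = n ∧ ((a = 0 ∧ x + 1 = n) ∨ (x = 0 ∧ a + 1 = n)))) := by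
  obtain ⟨x, hx, hxa, px⟩ := h.surj (k := 0) ha (by omega)
  refine ⟨x, hx, hxa, px, ?_⟩
  rcases h.end_of_end ha hx hxa (Or.inl px) with h1 | h1
  · rcases lt_or_gt_of_ne hxa with hl | hl
    · exact Or.inl ⟨h1, Or.inr (h.first_first hl ha h1 px)⟩
    · exact Or.inl ⟨h1, Or.inl (h.first_first hl hx px h1)⟩
  · exact Or.inr ⟨h1, h.first_last ha hx hxa.symm px h1⟩

/-- The line that crosses line `a` last. -/
theorem exists_last (h : PosArrangement n pos) {a : ℕ} (ha : a < n) (hn : 3 ≤ n) :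
    ∃ x, x < n ∧ x ≠ a ∧ pos a x + 2 = n ∧
      ((pos x a + 2 = n ∧ (x = a + 1 ∨ a = x + 1)) ∨
        (pos x a = 0 ∧ ((a = 0 ∧ x + 1 = n) ∨ (x = 0 ∧ a + 1 = n)))) := by
  obtain ⟨x, hx, hxa, px⟩ := h.surj (k := n - 2) ha (by omega)
  have px : pos a x + 2 = n := by omega
  refine ⟨x, hx, hxa, px, ?_⟩
  rcases h.end_of_end ha hx hxa (Or.inr px) with h1 | h1
  · refine Or.inr ⟨h1, ?_⟩
    have := h.first_last hx ha hxa h1 px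
    tauto
  · rcases lt_or_gt_of_ne hxa with hl | hl
    · exact Or.inl ⟨h1, Or.inr (h.last_last hl ha h1 px)⟩
    · exact Or.inl ⟨h1, Or.inl (h.last_last hl hx px h1)⟩

/-- If lines `0` and `1` do not meet each other first, then lines `1` and `2` do. -/
theorem pos_one_two (h : PosArrangement n pos) (hn : 3 ≤ n) (h0 : pos 0 1 ≠ 0) : pos 1 2 = 0 := by
  obtain ⟨x, hx, hx1, px, hc⟩ := h.exists_first (a := 1) (by omega) hn
  have : x = 2 := by
    rcases hc with ⟨h1, h2⟩ | ⟨h1, h2⟩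
    · rcases h2 with h2 | h2
      · exact h2
      · obtain rfl : x = 0 := by omega
        exact absurd h1 h0
    · omega
  subst this
  exact px

/-- Induction along the circle: the first crossing of `2i + 2` is with one of its neighbours in the
numbering, and `2i + 1` already meets `2i` first. -/
theorem pos_pair (h : PosArrangement n pos) (hn : 3 ≤ n) (h0 : pos 0 1 = 0) (i : ℕ)
    (hi : 2 * i + 1 < n) : pos (2 * i) (2 * i + 1) = 0 ∧ pos (2 * i + 1) (2 * i) = 0 := by
  have step : ∀ a, a + 1 < n → pos a (a + 1) = 0 → pos (a + 1) a = 0 := by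
    intro a ha hp
    rcases h.end_of_end (a := a) (x := a + 1) (by omega) ha (by omega) (Or.inl hp) with h1 | h1
    · exact h1
    · have := h.first_last (a := a) (x := a + 1) (by omega) ha (by omega) hp h1
      omega
  induction i with
  | zero => exact ⟨h0, step 0 (by omega) h0⟩
  | succ i ih =>
    have ih := ih (by omega)
    obtain ⟨x, hx, hxa, px, hc⟩ := h.exists_first (a := 2 * (i + 1)) (by omega) hn
    have hx' : x = 2 * (i + 1) + 1 := by
      rcases hc with ⟨h1, h2 | h2⟩ | ⟨h1, h2⟩
      · exact h2
      · obtain rfl : x = 2 * i + 1 := by omega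
        have := h.inj (r := 2 * i + 1) (i := 2 * i) (j := 2 * (i + 1)) (by omega) (by omega)
          (by omega) (by omega) (by omega) (by omega)
        omega
      · omega
    subst hx'
    exact ⟨px, step _ hi px⟩

/-- As `n` is odd, `n - 2` already meets `n - 3` first, so only the wrap-around to line `0` remains
for line `n - 1`. -/
theorem pos_last_zero (h : PosArrangement n pos) (hn : 3 ≤ n) (h0 : pos 0 1 = 0) (ho : n % 2 = 1) :
    pos (n - 1) 0 = 0 ∧ pos 0 (n - 1) + 2 = n := by
  obtain ⟨x, hx, hxa, px, hc⟩ := h.exists_first (a := n - 1) (by omega) hn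
  have hx0 : x = 0 ∧ pos x (n - 1) + 2 = n := by
    rcases hc with ⟨h1, h2 | h2⟩ | ⟨h1, h2⟩
    · omega
    · have h3 := (h.pos_pair hn h0 ((n - 3) / 2) (by omega)).2
      have e : 2 * ((n - 3) / 2) + 1 = x := by omega
      rw [e] at h3
      have := h.inj (r := x) (i := 2 * ((n - 3) / 2)) (j := n - 1) hx (by omega) (by omega)
        (by omega) (by omega) (by omega)
      omega
    · exact ⟨by omega, h1⟩
  obtain ⟨rfl, h2⟩ := hx0
  exact ⟨px, h2⟩

/-- The line that crosses line `x` last, if lines `0` and `1` cross each other first. -/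
def mate (n x : ℕ) : ℕ := if x = 0 then n - 1 else if x % 2 = 1 then x + 1 else x - 1

/-- The same induction for last crossings: line `0` meets `1` first, so the last crossing of `1` is
with `2`, which leaves `4` for `3`, and so on; line `0` ends with `n - 1`. -/
theorem pos_mate (h : PosArrangement n pos) (hn : 3 ≤ n) (h0 : pos 0 1 = 0) (ho : n % 2 = 1)
    {x : ℕ} (hx : x < n) : mate n x < n ∧ mate n x ≠ x ∧ pos x (mate n x) + 2 = n := by
  have hl := h.pos_last_zero hn h0 ho
  have key : ∀ i, 2 * i + 2 < n →
      pos (2 * i + 1) (2 * i + 2) + 2 = n ∧ pos (2 * i + 2) (2 * i + 1) + 2 = n := by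
    intro i
    induction i with
    | zero =>
      intro hi
      obtain ⟨y, hy, hya, py, hc⟩ := h.exists_last (a := 1) (by omega) hn
      have hy2 : y = 2 ∧ pos y 1 + 2 = n := by
        rcases hc with ⟨h1, h2 | h2⟩ | ⟨h1, h2⟩
        · exact ⟨by omega, h1⟩
        · obtain rfl : y = 0 := by omega
          omega
        · omega
      obtain ⟨rfl, h2⟩ := hy2
      exact ⟨py, h2⟩
    | succ i ih =>
      intro hi
      have ih := ih (by omega)
      obtain ⟨y, hy, hya, py, hc⟩ := h.exists_last (a := 2 * (i + 1) + 1) (by omega) hn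
      have hy2 : y = 2 * (i + 1) + 2 ∧ pos y (2 * (i + 1) + 1) + 2 = n := by
        rcases hc with ⟨h1, h2 | h2⟩ | ⟨h1, h2⟩
        · exact ⟨by omega, h1⟩
        · obtain rfl : y = 2 * i + 2 := by omega
          have := h.inj (r := 2 * i + 2) (i := 2 * i + 1) (j := 2 * (i + 1) + 1) (by omega)
            (by omega) (by omega) (by omega) (by omega) (by omega)
          omega
        · omega
      obtain ⟨rfl, h2⟩ := hy2
      exact ⟨py, h2⟩
  unfold mate
  split_ifs with h1 h2
  · subst h1
    exact ⟨by omega, by omega, hl.2⟩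
  · have := key ((x - 1) / 2) (by omega)
    have e : 2 * ((x - 1) / 2) + 1 = x := by omega
    have e' : 2 * ((x - 1) / 2) + 2 = x + 1 := by omega
    rw [e, e'] at this
    exact ⟨by omega, by omega, this.1⟩
  · have := key ((x - 2) / 2) (by omega)
    have e : 2 * ((x - 2) / 2) + 1 = x - 1 := by omega
    have e' : 2 * ((x - 2) / 2) + 2 = x := by omega
    rw [e, e'] at this
    exact ⟨by omega, by omega, this.2⟩

/-! ### Cuts of the sweep and the crossing between neighbours -/

/-- Line `x` has been followed through its first `K x` crossings and line `y` through its first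
`K y`; line `x` is now below line `y`, and they have crossed exactly if `y < x`. -/
def Below (pos : ℕ → ℕ → ℕ) (K : ℕ → ℕ) (x y : ℕ) : Prop :=
  (pos x y < K x ↔ y < x) ∧ (pos y x < K y ↔ y < x)

/-- The next line to cross `x` is `v`. -/
def Next (n : ℕ) (pos : ℕ → ℕ → ℕ) (K : ℕ → ℕ) (x v : ℕ) : Prop :=
  v < n ∧ v ≠ x ∧ pos x v = K x

theorem exists_next (h : PosArrangement n pos) {K : ℕ → ℕ} {x : ℕ} (hx : x < n)
    (hK : K x + 1 < n) : ∃ v, Next n pos K x v := h.surj hx hK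

theorem Next.unique (h : PosArrangement n pos) {K : ℕ → ℕ} {x u v : ℕ} (hx : x < n)
    (hu : Next n pos K x u) (hv : Next n pos K x v) : u = v :=
  h.inj hx hu.1 hv.1 hu.2.1 hv.2.1 (hu.2.2.trans hv.2.2.symm)

/-- If `x` is directly below `y`, the next crossing of `x` is upwards and the next crossing of `y`
is downwards, then `x` and `y` cross next. -/
theorem next_of_up_down (h : PosArrangement n pos) {K : ℕ → ℕ} {x y u w : ℕ}
    (hx : x < n) (hy : y < n) (hxy : x ≠ y) (hu : Next n pos K x u) (hw : Next n pos K y w)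
    (hxu : x < u) (hwy : w < y) (hB : Below pos K x y)
    (hadj : ∀ z, z < n → z ≠ x → z ≠ y →
      (Below pos K z x ∧ Below pos K z y) ∨ (Below pos K x z ∧ Below pos K y z)) :
    u = y ∧ w = x := by
  obtain ⟨hun, hux, pu⟩ := hu
  obtain ⟨hwn, hwy', pw⟩ := hw
  unfold Below at *
  -- A line that `x` has not crossed yet and whose number is larger lies above `x`; unless it is
  -- `y`, it lies above `y` too. Likewise `w` lies below both `x` and `y` unless it is `x`.
  have hu' : u ≠ y → pos x u ≠ pos x y ∧ ((pos x u < K x ↔ u < x) ∧ (pos u x < K u ↔ u < x)) ∧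
      ((pos y u < K y ↔ u < y) ∧ (pos u y < K u ↔ u < y)) := by
    intro huy
    refine ⟨h.ne hx hun hy hux hxy.symm huy, ?_⟩
    rcases hadj u hun hux huy with h1 | h1
    · omega
    · exact h1
  have hw' : w ≠ x → pos y w ≠ pos y x ∧ ((pos w x < K w ↔ x < w) ∧ (pos x w < K x ↔ x < w)) ∧
      ((pos w y < K w ↔ y < w) ∧ (pos y w < K y ↔ y < w)) := by
    intro hwx
    refine ⟨h.ne hy hwn hx hwy' hxy hwx, ?_⟩
    rcases hadj w hwn hwx hwy' with h1 | h1
    · exact h1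
    · omega
  by_cases huy : u = y
  · refine ⟨huy, ?_⟩
    by_contra hwx
    obtain ⟨w1, w2, w3⟩ := hw' hwx
    subst huy
    have nxw := h.ne hx hun hwn hux hwx (Ne.symm hwy')
    rcases lt_or_gt_of_ne hwx with hl | hl
    · have c := h.cons hl hxu hun
      omega
    · have c := h.cons hl hwy hun
      omega
  · exfalso
    obtain ⟨u1, u2, u3⟩ := hu' huy
    by_cases hwx : w = x
    · subst hwx
      have nyu := h.ne hy hun hx huy hxy hux
      rcases lt_or_gt_of_ne huy with hl | hl
      · have c := h.cons hxu hl hy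
        omega
      · have c := h.cons hwy hl hun
        omega
    · obtain ⟨w1, w2, w3⟩ := hw' hwx
      have huw : u ≠ w := by
        rintro rfl
        omega
      have n1 := h.ne hx hun hwn hux hwx huw
      have n2 := h.ne hy hun hwn huy hwy' huw
      have n3 := h.ne hun hx hwn hux.symm huw.symm (Ne.symm hwx)
      have n5 := h.ne hun hx hy hux.symm (Ne.symm huy) hxy
      -- In both cases `w` is smaller and `u` is larger than `x` and `y`. Consistency then makes `y`
      -- precede `x`, `x` precede `w`, and `w` precede `y` in row `u`.
      rcases lt_or_gt_of_ne hxy with hl | hl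
      · have e0 : K x ≤ pos x y ∧ K y ≤ pos y x := by
          clear u2 u3 w2 w3 hadj hu' hw'
          omega
        have hyu : y < u := by
          by_contra hc
          have c := (h.cons (a := x) (b := u) (c := y) hxu (by omega) hy).1.1 (by omega)
          clear hB w2 w3 hadj hu' hw'
          omega
        have hwx' : w < x := by
          by_contra hc
          have hxw : x < w := by omega
          have c := (h.cons (a := x) (b := w) (c := y) hxw hwy hy).2.1
            (lt_of_lt_of_le (w2.1.2 hxw) (not_lt.1 fun e => absurd (w3.1.1 e) (by omega)))
          omega
        have e2 : K x ≤ pos x w := not_lt.1 fun e => absurd (w2.2.1 e) (by omega)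
        have e3 : K y ≤ pos y u := not_lt.1 fun e => absurd (u3.1.1 e) (by omega)
        have c1 := h.cons hl hyu hun
        have c3 := (h.cons hwx' hxu hun).2
        have c4 := (h.cons hwy hyu hun).2.1 (by omega)
        clear hB u2 u3 w2 w3 hadj hu' hw'
        omega
      · have e1 : pos x y < pos x u := by
          have := hB.1
          clear hB u2 u3 w2 w3 hadj hu' hw'
          omega
        have e2 : pos x u < pos x w := by
          have := w2.2
          clear hB u2 u3 w2 w3 hadj hu' hw'
          omega
        have e3 : pos y w < pos y u := by
          have := u3.1
          clear hB u2 u3 w2 w3 hadj hu' hw'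
          omega
        have c1 := (h.cons hl hxu hun).2.1 e1
        have c3 := (h.cons (lt_trans hwy hl) hxu hun).2
        have c4 := (h.cons hwy (lt_trans hl hxu) hun).2.1 e3
        clear hB u2 u3 w2 w3 hadj hu' hw'
        omega

end PosArrangement

open PosArrangement

/-! ### The search -/

/-- A line of a sweep: `dig` is its label plus one, `bit` is `2 ^ label`, `rem` is the set of the
lines that it still has to cross, `row` lists the lines that it has crossed, in base `64`; `mt`
stands for the line that it crosses last and `nm` for the set of all others. -/
structure Strand where
  dig : ℕ
  bit : ℕ
  mt : ℕ
  nm : ℕ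
  rem : ℕ
  row : ℕ

/-- Two lines that have just crossed, `p` being the lower one. -/
structure Block where
  p : Strand
  q : Strand

namespace Strand

def lab (x : Strand) : ℕ := x.dig - 1

/-- The lines that may be the next to cross `x`. -/
def avail (x : Strand) : ℕ := bif x.rem.beq x.mt then x.rem else Nat.land x.rem x.nm

/-- Sets of lines are bit masks and tests are Boolean so that the kernel evaluates the search with
its built-in arithmetic. The test is a necessary condition for `y` to be next on `x`, not a
sufficient one. -/
def meets (x y : Strand) : Bool := !(Nat.land x.avail y.bit).beq 0

def cross (x y : Strand) : Strand :=
  ⟨x.dig, x.bit, x.mt, x.nm, Nat.xor x.rem y.bit, x.row * 64 + y.dig⟩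

/-- Line `i` before its first crossing. -/
def fresh (n i : ℕ) : Strand :=
  ⟨i + 1, 2 ^ i, 2 ^ mate n i, Nat.xor (2 ^ n - 1) (2 ^ mate n i), Nat.xor (2 ^ n - 1) (2 ^ i), 0⟩

end Strand

namespace Block

def finished (b : Block) : Bool := (b.p.rem + b.q.rem).beq 0

/-- Since `p` lies below `q` after their crossing, `p` has the larger label. The line that crosses
both next is above them if its label exceeds that of `p`, and below them if its label is less than
that of `q`: a common bit of weight at least `2 * p.bit`, or one below `q.bit`. -/
def canUp (b : Block) : Bool := (b.p.bit + b.p.bit).ble (Nat.land b.p.avail b.q.avail)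

def canDown (b : Block) : Bool := !(Nat.land b.p.avail b.q.avail % b.q.bit).beq 0

def fresh (n i : ℕ) : Block :=
  ⟨(Strand.fresh n (2 * i + 1)).cross (Strand.fresh n (2 * i)),
    (Strand.fresh n (2 * i)).cross (Strand.fresh n (2 * i + 1))⟩

end Block

/-- The lines of a list of blocks, from the lowest to the highest. -/
def lines (bs : List Block) : List Strand := bs.flatMap fun b => [b.p, b.q]

/-- The three crossings between two neighbouring blocks `(a b)` and `(c d)`. -/
def exchange (bad : Strand → Bool) (u v : Block) (k : Block → Block → Bool) : Bool :=
  match u, v with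
  | ⟨a, b⟩, ⟨c, d⟩ =>
    bif a.meets c && b.meets c && c.meets b && d.meets b then
      bif (c.cross b).meets a && (b.cross c).meets d then
        bif bad ((b.cross c).cross d) then true
        else k ⟨(c.cross b).cross a, a.cross c⟩ ⟨d.cross b, (b.cross c).cross d⟩
      else true
    else true

/-- The two crossings of the topmost line with the highest block. -/
def exchangeTop (u : Block) (z : Strand) (k : Block → Strand → Bool) : Bool :=
  match u with
  | ⟨a, b⟩ =>
    -- Here `z` is line `n - 1`, which must meet line `0` first; the digit of line `0` is `1`.
    bif b.dig.beq 1 && a.meets z && b.meets z && z.meets b && (z.cross b).meets a then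
      k ⟨(z.cross b).cross a, a.cross z⟩ (b.cross z)
    else true

/-- Sweep all arrangements that continue the given state: the blocks of `st` (the highest one
first) are finished or have their next crossing upwards; the blocks of `rest` lie above them, and
the line `z` on top. -/
def search (bad : Strand → Bool) (leaf : List Block → Strand → Bool) :
    ℕ → List Block → List Block → Strand → Bool
  -- Running out of fuel counts as failure and a contradictory branch as success, so no bound on the
  -- length of the search has to be proved.
  | 0, _, _, _ => false
  | f + 1, st, [], z =>
    -- The top line is either line `n - 1` without any crossing or line `0` with all of them. In the
    -- second case, as no block goes down, the sweep is complete.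
    match z.rem with
    | 0 => leaf st z
    | _ + 1 =>
      match st with
      | [] => true
      | u :: st => exchangeTop u z fun v z => search bad leaf f st [v] z
  | f + 1, st, c :: rest, z =>
    bif c.finished then search bad leaf f (c :: st) rest z
    else
      -- If both directions are possible, both branches have to succeed.
      bif (bif c.canUp then search bad leaf f (c :: st) rest z else true) then
        match st with
        | [] => true
        | u :: st =>
          bif c.canDown then
            exchange bad u c fun u c => search bad leaf f st (u :: c :: rest) z
          else true
      else false

/-- Let the higher line of block `cur` cross the next `d` blocks. -/
def advance (bad : Strand → Bool) (k : List Block → Bool) :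
    ℕ → List Block → Block → List Block → Bool
  | 0, done, cur, rest => k (done.reverse ++ cur :: rest)
  | _ + 1, _, _, [] => false
  | d + 1, done, cur, v :: rest =>
    exchange bad cur v fun x y => advance bad k d (x :: done) y rest

def freshBlocks (n : ℕ) : ℕ → ℕ → List Block
  | _, 0 => []
  | i, k + 1 => Block.fresh n i :: freshBlocks n (i + 1) k

/-! ### Search states that agree with a given arrangement -/

/-- The row of line `x` starts with `k` lines that form the number `c` in base `64`. -/
inductive RowCode (n : ℕ) (pos : ℕ → ℕ → ℕ) (x : ℕ) : ℕ → ℕ → Prop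
  | zero : RowCode n pos x 0 0
  | succ {k c v : ℕ} : RowCode n pos x k c → v < n → v ≠ x → pos x v = k →
      RowCode n pos x (k + 1) (c * 64 + (v + 1))

/-- `s` describes line `s.lab` after its first `k` crossings. -/
structure StrandOk (n : ℕ) (pos : ℕ → ℕ → ℕ) (k : ℕ) (s : Strand) : Prop where
  dig_pos : 0 < s.dig
  lt : s.lab < n
  bit : s.bit = 2 ^ s.lab
  mt : s.mt = 2 ^ mate n s.lab
  nm : ∀ j, s.nm.testBit j = true ↔ j < n ∧ j ≠ mate n s.lab
  rem : ∀ j, s.rem.testBit j = true ↔ j < n ∧ j ≠ s.lab ∧ k ≤ pos s.lab j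
  row : RowCode n pos s.lab k s.row

@[simp] theorem Strand.lab_cross (x y : Strand) : (x.cross y).lab = x.lab := rfl

@[simp] theorem Strand.lab_fresh (n i : ℕ) : (Strand.fresh n i).lab = i := by
  simp [Strand.lab, Strand.fresh]

@[simp] theorem lines_nil : lines [] = [] := rfl

@[simp] theorem lines_cons (b : Block) (bs : List Block) :
    lines (b :: bs) = b.p :: b.q :: lines bs := rfl

@[simp] theorem lines_append (bs cs : List Block) : lines (bs ++ cs) = lines bs ++ lines cs := by
  simp [lines]

section

variable {n : ℕ} {pos : ℕ → ℕ → ℕ}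

theorem RowCode.lt (h : PosArrangement n pos) {x k c : ℕ} (hx : x < n)
    (hr : RowCode n pos x k c) : k < n := by
  cases hr with
  | zero => omega
  | succ _ h1 h2 h3 => have := h.lt hx h1 h2; omega

theorem StrandOk.cross (h : PosArrangement n pos) {k : ℕ} {s t : Strand} (hs : StrandOk n pos k s)
    (htd : 0 < t.dig) (ht : t.lab < n) (hb : t.bit = 2 ^ t.lab) (hne : t.lab ≠ s.lab)
    (hp : pos s.lab t.lab = k) : StrandOk n pos (k + 1) (s.cross t) where
  dig_pos := hs.dig_pos
  lt := hs.lt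
  bit := hs.bit
  mt := hs.mt
  nm := hs.nm
  rem j := by
    have h1 := hs.rem j
    have h2 : (s.cross t).rem = s.rem ^^^ 2 ^ t.lab := by rw [← hb]; rfl
    rw [h2, Nat.testBit_xor, Nat.testBit_two_pow, Strand.lab_cross]
    by_cases hj : t.lab = j
    · subst hj
      have : s.rem.testBit t.lab = true := h1.2 ⟨ht, hne, hp.ge⟩
      simp [this]
      omega
    · simp only [hj, decide_false, Bool.xor_false, h1]
      constructor
      · rintro ⟨a, b, c⟩
        have := h.ne hs.lt ht a hne b hj
        exact ⟨a, b, by omega⟩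
      · rintro ⟨a, b, c⟩
        exact ⟨a, b, by omega⟩
  row := by
    have h2 : (s.cross t).row = s.row * 64 + (t.lab + 1) := by
      have : t.lab + 1 = t.dig := by unfold Strand.lab; omega
      rw [this]; rfl
    rw [h2]
    exact hs.row.succ ht hne hp

theorem StrandOk.cross' (h : PosArrangement n pos) {k l : ℕ} {s t : Strand}
    (hs : StrandOk n pos k s) (ht : StrandOk n pos l t) (hne : t.lab ≠ s.lab)
    (hp : pos s.lab t.lab = k) : StrandOk n pos (k + 1) (s.cross t) :=
  hs.cross h ht.dig_pos ht.lt ht.bit hne hp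

theorem StrandOk.fresh {i : ℕ} (hi : i < n) (hm : mate n i < n) : StrandOk n pos 0 (Strand.fresh n i) where
  dig_pos := Nat.succ_pos i
  lt := by simpa
  bit := by simp; rfl
  mt := by simp; rfl
  nm j := by
    have : (Strand.fresh n i).nm = (2 ^ n - 1) ^^^ 2 ^ mate n i := rfl
    rw [this, Nat.testBit_xor, Nat.testBit_two_pow, Nat.testBit_two_pow_sub_one, Strand.lab_fresh]
    by_cases h1 : mate n i = j
    · rw [h1] at hm; simp [h1, hm]
    · simp [h1, Ne.symm h1]
  rem j := by
    have : (Strand.fresh n i).rem = (2 ^ n - 1) ^^^ 2 ^ i := rfl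
    rw [this, Nat.testBit_xor, Nat.testBit_two_pow, Nat.testBit_two_pow_sub_one, Strand.lab_fresh]
    by_cases h1 : i = j
    · subst h1; simp [hi]
    · simp [h1, Ne.symm h1]
  row := RowCode.zero

/-- The mate is the last line to be crossed, so it can be the next one only if it is the only one
left. -/
theorem StrandOk.avail (h : PosArrangement n pos) {k v : ℕ} {s : Strand}
    (hm : pos s.lab (mate n s.lab) + 2 = n) (hmn : mate n s.lab < n) (hml : mate n s.lab ≠ s.lab)
    (hs : StrandOk n pos k s) (hv : v < n) (hvs : v ≠ s.lab) (hp : pos s.lab v = k) :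
    s.avail.testBit v = true := by
  have h1 := (hs.rem v).2 ⟨hv, hvs, hp.ge⟩
  unfold Strand.avail
  by_cases hc : s.rem.beq s.mt = true
  · rw [hc]; exact h1
  · rw [Bool.not_eq_true] at hc
    rw [hc]
    change (s.rem &&& s.nm).testBit v = true
    rw [Nat.testBit_and, h1, (hs.nm v).2 ⟨hv, ?_⟩]
    · rfl
    · rintro rfl
      apply Nat.ne_of_beq_eq_false hc
      rw [hs.mt]
      apply Nat.eq_of_testBit_eq
      intro j
      rw [Nat.testBit_two_pow, Bool.eq_iff_iff, hs.rem, decide_eq_true_iff]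
      constructor
      · rintro ⟨a, b, c⟩
        have := h.lt hs.lt a b
        exact h.inj hs.lt hmn a hml b (by omega)
      · rintro rfl
        exact ⟨hmn, hml, hp.ge⟩

theorem testBit_of_land_two_pow {a v : ℕ} (h : a.testBit v = true) :
    (Nat.land a (2 ^ v)).beq 0 = false := by
  rw [Bool.eq_false_iff]
  intro e
  replace e := Nat.eq_of_beq_eq_true e
  have h2 : (a &&& 2 ^ v).testBit v = false := by
    change (Nat.land a (2 ^ v)).testBit v = false
    rw [e]; simp
  simp [Nat.testBit_and, h] at h2

/-- The lines `0` and `1` cross each other first, and the number of lines is odd. -/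
structure Normalized (n : ℕ) (pos : ℕ → ℕ → ℕ) : Prop extends PosArrangement n pos where
  three_le : 3 ≤ n
  odd : n % 2 = 1
  first : pos 0 1 = 0

theorem Normalized.mate (h : Normalized n pos) {x : ℕ} (hx : x < n) :
    mate n x < n ∧ mate n x ≠ x ∧ pos x (mate n x) + 2 = n :=
  h.pos_mate h.three_le h.first h.odd hx

theorem StrandOk.meets (h : Normalized n pos) {k l : ℕ} {s t : Strand}
    (hs : StrandOk n pos k s) (ht : StrandOk n pos l t) (hne : t.lab ≠ s.lab)
    (hp : pos s.lab t.lab = k) : s.meets t = true := by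
  obtain ⟨h1, h2, h3⟩ := h.mate hs.lt
  have := hs.avail h.toPosArrangement h3 h1 h2 ht.lt hne hp
  unfold Strand.meets
  rw [ht.bit, testBit_of_land_two_pow this]
  rfl

/-- `p` and `q` have just crossed, and the same line is the next one to cross each of them. -/
structure BlockOk (n : ℕ) (pos : ℕ → ℕ → ℕ) (K : ℕ → ℕ) (b : Block) : Prop where
  ne : b.p.lab ≠ b.q.lab
  left : pos b.p.lab b.q.lab + 1 = K b.p.lab
  right : pos b.q.lab b.p.lab + 1 = K b.q.lab
  next : ∀ v, Next n pos K b.p.lab v ↔ Next n pos K b.q.lab v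

/-- The segment from `q` to `v` on `p` is a side of a triangle, so `v` stands next to `p` in row
`q`. The place before `p` is taken by `u` or does not exist, hence `v` follows `p`. -/
theorem next_of_next (h : PosArrangement n pos) {K : ℕ → ℕ} {p q v : ℕ} (hp : p < n) (hq : q < n)
    (hpq : p ≠ q) (h1 : pos p q + 1 = K p) (h2 : pos q p + 1 = K q)
    (hu : pos q p = 0 ∨ ∃ u, u < n ∧ u ≠ p ∧ u ≠ q ∧ pos p u + 1 = pos p q ∧ pos q u + 1 = pos q p)
    (hv : Next n pos K p v) : Next n pos K q v := by
  obtain ⟨hvn, hvp, pv⟩ := hv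
  have hvq : v ≠ q := by rintro rfl; omega
  refine ⟨hvn, hvq, ?_⟩
  have h3 := (h.adj hp hq hvn hpq.symm hvp (by omega)).1
  rcases hu with hu | ⟨u, hun, hup, huq, e1, e2⟩
  · omega
  · by_contra hc
    have : u = v := h.inj hq hun hvn huq hvq (by omega)
    subst this
    omega

/-- The alternatives in `hu` are the two origins of a block: a pair of first crossings, or a
crossing that closes a triangle whose third line `u` both lines have crossed immediately before. -/
theorem BlockOk.mk' (h : PosArrangement n pos) {K : ℕ → ℕ} {b : Block} (hp : b.p.lab < n)
    (hq : b.q.lab < n) (hpq : b.p.lab ≠ b.q.lab) (h1 : pos b.p.lab b.q.lab + 1 = K b.p.lab)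
    (h2 : pos b.q.lab b.p.lab + 1 = K b.q.lab)
    (hu : (pos b.p.lab b.q.lab = 0 ∧ pos b.q.lab b.p.lab = 0) ∨
      ∃ u, u < n ∧ u ≠ b.p.lab ∧ u ≠ b.q.lab ∧ pos b.p.lab u + 1 = pos b.p.lab b.q.lab ∧
        pos b.q.lab u + 1 = pos b.q.lab b.p.lab) : BlockOk n pos K b where
  ne := hpq
  left := h1
  right := h2
  next v := by
    constructor
    · refine next_of_next h hp hq hpq h1 h2 ?_
      rcases hu with hu | ⟨u, a, b, c, d, e⟩
      · exact Or.inl hu.2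
      · exact Or.inr ⟨u, a, b, c, d, e⟩
    · refine next_of_next h hq hp hpq.symm h2 h1 ?_
      rcases hu with hu | ⟨u, a, b, c, d, e⟩
      · exact Or.inl hu.1
      · exact Or.inr ⟨u, a, c, b, e, d⟩

/-- The list `S` of lines, from the lowest to the highest, is a state of the sweep. -/
structure StateOk (n : ℕ) (pos : ℕ → ℕ → ℕ) (K : ℕ → ℕ) (S : List Strand) : Prop where
  strand : ∀ s ∈ S, StrandOk n pos (K s.lab) s
  below : S.Pairwise fun s t => s.lab ≠ t.lab ∧ Below pos K s.lab t.lab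
  mem : ∀ x, x < n → ∃ s ∈ S, s.lab = x

/-- Supplies the hypotheses of `next_of_up_down` for two consecutive lines of a state. -/
theorem StateOk.adjacent {K : ℕ → ℕ} {A B : List Strand} {x y : Strand}
    (hS : StateOk n pos K (A ++ x :: y :: B)) :
    x.lab ≠ y.lab ∧ Below pos K x.lab y.lab ∧ ∀ z, z < n → z ≠ x.lab → z ≠ y.lab →
      (Below pos K z x.lab ∧ Below pos K z y.lab) ∨
        (Below pos K x.lab z ∧ Below pos K y.lab z) := by
  have hb := hS.below
  simp only [List.pairwise_append, List.pairwise_cons, List.mem_cons] at hb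
  obtain ⟨-, ⟨hx, hy, -⟩, hA⟩ := hb
  refine ⟨(hx y (Or.inl rfl)).1, (hx y (Or.inl rfl)).2, ?_⟩
  intro z hz hzx hzy
  obtain ⟨s, hs, rfl⟩ := hS.mem z hz
  simp only [List.mem_append, List.mem_cons] at hs
  rcases hs with hs | rfl | rfl | hs
  · exact Or.inl ⟨(hA s hs x (Or.inl rfl)).2, (hA s hs y (Or.inr (Or.inl rfl))).2⟩
  · exact absurd rfl hzx
  · exact absurd rfl hzy
  · exact Or.inr ⟨(hx s (Or.inr hs)).2, (hy s hs).2⟩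

/-- The counters after the crossings between two neighbouring blocks. -/
def advanceK (K : ℕ → ℕ) (a b c d : ℕ) (x : ℕ) : ℕ :=
  if x = a ∨ x = d then K x + 1 else if x = b ∨ x = c then K x + 2 else K x

/-- On `b`, line `c` follows `a`, so `a` and `b` are neighbours on `c`; the place before `b` is held
by `d`, hence `a` comes right after `b`. -/
theorem pos_of_exchange (h : PosArrangement n pos) {K : ℕ → ℕ} {a b c d : ℕ} (ha : a < n)
    (hb : b < n) (hc : c < n) (hab : a ≠ b) (hac : a ≠ c) (had : a ≠ d) (hbc : b ≠ c)
    (hcd : c ≠ d) (hd : d < n) (bac : pos b a + 1 = K b) (pbc : pos b c = K b)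
    (cdb : pos c d + 1 = K c) (pcb : pos c b = K c) : pos c a = K c + 1 := by
  have h1 := (h.adj hb ha hc hab hbc.symm (by omega)).2
  rcases h1 with h1 | h1
  · omega
  · exact absurd (h.inj hc ha hd hac hcd.symm (by omega)) had

/-- Once `b` and `c` are about to cross, the common next line of each block forces `a` to meet `c`
and `d` to meet `b`, and the triangle property puts these right after the crossing of `b` and `c`.
The pairs `c, a` and `d, b` have then just crossed. The relative position of all other pairs stays
the same, and the tests in `exchange` hold. -/
theorem StateOk.exchange (h : Normalized n pos) {K : ℕ → ℕ} {A B : List Strand}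
    {a b c d : Strand} (hS : StateOk n pos K (A ++ a :: b :: c :: d :: B))
    (hu : BlockOk n pos K ⟨a, b⟩) (hv : BlockOk n pos K ⟨c, d⟩)
    (hbc : pos b.lab c.lab = K b.lab) (hcb : pos c.lab b.lab = K c.lab) :
    let K' := advanceK K a.lab b.lab c.lab d.lab
    StateOk n pos K' (A ++ (c.cross b).cross a :: a.cross c :: d.cross b ::
        (b.cross c).cross d :: B) ∧
      BlockOk n pos K' ⟨(c.cross b).cross a, a.cross c⟩ ∧
      BlockOk n pos K' ⟨d.cross b, (b.cross c).cross d⟩ ∧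
      (∀ s ∈ A ++ B, K' s.lab = K s.lab) ∧
      a.meets c = true ∧ b.meets c = true ∧ c.meets b = true ∧ d.meets b = true ∧
      (c.cross b).meets a = true ∧ (b.cross c).meets d = true := by
  intro K'
  have hp := hS.below
  simp only [List.pairwise_append, List.pairwise_cons, List.mem_cons] at hp
  obtain ⟨hA, ⟨ha, hb, hc, hd, hB⟩, hAB⟩ := hp
  have sa := hS.strand a (by simp)
  have sb := hS.strand b (by simp)
  have sc := hS.strand c (by simp)
  have sd := hS.strand d (by simp)
  obtain ⟨nab, Bab⟩ := ha b (by simp)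
  obtain ⟨nac, Bac⟩ := ha c (by simp)
  obtain ⟨nad, Bad⟩ := ha d (by simp)
  obtain ⟨nbc, Bbc⟩ := hb c (by simp)
  obtain ⟨nbd, Bbd⟩ := hb d (by simp)
  obtain ⟨ncd, Bcd⟩ := hc d (by simp)
  have pac : pos a.lab c.lab = K a.lab := ((hu.next c.lab).2 ⟨sc.lt, nbc.symm, hbc⟩).2.2
  have pdb : pos d.lab b.lab = K d.lab := ((hv.next b.lab).1 ⟨sb.lt, nbc, hcb⟩).2.2
  have pab : pos a.lab b.lab + 1 = K a.lab := hu.left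
  have pba : pos b.lab a.lab + 1 = K b.lab := hu.right
  have pcd : pos c.lab d.lab + 1 = K c.lab := hv.left
  have pdc : pos d.lab c.lab + 1 = K d.lab := hv.right
  have pca := pos_of_exchange h.toPosArrangement sa.lt sb.lt sc.lt nab nac nad nbc ncd sd.lt pba hbc
    pcd hcb
  have pbd := pos_of_exchange h.toPosArrangement sd.lt sc.lt sb.lt ncd.symm nbd.symm nad.symm
    nbc.symm nab.symm sa.lt pcd hcb pba hbc
  have Ka : K' a.lab = K a.lab + 1 := by simp [K', advanceK]
  have Kd : K' d.lab = K d.lab + 1 := by simp [K', advanceK]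
  have Kb : K' b.lab = K b.lab + 2 := by simp [K', advanceK, nab.symm, nbd]
  have Kc : K' c.lab = K c.lab + 2 := by simp [K', advanceK, nac.symm, ncd]
  have Kz : ∀ z, z ≠ a.lab → z ≠ b.lab → z ≠ c.lab → z ≠ d.lab → K' z = K z := by
    intro z h1 h2 h3 h4; simp [K', advanceK, h1, h2, h3, h4]
  have Ca : ∀ z, z < n → z ≠ a.lab → z ≠ c.lab →
      (pos a.lab z < K' a.lab ↔ pos a.lab z < K a.lab) := by
    intro z hz h1 h2
    have := h.ne sa.lt hz sc.lt h1 nac.symm h2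
    omega
  have Cd : ∀ z, z < n → z ≠ d.lab → z ≠ b.lab →
      (pos d.lab z < K' d.lab ↔ pos d.lab z < K d.lab) := by
    intro z hz h1 h2
    have := h.ne sd.lt hz sb.lt h1 nbd h2
    omega
  have Cb : ∀ z, z < n → z ≠ b.lab → z ≠ c.lab → z ≠ d.lab →
      (pos b.lab z < K' b.lab ↔ pos b.lab z < K b.lab) := by
    intro z hz h1 h2 h3
    have := h.ne sb.lt hz sc.lt h1 nbc.symm h2
    have := h.ne sb.lt hz sd.lt h1 nbd.symm h3
    omega
  have Cc : ∀ z, z < n → z ≠ c.lab → z ≠ b.lab → z ≠ a.lab →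
      (pos c.lab z < K' c.lab ↔ pos c.lab z < K c.lab) := by
    intro z hz h1 h2 h3
    have := h.ne sc.lt hz sb.lt h1 nbc h2
    have := h.ne sc.lt hz sa.lt h1 nac h3
    omega
  have mid : ∀ s ∈ A ++ B, s.lab < n ∧ s.lab ≠ a.lab ∧ s.lab ≠ b.lab ∧ s.lab ≠ c.lab ∧
      s.lab ≠ d.lab := by
    intro s hs
    refine ⟨(hS.strand s (by simp at hs ⊢; tauto)).lt, ?_⟩
    rcases List.mem_append.1 hs with hs | hs
    · exact ⟨(hAB s hs a (by simp)).1, (hAB s hs b (by simp)).1, (hAB s hs c (by simp)).1,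
        (hAB s hs d (by simp)).1⟩
    · exact ⟨(ha s (by simp [hs])).1.symm, (hb s (by simp [hs])).1.symm,
        (hc s (by simp [hs])).1.symm, (hd s hs).1.symm⟩
  have Km : ∀ s ∈ A ++ B, K' s.lab = K s.lab := fun s hs =>
    Kz _ (mid s hs).2.1 (mid s hs).2.2.1 (mid s hs).2.2.2.1 (mid s hs).2.2.2.2
  have Cm : ∀ s ∈ A ++ B, ∀ z, (pos s.lab z < K' s.lab ↔ pos s.lab z < K s.lab) := by
    intro s hs z; rw [Km s hs]
  have c1 : StrandOk n pos (K c.lab + 1) (c.cross b) :=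
    sc.cross' h.toPosArrangement sb nbc hcb
  have b1 : StrandOk n pos (K b.lab + 1) (b.cross c) :=
    sb.cross' h.toPosArrangement sc nbc.symm hbc
  have c2 : StrandOk n pos (K c.lab + 2) ((c.cross b).cross a) :=
    c1.cross' h.toPosArrangement sa nac pca
  have b2 : StrandOk n pos (K b.lab + 2) ((b.cross c).cross d) :=
    b1.cross' h.toPosArrangement sd nbd.symm pbd
  have a1 : StrandOk n pos (K a.lab + 1) (a.cross c) :=
    sa.cross' h.toPosArrangement sc nac.symm pac
  have d1 : StrandOk n pos (K d.lab + 1) (d.cross b) :=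
    sd.cross' h.toPosArrangement sb nbd pdb
  have mA : ∀ s, s ∈ A → s ∈ A ++ B := fun s hs => List.mem_append_left B hs
  have mB : ∀ s, s ∈ B → s ∈ A ++ B := fun s hs => List.mem_append_right A hs
  refine ⟨⟨?_, ?_, ?_⟩, ?_, ?_, Km, sa.meets h sc nac.symm pac, sb.meets h sc nbc.symm hbc,
    sc.meets h sb nbc hcb, sd.meets h sb nbd pdb, c1.meets h sa nac pca,
    b1.meets h sd nbd.symm pbd⟩
  · intro s hs
    simp only [List.mem_append, List.mem_cons] at hs
    have old : s ∈ A ++ B → StrandOk n pos (K' s.lab) s := by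
      intro hs
      rw [Km s hs]
      exact hS.strand s (by simp at hs ⊢; tauto)
    rcases hs with hs | rfl | rfl | rfl | rfl | hs
    · exact old (mA s hs)
    · simpa [Kc] using c2
    · simpa [Ka] using a1
    · simpa [Kd] using d1
    · simpa [Kb] using b2
    · exact old (mB s hs)
  · have keep : ∀ {x y : ℕ}, (x ≠ y ∧ Below pos K x y) → (pos x y < K' x ↔ pos x y < K x) →
        (pos y x < K' y ↔ pos y x < K y) → x ≠ y ∧ Below pos K' x y := by
      intro x y hxy h1 h2
      unfold Below at *
      rw [h1, h2]
      exact hxy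
    have swap : ∀ {x y : ℕ}, x ≠ y → Below pos K x y → K x ≤ pos x y →
        pos x y < K' x → pos y x < K' y → y ≠ x ∧ Below pos K' y x := by
      intro x y hne hxy h1 h2 h3
      unfold Below at *
      have : x < y := by have := hxy.1; omega
      exact ⟨hne.symm, by simp [h3, this], by simp [h2, this]⟩
    have low : ∀ s ∈ A, (∀ t ∈ A, (s.lab ≠ t.lab ∧ Below pos K s.lab t.lab) →
        (s.lab ≠ t.lab ∧ Below pos K' s.lab t.lab)) := by
      intro s hs t ht hst
      exact keep hst (Cm s (mA s hs) _) (Cm t (mA t ht) _)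
    simp only [List.pairwise_append, List.pairwise_cons, List.mem_cons, Strand.lab_cross]
    refine ⟨hA.imp_of_mem fun {s t} hs ht => low s hs t ht, ⟨?_, ?_, ?_, ?_, ?_⟩, ?_⟩
    · rintro t (rfl | rfl | rfl | ht)
      · exact swap nac Bac pac.ge (by simp; omega) (by simp; omega)
      · exact keep ⟨ncd, Bcd⟩ (Cc _ sd.lt ncd.symm nbd.symm nad.symm)
          (Cd _ sc.lt ncd nbc.symm)
      · exact swap nbc Bbc hbc.ge (by simp; omega) (by simp; omega)
      · obtain ⟨m1, m2, m3, m4, m5⟩ := mid t (mB t ht)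
        exact keep (hc t (by simp [ht])) (Cc _ m1 m4 m3 m2) (Cm t (mB t ht) _)
    · rintro t (rfl | rfl | ht)
      · exact keep ⟨nad, Bad⟩ (Ca _ sd.lt nad.symm ncd.symm) (Cd _ sa.lt nad nab)
      · exact keep ⟨nab, Bab⟩ (Ca _ sb.lt nab.symm nbc) (Cb _ sa.lt nab nac nad)
      · obtain ⟨m1, m2, m3, m4, m5⟩ := mid t (mB t ht)
        exact keep (ha t (by simp [ht])) (Ca _ m1 m2 m4) (Cm t (mB t ht) _)
    · rintro t (rfl | ht)
      · exact swap nbd Bbd (by simp only [Strand.lab_cross]; omega) (by simp; omega) (by simp; omega)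
      · obtain ⟨m1, m2, m3, m4, m5⟩ := mid t (mB t ht)
        exact keep (hd t ht) (Cd _ m1 m5 m3) (Cm t (mB t ht) _)
    · intro t ht
      obtain ⟨m1, m2, m3, m4, m5⟩ := mid t (mB t ht)
      exact keep (hb t (by simp [ht])) (Cb _ m1 m3 m4 m5) (Cm t (mB t ht) _)
    · exact hB.imp_of_mem fun {s t} hs ht hst =>
        keep hst (Cm s (mB s hs) _) (Cm t (mB t ht) _)
    · intro s hs t ht
      obtain ⟨m1, m2, m3, m4, m5⟩ := mid s (mA s hs)
      rcases ht with rfl | rfl | rfl | rfl | ht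
      · exact keep (hAB s hs c (by simp)) (Cm s (mA s hs) _) (Cc _ m1 m4 m3 m2)
      · exact keep (hAB s hs a (by simp)) (Cm s (mA s hs) _) (Ca _ m1 m2 m4)
      · exact keep (hAB s hs d (by simp)) (Cm s (mA s hs) _) (Cd _ m1 m5 m3)
      · exact keep (hAB s hs b (by simp)) (Cm s (mA s hs) _) (Cb _ m1 m3 m4 m5)
      · exact keep (hAB s hs t (by simp [ht])) (Cm s (mA s hs) _) (Cm t (mB t ht) _)
  · intro x hx
    obtain ⟨s, hs, rfl⟩ := hS.mem x hx
    simp only [List.mem_append, List.mem_cons] at hs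
    rcases hs with hs | rfl | rfl | rfl | rfl | hs
    · exact ⟨s, by simp [hs], rfl⟩
    · exact ⟨s.cross c, by simp, rfl⟩
    · exact ⟨(s.cross c).cross d, by simp, rfl⟩
    · exact ⟨(s.cross b).cross a, by simp, rfl⟩
    · exact ⟨s.cross b, by simp, rfl⟩
    · exact ⟨s, by simp [hs], rfl⟩
  -- The triangle behind the crossing of `c` and `a` has third line `b`; for `d` and `b`, below, it
  -- is `c`.
  · refine BlockOk.mk' h.toPosArrangement sc.lt sa.lt nac.symm ?_ ?_
      (Or.inr ⟨b.lab, sb.lt, nbc, nab.symm, ?_, ?_⟩) <;> simp <;> omega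
  · refine BlockOk.mk' h.toPosArrangement sd.lt sb.lt nbd.symm ?_ ?_
      (Or.inr ⟨c.lab, sc.lt, ncd, nbc.symm, ?_, ?_⟩) <;> simp <;> omega

end

section

variable {n : ℕ} {pos : ℕ → ℕ → ℕ}

/-- The first crossing of line `n - 1` is with line `0`, so `b` is line `0`; this is also the last
crossing of line `0`, so the new top line is finished. As in a block exchange, `a` then crosses `z`
as well. -/
theorem StateOk.exchangeTop (h : Normalized n pos) {K : ℕ → ℕ} {A : List Strand}
    {a b z : Strand} (hS : StateOk n pos K (A ++ [a, b, z]))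
    (hu : BlockOk n pos K ⟨a, b⟩) (hz : z.lab + 1 = n) (hKz : K z.lab = 0)
    (hbz : pos b.lab z.lab = K b.lab) (hzb : pos z.lab b.lab = K z.lab) :
    let K' := fun x => if x = z.lab then K x + 2 else if x = a.lab ∨ x = b.lab then K x + 1 else K x
    StateOk n pos K' (A ++ [(z.cross b).cross a, a.cross z, b.cross z]) ∧
      BlockOk n pos K' ⟨(z.cross b).cross a, a.cross z⟩ ∧
      (∀ s ∈ A, K' s.lab = K s.lab) ∧ b.lab = 0 ∧ K' b.lab + 1 = n ∧
      a.meets z = true ∧ b.meets z = true ∧ z.meets b = true ∧ (z.cross b).meets a = true := by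
  intro K'
  have hp := hS.below
  simp only [List.pairwise_append, List.pairwise_cons, List.mem_cons] at hp
  obtain ⟨hA, ⟨ha, hb, -⟩, hAB⟩ := hp
  have sa := hS.strand a (by simp)
  have sb := hS.strand b (by simp)
  have sz := hS.strand z (by simp)
  obtain ⟨nab, Bab⟩ := ha b (by simp)
  obtain ⟨naz, Baz⟩ := ha z (by simp)
  obtain ⟨nbz, Bbz⟩ := hb z (by simp)
  have paz : pos a.lab z.lab = K a.lab := ((hu.next z.lab).2 ⟨sz.lt, nbz.symm, hbz⟩).2.2
  have pab : pos a.lab b.lab + 1 = K a.lab := hu.left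
  have pba : pos b.lab a.lab + 1 = K b.lab := hu.right
  have hlast := h.pos_last_zero h.three_le h.first h.odd
  have three := h.three_le
  have ez : n - 1 = z.lab := by omega
  rw [ez] at hlast
  have hb0 : b.lab = 0 := h.inj sz.lt sb.lt (by omega) nbz (by omega) (by omega)
  have pza : pos z.lab a.lab = K z.lab + 1 := by
    rcases (h.adj sb.lt sa.lt sz.lt nab nbz.symm (by omega)).2 with h1 | h1 <;> omega
  have Kz : K' z.lab = K z.lab + 2 := by simp [K']
  have Ka : K' a.lab = K a.lab + 1 := by simp [K', naz]
  have Kb : K' b.lab = K b.lab + 1 := by simp [K', nbz]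
  have Ca : ∀ x, x < n → x ≠ a.lab → x ≠ z.lab →
      (pos a.lab x < K' a.lab ↔ pos a.lab x < K a.lab) := by
    intro x hx h1 h2
    have := h.ne sa.lt hx sz.lt h1 naz.symm h2
    omega
  have Cb : ∀ x, x < n → x ≠ b.lab → x ≠ z.lab →
      (pos b.lab x < K' b.lab ↔ pos b.lab x < K b.lab) := by
    intro x hx h1 h2
    have := h.ne sb.lt hx sz.lt h1 nbz.symm h2
    omega
  have Cz : ∀ x, x < n → x ≠ z.lab → x ≠ b.lab → x ≠ a.lab →
      (pos z.lab x < K' z.lab ↔ pos z.lab x < K z.lab) := by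
    intro x hx h1 h2 h3
    have := h.ne sz.lt hx sb.lt h1 nbz h2
    have := h.ne sz.lt hx sa.lt h1 naz h3
    omega
  have mid : ∀ s ∈ A, s.lab < n ∧ s.lab ≠ a.lab ∧ s.lab ≠ b.lab ∧ s.lab ≠ z.lab := fun s hs =>
    ⟨(hS.strand s (by simp [hs])).lt, (hAB s hs a (by simp)).1, (hAB s hs b (by simp)).1,
      (hAB s hs z (by simp)).1⟩
  have Km : ∀ s ∈ A, K' s.lab = K s.lab := by
    intro s hs
    obtain ⟨-, h1, h2, h3⟩ := mid s hs
    simp [K', h1, h2, h3]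
  have Cm : ∀ s ∈ A, ∀ x, (pos s.lab x < K' s.lab ↔ pos s.lab x < K s.lab) := by
    intro s hs x; rw [Km s hs]
  have z1 : StrandOk n pos (K z.lab + 1) (z.cross b) := sz.cross' h.toPosArrangement sb nbz hzb
  have z2 : StrandOk n pos (K z.lab + 2) ((z.cross b).cross a) :=
    z1.cross' h.toPosArrangement sa naz pza
  have a1 : StrandOk n pos (K a.lab + 1) (a.cross z) :=
    sa.cross' h.toPosArrangement sz naz.symm paz
  have b1 : StrandOk n pos (K b.lab + 1) (b.cross z) :=
    sb.cross' h.toPosArrangement sz nbz.symm hbz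
  have zlt := sz.lt
  have alt := sa.lt
  refine ⟨⟨?_, ?_, ?_⟩, ?_, Km, hb0, ?_, sa.meets h sz naz.symm paz, sb.meets h sz nbz.symm hbz,
    sz.meets h sb nbz hzb, z1.meets h sa naz pza⟩
  · intro s hs
    simp only [List.mem_append, List.mem_cons, List.not_mem_nil, or_false] at hs
    rcases hs with hs | rfl | rfl | rfl
    · rw [Km s hs]
      exact hS.strand s (by simp [hs])
    · simpa [Kz] using z2
    · simpa [Ka] using a1
    · simpa [Kb] using b1
  · have keep : ∀ {x y : ℕ}, (x ≠ y ∧ Below pos K x y) → (pos x y < K' x ↔ pos x y < K x) →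
        (pos y x < K' y ↔ pos y x < K y) → x ≠ y ∧ Below pos K' x y := by
      intro x y hxy h1 h2
      unfold Below at *
      rw [h1, h2]
      exact hxy
    have swap : ∀ {x y : ℕ}, x ≠ y → x < y → pos x y < K' x → pos y x < K' y →
        y ≠ x ∧ Below pos K' y x := by
      intro x y hne hxy h2 h3
      unfold Below at *
      exact ⟨hne.symm, by simp [h3, hxy], by simp [h2, hxy]⟩
    simp only [List.pairwise_append, List.pairwise_cons, List.mem_cons, Strand.lab_cross,
      List.not_mem_nil, or_false, List.Pairwise.nil, and_true]
    refine ⟨hA.imp_of_mem fun {s t} hs ht hst => keep hst (Cm s hs _) (Cm t ht _),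
      ⟨?_, ?_, by simp⟩, ?_⟩
    · rintro t (rfl | rfl)
      · exact swap naz (by simp only [Strand.lab_cross]; omega) (by simp only [Strand.lab_cross]; omega)
          (by simp only [Strand.lab_cross]; omega)
      · exact swap nbz (by simp only [Strand.lab_cross]; omega) (by simp only [Strand.lab_cross]; omega)
          (by simp only [Strand.lab_cross]; omega)
    · rintro t rfl
      exact keep ⟨nab, Bab⟩ (Ca _ sb.lt nab.symm nbz) (Cb _ sa.lt nab naz)
    · intro s hs t ht
      obtain ⟨m1, m2, m3, m4⟩ := mid s hs
      rcases ht with rfl | rfl | rfl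
      · exact keep (hAB s hs z (by simp)) (Cm s hs _) (Cz _ m1 m4 m3 m2)
      · exact keep (hAB s hs a (by simp)) (Cm s hs _) (Ca _ m1 m2 m4)
      · exact keep (hAB s hs b (by simp)) (Cm s hs _) (Cb _ m1 m3 m4)
  · intro x hx
    obtain ⟨s, hs, rfl⟩ := hS.mem x hx
    simp only [List.mem_append, List.mem_cons, List.not_mem_nil, or_false] at hs
    rcases hs with hs | rfl | rfl | rfl
    · exact ⟨s, by simp [hs], rfl⟩
    · exact ⟨s.cross z, by simp, rfl⟩
    · exact ⟨s.cross z, by simp, rfl⟩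
    · exact ⟨(s.cross b).cross a, by simp, rfl⟩
  · refine BlockOk.mk' h.toPosArrangement sz.lt sa.lt naz.symm ?_ ?_
      (Or.inr ⟨b.lab, sb.lt, nbz, nab.symm, ?_, ?_⟩) <;> simp <;> omega
  · have e : pos b.lab z.lab + 2 = n := by rw [hb0]; exact hlast.2
    omega

/-! ### Soundness of the search -/

/-- The next crossing of the block is upwards, if it has one. -/
def Up (n : ℕ) (pos : ℕ → ℕ → ℕ) (K : ℕ → ℕ) (b : Block) : Prop :=
  ∀ v, Next n pos K b.p.lab v → b.p.lab < v

theorem Up.congr {K K' : ℕ → ℕ} {b : Block} (h : K' b.p.lab = K b.p.lab) (hb : Up n pos K b) :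
    Up n pos K' b := by
  intro v hv
  exact hb v ⟨hv.1, hv.2.1, by rw [← h]; exact hv.2.2⟩

theorem BlockOk.congr {K K' : ℕ → ℕ} {b : Block} (h1 : K' b.p.lab = K b.p.lab)
    (h2 : K' b.q.lab = K b.q.lab) (hb : BlockOk n pos K b) : BlockOk n pos K' b where
  ne := hb.ne
  left := by rw [h1]; exact hb.left
  right := by rw [h2]; exact hb.right
  next v := by
    have := hb.next v
    unfold Next at *
    rw [h1, h2]
    exact this

/-- The blocks `bs` and the line `z` above them are a state of the sweep. -/
structure SweepOk (n : ℕ) (pos : ℕ → ℕ → ℕ) (K : ℕ → ℕ) (bs : List Block) (z : Strand) : Prop where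
  state : StateOk n pos K (lines bs ++ [z])
  block : ∀ b ∈ bs, BlockOk n pos K b
  top : (z.lab + 1 = n ∧ K z.lab = 0) ∨ (z.lab = 0 ∧ K z.lab + 1 = n)

theorem mem_lines {s : Strand} {bs : List Block} :
    s ∈ lines bs ↔ ∃ b ∈ bs, s = b.p ∨ s = b.q := by
  simp [lines]

/-- For a state that agrees with the arrangement no test of `exchange` fails and no line is `bad`,
so its value is that of the continuation at the true next state. -/
theorem SweepOk.exchange (h : Normalized n pos) {bad : Strand → Bool}
    (hbad : ∀ k s, StrandOk n pos k s → bad s = false) {K : ℕ → ℕ} {bs cs : List Block}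
    {u v : Block} {z : Strand} (hS : SweepOk n pos K (bs ++ u :: v :: cs) z)
    (h1 : pos u.q.lab v.p.lab = K u.q.lab) (h2 : pos v.p.lab u.q.lab = K v.p.lab)
    {k : Block → Block → Bool} (hk : _root_.exchange bad u v k = true) :
    ∃ K' u' v', k u' v' = true ∧ SweepOk n pos K' (bs ++ u' :: v' :: cs) z ∧
      v'.q.lab = u.q.lab ∧ K' u.q.lab = K u.q.lab + 2 ∧
      (∀ b ∈ bs ++ cs, K' b.p.lab = K b.p.lab ∧ K' b.q.lab = K b.q.lab) := by
  obtain ⟨a, b⟩ := u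
  obtain ⟨c, d⟩ := v
  have hS' : StateOk n pos K (lines bs ++ a :: b :: c :: d :: (lines cs ++ [z])) := by
    have := hS.state
    simpa using this
  obtain ⟨s1, s2, s3, s4, m1, m2, m3, m4, m5, m6⟩ :=
    hS'.exchange h (hS.block _ (by simp)) (hS.block _ (by simp)) h1 h2
  have hsame : ∀ x ∈ bs ++ cs,
      advanceK K a.lab b.lab c.lab d.lab x.p.lab = K x.p.lab ∧
        advanceK K a.lab b.lab c.lab d.lab x.q.lab = K x.q.lab := by
    intro x hx
    have hx' : x.p ∈ lines (bs ++ cs) ∧ x.q ∈ lines (bs ++ cs) :=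
      ⟨mem_lines.2 ⟨x, hx, Or.inl rfl⟩, mem_lines.2 ⟨x, hx, Or.inr rfl⟩⟩
    simp only [lines_append, List.mem_append] at hx'
    constructor
    · exact s4 _ (by simp; tauto)
    · exact s4 _ (by simp; tauto)
  have hbb : bad ((b.cross c).cross d) = false := by
    refine hbad _ _ (s1.strand _ ?_)
    simp
  simp only [_root_.exchange, m1, m2, m3, m4, m5, m6, hbb, Bool.and_self, cond_true,
    cond_false] at hk
  have nbz := hS'.below
  simp only [List.pairwise_append, List.pairwise_cons, List.mem_cons, List.mem_append] at nbz
  have nbc : b.lab ≠ c.lab := (nbz.2.1.2.1 c (by simp)).1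
  have nbd : b.lab ≠ d.lab := (nbz.2.1.2.1 d (by simp)).1
  have nab : a.lab ≠ b.lab := (nbz.2.1.1 b (by simp)).1
  refine ⟨_, _, _, hk, ⟨?_, ?_, ?_⟩, rfl, ?_, hsame⟩
  · simpa using s1
  · intro x hx
    simp only [List.mem_append, List.mem_cons] at hx
    rcases hx with hx | rfl | rfl | hx
    · have := hsame x (by simp [hx])
      exact (hS.block x (by simp [hx])).congr this.1 this.2
    · exact s2
    · exact s3
    · have := hsame x (by simp [hx])
      exact (hS.block x (by simp [hx])).congr this.1 this.2
  · rw [s4 z (by simp)]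
    exact hS.top
  · simp [advanceK, nab.symm, nbd]

theorem StrandOk.not_next_of_rem (h : PosArrangement n pos) {K : ℕ → ℕ} {s : Strand}
    (hs : StrandOk n pos (K s.lab) s) : (s.rem = 0 ↔ ∀ v, ¬ Next n pos K s.lab v) := by
  constructor
  · intro h0 v hv
    have := (hs.rem v).2 ⟨hv.1, hv.2.1, hv.2.2.ge⟩
    simp [h0] at this
  · intro hv
    apply Nat.eq_of_testBit_eq
    intro j
    rw [Nat.zero_testBit, Bool.eq_false_iff]
    intro hj
    obtain ⟨a, b, c⟩ := (hs.rem j).1 hj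
    have := h.lt hs.lt a b
    obtain ⟨v, hv'⟩ := h.exists_next hs.lt (K := K) (by omega)
    exact hv v hv'

theorem BlockOk.exists_next (h : PosArrangement n pos) {K : ℕ → ℕ} {b : Block}
    (hb : BlockOk n pos K b) (hp : StrandOk n pos (K b.p.lab) b.p)
    (hq : StrandOk n pos (K b.q.lab) b.q) (hf : b.finished = false) :
    ∃ v, Next n pos K b.p.lab v := by
  by_contra hc
  push Not at hc
  have h1 := (hp.not_next_of_rem h).2 hc
  have h2 := (hq.not_next_of_rem h).2 fun v hv => hc v ((hb.next v).2 hv)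
  simp [Block.finished, h1, h2] at hf

theorem Block.up_of_finished (h : PosArrangement n pos) {K : ℕ → ℕ} {b : Block}
    (hp : StrandOk n pos (K b.p.lab) b.p) (hf : b.finished = true) : Up n pos K b := by
  have h1 : b.p.rem + b.q.rem = 0 := Nat.eq_of_beq_eq_true hf
  intro v hv
  exact absurd hv ((hp.not_next_of_rem h).1 (by omega) v)

theorem Block.canUp_of_next (h : Normalized n pos) {K : ℕ → ℕ} {b : Block}
    (hb : BlockOk n pos K b) (hp : StrandOk n pos (K b.p.lab) b.p)
    (hq : StrandOk n pos (K b.q.lab) b.q) {v : ℕ} (hv : Next n pos K b.p.lab v)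
    (hlt : b.p.lab < v) : b.canUp = true := by
  obtain ⟨p1, p2, p3⟩ := h.mate hp.lt
  obtain ⟨q1, q2, q3⟩ := h.mate hq.lt
  have hv' := (hb.next v).1 hv
  have t1 := hp.avail h.toPosArrangement p3 p1 p2 hv.1 hv.2.1 hv.2.2
  have t2 := hq.avail h.toPosArrangement q3 q1 q2 hv'.1 hv'.2.1 hv'.2.2
  have t3 : (b.p.avail &&& b.q.avail).testBit v = true := by rw [Nat.testBit_and, t1, t2]; rfl
  have t4 := Nat.ge_two_pow_of_testBit t3
  unfold Block.canUp
  rw [Nat.ble_eq, hp.bit]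
  refine le_trans ?_ t4
  calc 2 ^ b.p.lab + 2 ^ b.p.lab = 2 ^ (b.p.lab + 1) := by ring
    _ ≤ 2 ^ v := Nat.pow_le_pow_right (by norm_num) hlt

theorem Block.canDown_of_next (h : Normalized n pos) {K : ℕ → ℕ} {b : Block}
    (hb : BlockOk n pos K b) (hp : StrandOk n pos (K b.p.lab) b.p)
    (hq : StrandOk n pos (K b.q.lab) b.q) {v : ℕ} (hv : Next n pos K b.p.lab v)
    (hlt : v < b.q.lab) : b.canDown = true := by
  obtain ⟨p1, p2, p3⟩ := h.mate hp.lt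
  obtain ⟨q1, q2, q3⟩ := h.mate hq.lt
  have hv' := (hb.next v).1 hv
  have t1 := hp.avail h.toPosArrangement p3 p1 p2 hv.1 hv.2.1 hv.2.2
  have t2 := hq.avail h.toPosArrangement q3 q1 q2 hv'.1 hv'.2.1 hv'.2.2
  have t3 : ((b.p.avail &&& b.q.avail) % 2 ^ b.q.lab).testBit v = true := by
    rw [Nat.testBit_mod_two_pow, Nat.testBit_and, t1, t2]; simp [hlt]
  unfold Block.canDown
  rw [hq.bit]
  have : (Nat.land b.p.avail b.q.avail % 2 ^ b.q.lab).beq 0 = false := by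
    rw [Bool.eq_false_iff]
    intro e
    replace e : (b.p.avail &&& b.q.avail) % 2 ^ b.q.lab = 0 := Nat.eq_of_beq_eq_true e
    rw [e] at t3
    simp at t3
  rw [this]
  rfl

theorem SweepOk.strand_of_mem {K : ℕ → ℕ} {bs : List Block} {z : Strand}
    (hS : SweepOk n pos K bs z) {b : Block} (hb : b ∈ bs) :
    StrandOk n pos (K b.p.lab) b.p ∧ StrandOk n pos (K b.q.lab) b.q :=
  ⟨hS.state.strand _ (List.mem_append_left _ (mem_lines.2 ⟨b, hb, Or.inl rfl⟩)),
    hS.state.strand _ (List.mem_append_left _ (mem_lines.2 ⟨b, hb, Or.inr rfl⟩))⟩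

/-- If the topmost line is finished and no block goes down, then all lines are finished. -/
theorem SweepOk.finished (h : Normalized n pos) {K : ℕ → ℕ} {bs : List Block} {z : Strand}
    (hS : SweepOk n pos K bs z) (hz : K z.lab + 1 = n) (hup : ∀ b ∈ bs, Up n pos K b) {x : ℕ}
    (hx : x < n) : K x + 1 = n := by
  by_contra hc
  have hle : ∀ y, y < n → K y < n := by
    intro y hy
    obtain ⟨s, hs, rfl⟩ := hS.state.mem y hy
    exact (hS.state.strand s hs).row.lt h.toPosArrangement hy
  have hne : ((Finset.range n).filter fun y => K y + 1 < n).Nonempty :=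
    ⟨x, by have := hle x hx; simp only [Finset.mem_filter, Finset.mem_range]; omega⟩
  -- The largest unfinished line is next crossed by a larger one, which has yet to cross it and is
  -- therefore unfinished as well.
  obtain ⟨y, hy, hmax⟩ := Finset.exists_max_image _ id hne
  simp only [Finset.mem_filter, Finset.mem_range, id] at hy hmax
  obtain ⟨s, hs, rfl⟩ := hS.state.mem y hy.1
  obtain ⟨v, hv⟩ := h.exists_next hy.1 hy.2
  have hsv : s.lab < v := by
    rcases List.mem_append.1 hs with hs | hs
    · obtain ⟨b, hb, hsb⟩ := mem_lines.1 hs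
      have h1 := hup b hb
      have h2 := (hS.block b hb).next v
      obtain ⟨sp, sq⟩ := hS.strand_of_mem hb
      rcases hsb with rfl | rfl
      · exact h1 v hv
      · have h3 := h1 v (h2.2 hv)
        have h4 := (hS.block b hb).left
        have h5 : b.q.lab < b.p.lab := by
          obtain ⟨l1, l2, rfl⟩ := List.append_of_mem hb
          have := hS.state.below
          simp only [lines_append, lines_cons, List.append_assoc, List.cons_append,
            List.pairwise_append, List.pairwise_cons, List.mem_cons] at this
          have := (this.2.1.1 b.q (Or.inl rfl)).2.1
          omega
        omega
    · simp only [List.mem_singleton] at hs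
      subst hs
      omega
  have hKv : K v + 1 < n := by
    obtain ⟨t, ht, rfl⟩ := hS.state.mem v hv.1
    have hst : s ≠ t := by rintro rfl; omega
    have h1 := h.lt hv.1 hy.1 hv.2.1.symm
    have h2 := hv.2.2
    have h3 : Below pos K s.lab t.lab ∨ Below pos K t.lab s.lab := by
      obtain ⟨l1, l2, hl⟩ := List.append_of_mem hs
      have hb := hS.state.below
      rw [hl] at hb ht
      simp only [List.pairwise_append, List.pairwise_cons] at hb
      simp only [List.mem_append, List.mem_cons] at ht
      rcases ht with ht | rfl | ht
      · exact Or.inr (hb.2.2 t ht s (by simp)).2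
      · exact absurd rfl hst
      · exact Or.inl (hb.2.1.1 t ht).2
    unfold Below at h3
    omega
  have := hmax v ⟨hv.1, hKv⟩
  omega

/-- A search that succeeds has met the arrangement. -/
theorem search_sound (h : Normalized n pos) {bad : Strand → Bool}
    (hbad : ∀ k s, StrandOk n pos k s → bad s = false) (leaf : List Block → Strand → Bool) :
    ∀ (f : ℕ) (st rest : List Block) (z : Strand) (K : ℕ → ℕ),
      SweepOk n pos K (st.reverse ++ rest) z → (∀ b ∈ st, Up n pos K b) →
      search bad leaf f st rest z = true →
      ∃ bs z, leaf bs z = true ∧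
        ∀ x, x < n → ∃ s ∈ lines bs ++ [z], s.lab = x ∧ StrandOk n pos (n - 1) s := by
  intro f
  induction f with
  | zero => intro st rest z K _ _ hs; simp [search] at hs
  | succ f ih =>
    intro st rest z K hS hup hs
    have three := h.three_le
    have zok : StrandOk n pos (K z.lab) z := hS.state.strand z (by simp)
    cases rest with
    | nil =>
      rw [List.append_nil] at hS
      unfold search at hs
      cases hz : z.rem with
      | zero =>
        simp only [hz] at hs
        refine ⟨st, z, hs, ?_⟩
        have hz1 : K z.lab + 1 = n := by
          by_contra hc
          have := zok.row.lt h.toPosArrangement zok.lt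
          obtain ⟨v, hv⟩ := h.exists_next zok.lt (K := K) (by omega)
          exact (zok.not_next_of_rem h.toPosArrangement).1 hz v hv
        intro x hx
        have hK := hS.finished h hz1 (fun b hb => hup b (by simpa using hb)) hx
        obtain ⟨s, hs1, rfl⟩ := hS.state.mem x hx
        refine ⟨s, ?_, rfl, ?_⟩
        · simp only [List.mem_append, mem_lines, List.mem_reverse] at hs1 ⊢
          exact hs1
        · have := hS.state.strand s hs1
          rwa [show n - 1 = K s.lab by omega]
      | succ m =>
        simp only [hz] at hs
        have hlast := h.pos_last_zero three h.first h.odd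
        obtain ⟨zl, zK⟩ : z.lab + 1 = n ∧ K z.lab = 0 := by
          rcases hS.top with ht | ht
          · exact ht
          · exfalso
            have := (zok.not_next_of_rem h.toPosArrangement).2 (by
              intro v hv
              have := h.lt zok.lt hv.1 hv.2.1
              have := hv.2.2
              omega)
            omega
        rw [show n - 1 = z.lab by omega] at hlast
        cases st with
        | nil =>
          exfalso
          obtain ⟨s, hs1, hs2⟩ := hS.state.mem 0 (by omega)
          simp at hs1
          subst hs1
          omega
        | cons u st =>
          simp only at hs
          obtain ⟨a, b⟩ := u
          have hS' : StateOk n pos K (lines st.reverse ++ [a, b, z]) := by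
            have := hS.state
            simpa using this
          have hS'' : StateOk n pos K ((lines st.reverse ++ [a]) ++ b :: z :: []) := by
            simpa using hS'
          obtain ⟨nbz, Bbz, hadj⟩ := hS''.adjacent
          have hu : BlockOk n pos K ⟨a, b⟩ := hS.block _ (by simp)
          have aok : StrandOk n pos (K a.lab) a := hS'.strand a (by simp)
          have bok : StrandOk n pos (K b.lab) b := hS'.strand b (by simp)
          have blt := bok.lt
          have pbz := h.lt bok.lt zok.lt nbz.symm
          -- Line `b` has not crossed `z`, so it is unfinished; its next crossing is upwards and
          -- that of `z` is downwards, with line `0`. Hence `b` and `z` meet.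
          obtain ⟨u, hbu⟩ := h.exists_next bok.lt (K := K) (by
            have := Bbz.1
            omega)
          have hau := (hu.next u).2 hbu
          have hup' : a.lab < u := hup ⟨a, b⟩ (by simp) u hau
          have hba : b.lab < a.lab := by
            have := hS'.below
            simp only [List.pairwise_append, List.pairwise_cons, List.mem_cons] at this
            have := (this.2.1.1 b (Or.inl rfl)).2.1
            have := hu.left
            simp only at this
            omega
          have hz0 : Next n pos K z.lab 0 := ⟨by omega, by omega, by omega⟩
          obtain ⟨e1, e2⟩ := h.next_of_up_down bok.lt zok.lt nbz hbu hz0 (by omega) (by omega) Bbz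
            hadj
          rw [e1] at hbu
          rw [e2] at hz0
          obtain ⟨s1, s2, s3, b0, Kb, m1, m2, m3, m4⟩ :=
            hS'.exchangeTop h hu zl zK hbu.2.2 hz0.2.2
          have bd : b.dig.beq 1 = true := by
            have := bok.dig_pos
            have h1 : b.dig = 1 := by unfold Strand.lab at b0; omega
            rw [h1]; rfl
          simp only [exchangeTop, m1, m2, m3, m4, bd, Bool.and_self, cond_true] at hs
          refine ih _ _ _ (fun x => if x = z.lab then K x + 2
            else if x = a.lab ∨ x = b.lab then K x + 1 else K x) ⟨?_, ?_, ?_⟩ ?_ hs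
          · simpa using s1
          · intro x hx
            simp only [List.mem_append, List.mem_reverse, List.mem_singleton] at hx
            rcases hx with hx | rfl
            · have hx' : x ∈ st.reverse := by simpa using hx
              exact (hS.block x (by simp [hx])).congr
                (s3 _ (mem_lines.2 ⟨x, hx', Or.inl rfl⟩))
                (s3 _ (mem_lines.2 ⟨x, hx', Or.inr rfl⟩))
            · exact s2
          · exact Or.inr ⟨b0, Kb⟩
          · intro x hx
            have hx' : x ∈ st.reverse := by simpa using hx
            exact (hup x (by simp [hx])).congr (s3 _ (mem_lines.2 ⟨x, hx', Or.inl rfl⟩))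
    | cons c rest =>
      have cmem : c ∈ st.reverse ++ c :: rest := by simp
      obtain ⟨pok, qok⟩ := hS.strand_of_mem cmem
      have cok := hS.block c cmem
      have push : Up n pos K c → search bad leaf f (c :: st) rest z = true → _ := fun hc =>
        ih (c :: st) rest z K (by simpa using hS) (by
          intro b hb
          rcases List.mem_cons.1 hb with rfl | hb
          · exact hc
          · exact hup b hb)
      unfold search at hs
      cases hf : c.finished with
      | true =>
        rw [hf, cond_true] at hs
        exact push (Block.up_of_finished h.toPosArrangement pok hf) hs
      | false =>
        rw [hf, cond_false] at hs
        obtain ⟨v, hv⟩ := cok.exists_next h.toPosArrangement pok qok hf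
        -- A successful search has succeeded in the upward branch too, if it was tried.
        have hor : (bif c.canUp then search bad leaf f (c :: st) rest z else true) = true := by
          by_contra hc
          rw [Bool.not_eq_true] at hc
          rw [hc] at hs
          simp at hs
        rw [hor, cond_true] at hs
        by_cases hcv : c.p.lab < v
        · rw [Block.canUp_of_next h cok pok qok hv hcv, cond_true] at hor
          refine push ?_ hor
          intro w hw
          rwa [Next.unique h.toPosArrangement pok.lt hw hv]
        · have hvp : v < c.p.lab := by
            have := hv.2.1
            omega
          cases st with
          | nil =>
            -- The lowest block cannot go down, as no line lies below it.
            exfalso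
            have hb := hS.state.below
            simp only [List.reverse_nil, List.nil_append, lines_cons, List.cons_append,
              List.pairwise_cons] at hb
            obtain ⟨s, hs1, hs2⟩ := hS.state.mem v hv.1
            simp only [List.reverse_nil, List.nil_append, lines_cons, List.cons_append] at hs1
            rcases List.mem_cons.1 hs1 with rfl | hs1
            · omega
            · have := (hb.1 s hs1).2.1
              have := hv.2.2
              subst hs2
              omega
          | cons u st =>
            simp only at hs
            have hbs : (u :: st).reverse ++ c :: rest = st.reverse ++ u :: c :: rest := by simp
            rw [hbs] at hS
            have umem : u ∈ st.reverse ++ u :: c :: rest := by simp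
            obtain ⟨aok, bok⟩ := hS.strand_of_mem umem
            have uok := hS.block u umem
            have hS1 : StateOk n pos K ((lines st.reverse ++ [u.p]) ++ u.q :: c.p ::
                (c.q :: (lines rest ++ [z]))) := by
              have := hS.state
              simpa using this
            have hS2 : StateOk n pos K ((lines st.reverse ++ [u.p, u.q]) ++ c.p :: c.q ::
                (lines rest ++ [z])) := by
              have := hS.state
              simpa using this
            have hS3 : StateOk n pos K (lines st.reverse ++ u.p :: u.q ::
                (c.p :: c.q :: (lines rest ++ [z]))) := by
              have := hS.state
              simpa using this
            obtain ⟨nbc, Bbc, hadj⟩ := hS1.adjacent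
            obtain ⟨ncd, Bcd, hadj2⟩ := hS2.adjacent
            obtain ⟨nab, Bab, hadj3⟩ := hS3.adjacent
            have hpv := hv.2.2
            -- Otherwise `u.q` has crossed both `c.p` and `v`. The first gives `c.p.lab < u.q.lab`;
            -- as `v` lies below, the second gives `u.q.lab < v`, which contradicts `v < c.p.lab`.
            have hbn : K u.q.lab + 1 < n := by
              by_contra hc
              have hKb := bok.row.lt h.toPosArrangement bok.lt
              have p1 := h.lt bok.lt pok.lt nbc.symm
              have hcb : c.p.lab < u.q.lab := Bbc.1.1 (by omega)
              have hvb : v ≠ u.q.lab := by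
                rintro rfl
                have := Bbc.2
                omega
              have p2 := h.lt bok.lt hv.1 hvb
              rcases hadj v hv.1 hvb hv.2.1 with h1 | h1
              · have := h1.1.2
                omega
              · have := h1.2.1
                omega
            obtain ⟨w, hw⟩ := h.exists_next bok.lt hbn
            have hwa := (uok.next w).2 hw
            have haw : u.p.lab < w := hup u (by simp) w hwa
            have hba : u.q.lab < u.p.lab := by
              have := Bab.1
              have := uok.left
              omega
            obtain ⟨e1, e2⟩ := h.next_of_up_down bok.lt pok.lt nbc hw hv (by omega) hvp Bbc hadj
            subst e1 e2
            -- Line `u.q` lies below `c.q` and has not crossed it.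
            have hbd : u.q.lab < c.q.lab := by
              have h1 := (cok.next _).1 hv
              have h2 := hS.state.below
              have h3 : u.q.lab ≠ c.q.lab := h1.2.1
              rcases hadj2 u.q.lab bok.lt hv.2.1 h3 with h4 | h4
              · have := h4.2.2
                have := h1.2.2
                omega
              · have := h4.1.1
                omega
            rw [Block.canDown_of_next h cok pok qok hv hbd, cond_true] at hs
            obtain ⟨K', u', v', hk, hS', -, -, hK'⟩ :=
              hS.exchange h hbad hw.2.2 hv.2.2 hs
            refine ih st (u' :: v' :: rest) z K' hS' ?_ hk
            intro x hx
            exact (hup x (by simp [hx])).congr (hK' x (by simp [hx])).1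

end

/-! ### Rows as numbers, runs, and the start of the sweep -/

/-- The number with the given digits in base `64`, the most significant digit first. -/
def encode (l : List ℕ) : ℕ := l.foldl (fun c v => c * 64 + v) 0

theorem encode_concat (l : List ℕ) (v : ℕ) : encode (l ++ [v]) = encode l * 64 + v := by
  simp [encode]

/-- Digits are nonzero, so the number determines the length of the list as well. -/
theorem encode_injective {l m : List ℕ} (hl : ∀ v ∈ l, 0 < v ∧ v < 64)
    (hm : ∀ v ∈ m, 0 < v ∧ v < 64) (h : encode l = encode m) : l = m := by
  induction l using List.reverseRecOn generalizing m with
  | nil =>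
    rcases List.eq_nil_or_concat' m with rfl | ⟨m', v, rfl⟩
    · rfl
    · rw [encode_concat] at h
      have := hm v (by simp)
      simp [encode] at h
      omega
  | append_singleton l u ih =>
    have hu := hl u (by simp)
    rcases List.eq_nil_or_concat' m with rfl | ⟨m', v, rfl⟩
    · rw [encode_concat] at h
      simp [encode] at h
      omega
    · have hv := hm v (by simp)
      rw [encode_concat, encode_concat] at h
      have e : u = v := by omega
      subst e
      rw [ih (m := m') (fun w hw => hl w (by simp [hw])) (fun w hw => hm w (by simp [hw]))
        (by omega)]

/-- Lets `endsRun` compare a row with a shifted run by one multiplication and one addition. -/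
theorem encode_map_add (x : ℕ) (l : List ℕ) :
    encode (l.map (x + ·)) = encode l + x * encode (l.map fun _ => 1) := by
  induction l using List.reverseRecOn with
  | nil => simp [encode]
  | append_singleton l u ih =>
    simp only [List.map_append, List.map_cons, List.map_nil, encode_concat, ih]
    ring

/-- The lines `1, 3, 2, 5, 4, …, 2m + 1, 2m`. -/
def run : ℕ → List ℕ
  | 0 => [1]
  | m + 1 => run m ++ [2 * m + 3, 2 * m + 2]

/-- After its first crossing, line `x` crosses `m` pairs of lines whose first crossings are with
each other. -/
def HasRun (n : ℕ) (pos : ℕ → ℕ → ℕ) (x m : ℕ) : Prop :=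
  x + 2 * m + 1 < n ∧ pos x (x + 1) = 0 ∧
    ∀ j < m, pos x (x + 2 * j + 3) = 2 * j + 1 ∧ pos x (x + 2 * j + 2) = 2 * j + 2

def endsRun (d : ℕ) (s : Strand) : Bool :=
  s.row.beq (encode (run (d + 1)) + s.dig * encode ((run (d + 1)).map fun _ => 1))

/-- The number `d` is the length of the run of line `0`: `advance` carries out its crossings, and
the search drops a branch when it finds a line that completes a run of length `d + 1`. -/
def sweep (n : ℕ) (leaf : List Block → Strand → Bool) (d : ℕ) : Bool :=
  match freshBlocks n 0 ((n - 1) / 2) with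
  | [] => false
  | b :: bs =>
    advance (endsRun d)
      (fun bs => search (endsRun d) leaf (n * n * n) [] bs (Strand.fresh n (n - 1))) d [] b bs

section

variable {n : ℕ} {pos : ℕ → ℕ → ℕ}

theorem length_run (m : ℕ) : (run m).length = 2 * m + 1 := by
  induction m with
  | zero => rfl
  | succ m ih => simp [run, ih]; ring

theorem mem_run {m v : ℕ} (h : v ∈ run m) : 0 < v ∧ v ≤ 2 * m + 1 := by
  induction m with
  | zero => simp [run] at h; omega
  | succ m ih =>
    simp only [run, List.mem_append, List.mem_cons, List.not_mem_nil, or_false] at h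
    rcases h with h | h | h
    · have := ih h; omega
    · omega
    · omega

theorem RowCode.exists_list {x k c : ℕ} (hr : RowCode n pos x k c) :
    ∃ l : List ℕ, l.length = k ∧ c = encode (l.map (1 + ·)) ∧
      ∀ i (hi : i < l.length), l[i] < n ∧ l[i] ≠ x ∧ pos x l[i] = i := by
  induction hr with
  | zero => exact ⟨[], rfl, rfl, by simp⟩
  | @succ k c v hr hv hvx hp ih =>
    obtain ⟨l, hl, hc, hi⟩ := ih
    refine ⟨l ++ [v], by simp [hl], ?_, ?_⟩
    · rw [List.map_append, List.map_cons, List.map_nil, encode_concat, hc, Nat.add_comm v]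
    · intro i h
      rcases Nat.lt_or_ge i l.length with h1 | h1
      · rw [List.getElem_append_left h1]
        exact hi i h1
      · have : i = l.length := by simp at h; omega
        subst this
        simp [hv, hvx, hp, hl]

theorem hasRun_of_list {x : ℕ} : ∀ (m : ℕ) (l : List ℕ), l = (run m).map (x + ·) →
    (∀ i (hi : i < l.length), l[i] < n ∧ l[i] ≠ x ∧ pos x l[i] = i) → HasRun n pos x m := by
  intro m
  induction m with
  | zero =>
    rintro l rfl hl
    have := hl 0 (by simp [run])
    simp [run] at this
    exact ⟨by omega, this.2, by simp⟩
  | succ m ih =>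
    rintro l rfl hl
    have hlen := length_run m
    have ih := ih _ rfl (by
      intro i hi
      have := hl i (by simp [run] at hi ⊢; omega)
      simp only [run, List.map_append] at this
      rwa [List.getElem_append_left hi] at this)
    have h1 := hl (2 * m + 1) (by simp [run, hlen])
    have h2 := hl (2 * m + 2) (by simp [run, hlen])
    simp only [run, List.map_append] at h1 h2
    rw [List.getElem_append_right (by simp [hlen])] at h1 h2
    simp [hlen] at h1 h2
    refine ⟨by omega, ih.2.1, ?_⟩
    intro j hj
    rcases Nat.lt_or_ge j m with h | h
    · exact ih.2.2 j h
    · obtain rfl : j = m := by omega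
      exact ⟨by rw [← h1.2]; rfl, by rw [← h2.2]; rfl⟩

/-- Decoding needs digits below `64`. The digits of a shifted run can exceed `n` but are at most `2
n + 1`, which is why `n ≤ 30` suffices. -/
theorem endsRun_eq_false (hn : n ≤ 30) {d : ℕ} (hd : 2 * d + 1 < n)
    (hrun : ∀ x, x < n → ¬ HasRun n pos x (d + 1)) {k : ℕ} {s : Strand}
    (hs : StrandOk n pos k s) : endsRun d s = false := by
  rw [Bool.eq_false_iff]
  intro e
  replace e := Nat.eq_of_beq_eq_true e
  rw [← encode_map_add] at e
  obtain ⟨l, hl, hc, hi⟩ := hs.row.exists_list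
  have hsd : s.dig = s.lab + 1 := by have := hs.dig_pos; unfold Strand.lab; omega
  have hlt := hs.lt
  have hl' : l.map (1 + ·) = (run (d + 1)).map (s.dig + ·) := by
    apply encode_injective
    · intro v hv
      obtain ⟨w, hw, rfl⟩ := List.mem_map.1 hv
      obtain ⟨i, h, rfl⟩ := List.getElem_of_mem hw
      have := (hi i h).1
      omega
    · intro v hv
      obtain ⟨w, hw, rfl⟩ := List.mem_map.1 hv
      have := mem_run hw
      omega
    · rw [← hc, e]
  have hl2 : l = (run (d + 1)).map (s.lab + ·) := by
    have := congrArg (List.map (· - 1)) hl'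
    simp only [List.map_map] at this
    have e1 : ((fun x => x - 1) ∘ fun x => 1 + x) = (id : ℕ → ℕ) := by funext y; simp
    rw [e1, List.map_id] at this
    rw [this]
    apply List.map_congr_left
    intro y _
    simp [hsd]
  exact hrun _ hlt (hasRun_of_list _ _ hl2 hi)

/-- Every line but the last one has made its first crossing. -/
def freshK (n x : ℕ) : ℕ := if x + 1 = n then 0 else 1

theorem mem_freshBlocks {i k : ℕ} {b : Block} (hb : b ∈ freshBlocks n i k) :
    ∃ j, i ≤ j ∧ j < i + k ∧ b = Block.fresh n j := by
  induction k generalizing i with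
  | zero => simp [freshBlocks] at hb
  | succ k ih =>
    rcases List.mem_cons.1 hb with rfl | hb
    · exact ⟨i, le_rfl, by omega, rfl⟩
    · obtain ⟨j, h1, h2, h3⟩ := ih hb
      exact ⟨j, by omega, by omega, h3⟩

theorem fresh_mem_freshBlocks {i k j : ℕ} (h1 : i ≤ j) (h2 : j < i + k) :
    Block.fresh n j ∈ freshBlocks n i k := by
  induction k generalizing i with
  | zero => omega
  | succ k ih =>
    rcases Nat.eq_or_lt_of_le h1 with rfl | h
    · exact List.mem_cons_self
    · exact List.mem_cons_of_mem _ (ih h (by omega))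

/-- The first crossings pair `2i` with `2i + 1`, so lines of different pairs have not crossed yet.
-/
theorem Normalized.below_freshK (h : Normalized n pos) {x y : ℕ} (hy : y < n)
    (hxy : x / 2 < y / 2) : Below pos (freshK n) x y := by
  have hpair : ∀ a b, a < n → b < n → b ≠ a → a / 2 ≠ b / 2 → ¬ pos a b < freshK n a := by
    intro a b ha hb hba hne hlt
    unfold freshK at hlt
    split_ifs at hlt with ha'
    · omega
    · have hodd := h.odd
      have hp := h.pos_pair h.three_le h.first (a / 2) (by omega)
      rcases Nat.mod_two_eq_zero_or_one a with h2 | h2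
      · have e : 2 * (a / 2) = a := by omega
        rw [e] at hp
        have := h.inj ha hb (j := a + 1) (by omega) hba (by omega) (by omega)
        omega
      · have e : 2 * (a / 2) + 1 = a := by omega
        rw [e] at hp
        have := h.inj ha hb (j := 2 * (a / 2)) (by omega) hba (by omega) (by omega)
        omega
  have h1 := hpair x y (by omega) hy (by omega) (by omega)
  have h2 := hpair y x hy (by omega) (by omega) (by omega)
  unfold Below
  omega

theorem Normalized.fresh_ok (h : Normalized n pos) {j : ℕ} (hj : 2 * j + 1 < n) :
    StrandOk n pos 1 (Block.fresh n j).p ∧ StrandOk n pos 1 (Block.fresh n j).q := by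
  have hp := h.pos_pair h.three_le h.first j hj
  have s1 : StrandOk n pos 0 (Strand.fresh n (2 * j + 1)) := .fresh hj (h.mate hj).1
  have s2 : StrandOk n pos 0 (Strand.fresh n (2 * j)) := .fresh (by omega) (h.mate (by omega)).1
  exact ⟨s1.cross' h.toPosArrangement s2 (by simp) (by simpa using hp.2),
    s2.cross' h.toPosArrangement s1 (by simp) (by simpa using hp.1)⟩

@[simp] theorem Block.lab_fresh_p (j : ℕ) : (Block.fresh n j).p.lab = 2 * j + 1 := by
  simp [Block.fresh]

@[simp] theorem Block.lab_fresh_q (j : ℕ) : (Block.fresh n j).q.lab = 2 * j := by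
  simp [Block.fresh]

theorem Normalized.sweepOk_fresh (h : Normalized n pos) :
    SweepOk n pos (freshK n) (freshBlocks n 0 ((n - 1) / 2)) (Strand.fresh n (n - 1)) := by
  have hodd := h.odd
  have three := h.three_le
  have zok : StrandOk n pos 0 (Strand.fresh n (n - 1)) :=
    .fresh (by omega) (h.mate (by omega)).1
  have hmem : ∀ {i k : ℕ} {s : Strand}, s ∈ lines (freshBlocks n i k) →
      2 * i ≤ s.lab ∧ s.lab < 2 * (i + k) := by
    intro i k s hs
    obtain ⟨b, hb, hs⟩ := mem_lines.1 hs
    obtain ⟨j, h1, h2, rfl⟩ := mem_freshBlocks hb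
    rcases hs with rfl | rfl <;> simp <;> omega
  refine ⟨⟨?_, ?_, ?_⟩, ?_, ?_⟩
  · intro s hs
    rcases List.mem_append.1 hs with hs | hs
    · obtain ⟨b, hb, hs⟩ := mem_lines.1 hs
      obtain ⟨j, h1, h2, rfl⟩ := mem_freshBlocks hb
      have := h.fresh_ok (j := j) (by omega)
      rcases hs with rfl | rfl
      · have e : freshK n (Block.fresh n j).p.lab = 1 := by
          simp [freshK]; omega
        rw [e]; exact this.1
      · have e : freshK n (Block.fresh n j).q.lab = 1 := by
          simp [freshK]; omega
        rw [e]; exact this.2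
    · simp only [List.mem_singleton] at hs
      subst hs
      have e : freshK n (Strand.fresh n (n - 1)).lab = 0 := by
        simp [freshK]; omega
      rw [e]; exact zok
  · rw [List.pairwise_append]
    refine ⟨?_, by simp, ?_⟩
    · have : ∀ k i, 2 * (i + k) < n → (lines (freshBlocks n i k)).Pairwise
          fun s t => s.lab ≠ t.lab ∧ Below pos (freshK n) s.lab t.lab := by
        intro k
        induction k with
        | zero => intro i _; exact List.Pairwise.nil
        | succ k ih =>
          intro i hi
          simp only [freshBlocks, lines_cons, List.pairwise_cons, List.mem_cons]
          refine ⟨?_, ?_, ih (i + 1) (by omega)⟩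
          · rintro t (rfl | ht)
            · have hp := h.pos_pair h.three_le h.first i (by omega)
              simp only [Block.lab_fresh_p, Block.lab_fresh_q]
              refine ⟨by omega, ?_⟩
              unfold Below freshK
              split_ifs <;> omega
            · have := hmem ht
              simp only [Block.lab_fresh_p]
              exact ⟨by omega, h.below_freshK (by omega) (by omega)⟩
          · intro t ht
            have := hmem ht
            simp only [Block.lab_fresh_q]
            exact ⟨by omega, h.below_freshK (by omega) (by omega)⟩
      exact this _ _ (by omega)
    · intro s hs t ht
      simp only [List.mem_singleton] at ht
      subst ht
      have := hmem hs
      simp only [Strand.lab_fresh]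
      exact ⟨by omega, h.below_freshK (by omega) (by omega)⟩
  · intro x hx
    rcases Nat.lt_or_ge (x + 1) n with h1 | h1
    · have hb : Block.fresh n (x / 2) ∈ freshBlocks n 0 ((n - 1) / 2) :=
        fresh_mem_freshBlocks (by omega) (by omega)
      rcases Nat.mod_two_eq_zero_or_one x with h2 | h2
      · exact ⟨_, List.mem_append_left _ (mem_lines.2 ⟨_, hb, Or.inr rfl⟩), by simp; omega⟩
      · exact ⟨_, List.mem_append_left _ (mem_lines.2 ⟨_, hb, Or.inl rfl⟩), by simp; omega⟩
    · exact ⟨Strand.fresh n (n - 1), by simp, by simp; omega⟩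
  · intro b hb
    obtain ⟨j, h1, h2, rfl⟩ := mem_freshBlocks hb
    have hp := h.pos_pair h.three_le h.first j (by omega)
    refine BlockOk.mk' h.toPosArrangement ?_ ?_ ?_ ?_ ?_ ?_ <;>
      simp only [Block.lab_fresh_p, Block.lab_fresh_q]
    · omega
    · omega
    · omega
    · unfold freshK; split_ifs <;> omega
    · unfold freshK; split_ifs <;> omega
    · exact Or.inl ⟨hp.2, hp.1⟩
  · left
    simp [freshK]
    omega

theorem advance_sound (h : Normalized n pos) {bad : Strand → Bool}
    (hbad : ∀ k s, StrandOk n pos k s → bad s = false) (k : List Block → Bool) (z : Strand) (D : ℕ)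
    (hD : HasRun n pos 0 D) :
    ∀ (d i m : ℕ) (done : List Block) (cur : Block) (K : ℕ → ℕ), i + d = D →
      2 * (i + 1 + m) + 1 = n →
      SweepOk n pos K (done.reverse ++ cur :: freshBlocks n (i + 1) m) z → cur.q.lab = 0 →
      K 0 = 2 * i + 1 → (∀ b ∈ freshBlocks n (i + 1) m, K b.p.lab = 1) →
      advance bad k d done cur (freshBlocks n (i + 1) m) = true →
      ∃ K' bs, SweepOk n pos K' bs z ∧ k bs = true := by
  intro d
  induction d with
  | zero =>
    intro i m done cur K _ _ hS _ _ _ hk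
    exact ⟨K, _, hS, hk⟩
  | succ d ih =>
    intro i m done cur K hid him hS hq hK hfresh hk
    cases m with
    | zero => simp [freshBlocks, advance] at hk
    | succ m =>
      obtain ⟨r1, r2⟩ := hD.2.2 i (by omega)
      have r3 := hD.1
      have hp := h.pos_pair h.three_le h.first (i + 1) (by omega)
      rw [Nat.zero_add] at r1 r2
      have e1 : 2 * (i + 1) + 1 = 2 * i + 3 := by ring
      have e2 : 2 * (i + 1) = 2 * i + 2 := by ring
      -- On line `2i + 3`, line `0` is a neighbour of `2i + 2`, which is the first to cross there,
      -- so line `0` is the second: it meets a block that is still fresh.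
      have hadj := (h.adj (r := 0) (i := 2 * i + 3) (j := 2 * i + 2) (by omega) (by omega)
        (by omega) (by omega) (by omega) (by omega)).1
      rw [e1, e2] at hp
      simp only [freshBlocks, advance] at hk hS hfresh
      have hf1 := hfresh (Block.fresh n (i + 1)) (by simp)
      rw [Block.lab_fresh_p, e1] at hf1
      obtain ⟨K', u, v, hk', hS', hv, hKq, hsame⟩ := hS.exchange h hbad (by
        rw [hq, Block.lab_fresh_p, e1, hK, r1]) (by
        rw [hq, Block.lab_fresh_p, e1, hf1]; omega) hk
      refine ih (i + 1) m (u :: done) v K' (by omega) (by omega) (by simpa using hS')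
        (by rw [hv, hq]) (by rw [hq] at hKq; omega) ?_ hk'
      intro b hb
      rw [(hsame b (by simp [hb])).1]
      exact hfresh b (by simp [hb])

/-- If line `0` has a run of length `d`, and no line has a longer one, then a sweep that succeeds
has met the arrangement. -/
theorem sweep_sound (h : Normalized n pos) (hn : n ≤ 30) (leaf : List Block → Strand → Bool)
    {d : ℕ} (hd : HasRun n pos 0 d) (hrun : ∀ x, x < n → ¬ HasRun n pos x (d + 1))
    (hs : sweep n leaf d = true) :
    ∃ bs z, leaf bs z = true ∧
      ∀ x, x < n → ∃ s ∈ lines bs ++ [z], s.lab = x ∧ StrandOk n pos (n - 1) s := by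
  have hbad : ∀ k s, StrandOk n pos k s → endsRun d s = false := fun k s hs =>
    endsRun_eq_false hn (by have := hd.1; omega) hrun hs
  have three := h.three_le
  have hodd := h.odd
  obtain ⟨m, hm⟩ : ∃ m, (n - 1) / 2 = m + 1 := ⟨(n - 1) / 2 - 1, by omega⟩
  have h0 := h.sweepOk_fresh
  unfold sweep at hs
  rw [hm] at hs h0
  simp only [freshBlocks] at hs h0
  obtain ⟨K, bs, hS, hk⟩ := advance_sound h hbad _ _ d hd d 0 m [] _ (freshK n) (by omega)
    (by omega) (by simpa using h0) (by simp) (by simp [freshK]; omega) (by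
      intro b hb
      obtain ⟨j, h1, h2, rfl⟩ := mem_freshBlocks hb
      simp [freshK]
      omega) hs
  exact search_sound h hbad leaf _ [] bs _ K (by simpa using hS) (by simp) hk

end

/-! ### Optimality: every segment is a side of a triangle -/

namespace Table

variable {n : ℕ}

/-- The position of line `i` in row `r`. -/
def pos (t : Table n) (r i : ℕ) : ℕ :=
  if h : r < n ∧ i < n then (t ⟨r, h.1⟩).idxOf ⟨i, h.2⟩ else 0

theorem pos_val (t : Table n) (r i : Fin n) : t.pos r i = (t r).idxOf i := by
  simp [pos]

/-- Every row lists the other lines. -/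
def RowsOk (t : Table n) : Prop := ∀ r, (t r).Nodup ∧ ∀ i, i ∈ t r ↔ i ≠ r

theorem IsArrangement.rowsOk {t : Table n} (h : t.IsArrangement) : t.RowsOk := fun r =>
  ⟨h.non_repetition r, fun i =>
    ⟨by rintro hi rfl; exact h.self_exclusion _ hi, h.completeness r i⟩⟩

theorem RowsOk.length {t : Table n} (h : t.RowsOk) (r : Fin n) : (t r).length + 1 = n := by
  have h1 : (t r).toFinset = Finset.univ.erase r := by
    ext i
    simp [(h r).2 i]
  rw [← List.toFinset_card_of_nodup (h r).1, h1, Finset.card_erase_of_mem (Finset.mem_univ r),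
    Finset.card_univ, Fintype.card_fin]
  have := r.pos
  omega

theorem IsArrangement.posTable {t : Table n} (h : t.IsArrangement) : PosTable n t.pos where
  lt := by
    intro r i hr hi hne
    lift r to Fin n using hr
    lift i to Fin n using hi
    rw [pos_val]
    have h1 := List.idxOf_lt_length_iff.2 (h.completeness r i (by simpa [Fin.ext_iff] using hne))
    have := h.rowsOk.length r
    omega
  inj := by
    intro r i j hr hi hj hir hjr he
    lift r to Fin n using hr
    lift i to Fin n using hi
    lift j to Fin n using hj
    rw [pos_val, pos_val] at he
    have h1 := h.completeness r i (by simpa [Fin.ext_iff] using hir)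
    rw [(List.idxOf_inj h1).1 he]
  surj := by
    intro r k hr hk
    lift r to Fin n using hr
    have hl := h.rowsOk.length r
    have hk' : k < (t r).length := by omega
    refine ⟨(t r)[k], Fin.isLt _, ?_, ?_⟩
    · have := ((h.rowsOk r).2 _).1 (List.getElem_mem hk')
      simpa [Fin.ext_iff] using this
    · rw [pos_val, (h.non_repetition r).idxOf_getElem]
  cons := by
    intro a b c hab hbc hc
    lift c to Fin n using hc
    lift b to Fin n using by omega
    lift a to Fin n using by omega
    simp only [pos_val]
    exact h.consistency a b c hab hbc

/-- The corner of a triangle on one of its three lines: the line, and the position where the side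
of the triangle on it starts. -/
def corner (t : Table n) (p : (Fin n × Fin n × Fin n) × Fin 3) : ℕ × ℕ :=
  match p.2 with
  | 0 => (p.1.1, min (t.pos p.1.1 p.1.2.1) (t.pos p.1.1 p.1.2.2))
  | 1 => (p.1.2.1, min (t.pos p.1.2.1 p.1.1) (t.pos p.1.2.1 p.1.2.2))
  | 2 => (p.1.2.2, min (t.pos p.1.2.2 p.1.1) (t.pos p.1.2.2 p.1.2.1))

theorem mem_triangles {t : Table n} {a b c : Fin n} : (a, b, c) ∈ t.triangles ↔
    a.val < b ∧ b.val < c ∧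
      (t.pos a c = t.pos a b + 1 ∨ t.pos a b = t.pos a c + 1) ∧
      (t.pos b c = t.pos b a + 1 ∨ t.pos b a = t.pos b c + 1) ∧
      (t.pos c b = t.pos c a + 1 ∨ t.pos c a = t.pos c b + 1) := by
  simp only [triangles, Finset.mem_filter, Finset.mem_univ, true_and, Neighbours, NextAfter,
    pos_val, Fin.lt_def]

theorem corner_spec {t : Table n} {a b c : Fin n} (h : (a, b, c) ∈ t.triangles) (k : Fin 3) :
    ∃ r i j : Fin n, i ≠ r ∧ j ≠ r ∧ t.corner ((a, b, c), k) = (r.val, t.pos r i) ∧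
      t.pos r j = t.pos r i + 1 ∧
      ((k = 0 ∧ r = a ∧ (i = b ∧ j = c ∨ i = c ∧ j = b)) ∨
        (k = 1 ∧ r = b ∧ (i = a ∧ j = c ∨ i = c ∧ j = a)) ∨
        (k = 2 ∧ r = c ∧ (i = a ∧ j = b ∨ i = b ∧ j = a))) := by
  obtain ⟨h1, h2, h3, h4, h5⟩ := mem_triangles.1 h
  have n1 : a ≠ b := by rintro rfl; omega
  have n2 : b ≠ c := by rintro rfl; omega
  have n3 : a ≠ c := by rintro rfl; omega
  match k with
  | 0 =>
    rcases h3 with h3 | h3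
    · exact ⟨a, b, c, n1.symm, n3.symm, by simp [corner, h3], h3, by simp⟩
    · exact ⟨a, c, b, n3.symm, n1.symm, by simp [corner, h3], h3, by simp⟩
  | 1 =>
    rcases h4 with h4 | h4
    · exact ⟨b, a, c, n1, n2.symm, by simp [corner, h4], h4, by simp⟩
    · exact ⟨b, c, a, n2.symm, n1, by simp [corner, h4], h4, by simp⟩
  | 2 =>
    rcases h5 with h5 | h5
    · exact ⟨c, a, b, n3, n2, by simp [corner, h5], h5, by simp⟩
    · exact ⟨c, b, a, n2, n3, by simp [corner, h5], h5, by simp⟩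

theorem ne_val {i j : Fin n} (h : i ≠ j) : i.val ≠ j.val := fun e => h (Fin.ext e)

theorem IsArrangement.corner_mapsTo {t : Table n} (h : t.IsArrangement) :
    Set.MapsTo t.corner (t.triangles ×ˢ (Finset.univ : Finset (Fin 3)) : Finset _)
      (Finset.range n ×ˢ Finset.range (n - 2) : Finset (ℕ × ℕ)) := by
  rintro ⟨⟨a, b, c⟩, k⟩ hp
  simp only [Finset.coe_product, Set.mem_prod, Finset.mem_coe, Finset.mem_univ, and_true] at hp
  obtain ⟨r, i, j, hi, hj, e, e2, -⟩ := corner_spec hp k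
  rw [e]
  have := h.posTable.lt r.2 j.2 (ne_val hj)
  simp only [Finset.coe_product, Set.mem_prod, Finset.mem_coe, Finset.mem_range]
  exact ⟨r.2, by omega⟩

/-- A line and a position on it determine the two consecutive crossings there, hence the three
lines; as these are listed in increasing order, triple and corner are determined too. -/
theorem IsArrangement.corner_injOn {t : Table n} (h : t.IsArrangement) :
    Set.InjOn t.corner (t.triangles ×ˢ (Finset.univ : Finset (Fin 3)) : Finset _) := by
  rintro ⟨⟨a, b, c⟩, k⟩ hp ⟨⟨a', b', c'⟩, k'⟩ hp' he
  simp only [Finset.coe_product, Set.mem_prod, Finset.mem_coe, Finset.mem_univ, and_true] at hp hp'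
  obtain ⟨r, i, j, hi, hj, e, e2, hk⟩ := corner_spec hp k
  obtain ⟨r', i', j', hi', hj', e', e2', hk'⟩ := corner_spec hp' k'
  rw [e, e', Prod.mk.injEq] at he
  obtain ⟨hr, hpos⟩ := he
  replace hr := Fin.ext hr
  subst hr
  have hii : i = i' := Fin.ext (h.posTable.inj r.2 i.2 i'.2 (ne_val hi) (ne_val hi') hpos)
  subst hii
  have hjj : j = j' := Fin.ext (h.posTable.inj r.2 j.2 j'.2 (ne_val hj) (ne_val hj') (by omega))
  subst hjj
  obtain ⟨h1, h2, -⟩ := mem_triangles.1 hp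
  obtain ⟨h1', h2', -⟩ := mem_triangles.1 hp'
  simp only [Prod.mk.injEq, Fin.ext_iff] at hk hk' ⊢
  clear e e' e2 e2' hpos hp hp' h hi hj hi' hj'
  rcases hk with ⟨k1, k2, k3⟩ | ⟨k1, k2, k3⟩ | ⟨k1, k2, k3⟩ <;>
    rcases hk' with ⟨l1, l2, l3⟩ | ⟨l1, l2, l3⟩ | ⟨l1, l2, l3⟩ <;>
    rw [k1, l1] <;> clear k1 l1 <;> omega

theorem card_corners (t : Table n) :
    (t.triangles ×ˢ (Finset.univ : Finset (Fin 3))).card = 3 * t.triangles.card := by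
  rw [Finset.card_product, Finset.card_univ, Fintype.card_fin, mul_comm]

theorem card_sides : (Finset.range n ×ˢ Finset.range (n - 2)).card = n * (n - 2) := by
  rw [Finset.card_product, Finset.card_range, Finset.card_range]

/-- The sides of the triangles inject into the `n (n - 2)` segments. Equality of the numbers makes
the injection onto, so any two consecutive crossings come from a triangle. -/
theorem IsOptimal.posArrangement {t : Table n} (ht : t.IsOptimal) : PosArrangement n t.pos where
  toPosTable := ht.1.posTable
  adj := by
    intro r i j hr hi hj hir hjr he
    have h := ht.1
    have hs := Finset.surjOn_of_injOn_of_card_le t.corner h.corner_mapsTo h.corner_injOn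
      (by rw [card_corners, card_sides, ht.2])
    have hlt := h.posTable.lt hr hj hjr
    have hmem : (r, t.pos r i) ∈ (Finset.range n ×ˢ Finset.range (n - 2) : Finset (ℕ × ℕ)) := by
      simp only [Finset.mem_product, Finset.mem_range]
      exact ⟨hr, by omega⟩
    obtain ⟨⟨⟨a, b, c⟩, k⟩, hp, hc⟩ := hs hmem
    simp only [Finset.coe_product, Set.mem_prod, Finset.mem_coe, Finset.mem_univ, and_true] at hp
    obtain ⟨r', i', j', hi', hj', e, e2, hk⟩ := corner_spec hp k
    rw [e, Prod.mk.injEq] at hc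
    obtain ⟨rfl, hpos⟩ := hc
    have hii : i = i' := h.posTable.inj hr hi i'.2 hir (ne_val hi') hpos.symm
    subst hii
    have hjj : j = j' := h.posTable.inj hr hj j'.2 hjr (ne_val hj') (by omega)
    subst hjj
    obtain ⟨h1, h2, h3, h4, h5⟩ := mem_triangles.1 hp
    rcases hk with ⟨-, rfl, ⟨rfl, rfl⟩ | ⟨rfl, rfl⟩⟩ | ⟨-, rfl, ⟨rfl, rfl⟩ | ⟨rfl, rfl⟩⟩ |
      ⟨-, rfl, ⟨rfl, rfl⟩ | ⟨rfl, rfl⟩⟩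
    exacts [⟨h4, h5⟩, ⟨h5, h4⟩, ⟨h3, h5.symm⟩, ⟨h5.symm, h3⟩, ⟨h3.symm, h4.symm⟩,
      ⟨h4.symm, h3.symm⟩]

/-- The converse count: if every segment is a side, the sides of triangles are in bijection with the
segments. -/
theorem IsArrangement.isOptimal {t : Table n} (h : t.IsArrangement)
    (hadj : ∀ r i j : Fin n, i ≠ r → j ≠ r → t.pos r j = t.pos r i + 1 →
      (t.pos i j = t.pos i r + 1 ∨ t.pos i r = t.pos i j + 1) ∧
        (t.pos j i = t.pos j r + 1 ∨ t.pos j r = t.pos j i + 1)) : t.IsOptimal := by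
  refine ⟨h, ?_⟩
  rw [← card_corners, ← card_sides]
  refine le_antisymm (Finset.card_le_card_of_injOn _ h.corner_mapsTo h.corner_injOn)
    (Finset.card_le_card_of_surjOn t.corner ?_)
  rintro ⟨r, m⟩ hrm
  simp only [Finset.coe_product, Set.mem_prod, Finset.mem_coe, Finset.mem_range] at hrm
  obtain ⟨i, hi, hir, pi⟩ := h.posTable.surj (k := m) hrm.1 (by omega)
  obtain ⟨j, hj, hjr, pj⟩ := h.posTable.surj (k := m + 1) hrm.1 (by omega)
  have hij : i ≠ j := by rintro rfl; omega
  have hr := hrm.1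
  obtain ⟨h1, h2⟩ := hadj ⟨r, hr⟩ ⟨i, hi⟩ ⟨j, hj⟩ (by simpa [Fin.ext_iff] using hir)
    (by simpa [Fin.ext_iff] using hjr) (by simp; omega)
  simp only at h1 h2
  have key : ∀ (a b c : Fin n) (k : Fin 3), (a, b, c) ∈ t.triangles →
      t.corner ((a, b, c), k) = (r, m) →
      (r, m) ∈ t.corner '' (t.triangles ×ˢ (Finset.univ : Finset (Fin 3)) : Finset _) := by
    intro a b c k h1 h2
    exact ⟨((a, b, c), k), by simpa using h1, h2⟩
  have p1 : min (t.pos r i) (t.pos r j) = m := by omega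
  have p2 : min (t.pos r j) (t.pos r i) = m := by omega
  have h0 : t.pos r j = t.pos r i + 1 := by omega
  rcases lt_or_gt_of_ne hir with l1 | l1 <;> rcases lt_or_gt_of_ne hjr with l2 | l2 <;>
    rcases lt_or_gt_of_ne hij with l3 | l3
  · exact key ⟨i, hi⟩ ⟨j, hj⟩ ⟨r, hr⟩ 2 (mem_triangles.2 (by simp only; tauto))
      (by simp [corner, p1])
  · exact key ⟨j, hj⟩ ⟨i, hi⟩ ⟨r, hr⟩ 2 (mem_triangles.2 (by simp only; tauto))
      (by simp [corner, p2])
  · exact key ⟨i, hi⟩ ⟨r, hr⟩ ⟨j, hj⟩ 1 (mem_triangles.2 (by simp only; tauto))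
      (by simp [corner, p1])
  · omega
  · omega
  · exact key ⟨j, hj⟩ ⟨r, hr⟩ ⟨i, hi⟩ 1 (mem_triangles.2 (by simp only; tauto))
      (by simp [corner, p2])
  · exact key ⟨r, hr⟩ ⟨i, hi⟩ ⟨j, hj⟩ 0 (mem_triangles.2 (by simp only; tauto))
      (by simp [corner, p1])
  · exact key ⟨r, hr⟩ ⟨j, hj⟩ ⟨i, hi⟩ 0 (mem_triangles.2 (by simp only; tauto))
      (by simp [corner, p2])

end Table

/-! ### Rotations -/

theorem List.idxOf_map_injective {α β : Type*} [DecidableEq α] [DecidableEq β] {f : α → β}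
    (hf : Function.Injective f) (a : α) (l : List α) : (l.map f).idxOf (f a) = l.idxOf a := by
  induction l with
  | nil => rfl
  | cons b l ih =>
    simp only [List.map_cons, List.idxOf_cons, ih]
    by_cases h : b = a
    · simp [h]
    · have h1 : (b == a) = false := by simpa using h
      have h2 : (f b == f a) = false := by simpa using fun e => h (hf e)
      rw [h1, h2]

theorem List.Nodup.idxOf_reverse {α : Type*} [DecidableEq α] {a : α} {l : List α} (hl : l.Nodup)
    (ha : a ∈ l) : l.reverse.idxOf a + l.idxOf a + 1 = l.length := by
  obtain ⟨i, hi, rfl⟩ := List.getElem_of_mem ha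
  rw [hl.idxOf_getElem]
  have h1 : l.reverse[l.length - 1 - i]'(by simp; omega) = l[i] := by
    rw [List.getElem_reverse]
    congr 1
    omega
  rw [← h1, (List.nodup_reverse.2 hl).idxOf_getElem]
  omega

namespace Table

variable {m : ℕ}

theorem rotate_apply (t : Table (m + 1)) (r : Fin (m + 1)) :
    t.rotate r = (if r.val = m then (t (r + 1)).reverse else t (r + 1)).map (· - 1) := by
  have h1 : ∀ x, (finRotate (m + 1)).symm x = x - 1 := by
    intro x
    rw [Equiv.symm_apply_eq, finRotate_apply, sub_add_cancel]
  simp only [rotate, finRotate_apply, Nat.add_right_cancel_iff]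
  congr 1
  funext x
  exact h1 x

/-- The row of line `r` after `k` rotations. -/
theorem iterate_rotate_apply (t : Table (m + 1)) (k : ℕ) (r : Fin (m + 1)) :
    rotate^[k] t r = (if (r.val + k) / (m + 1) % 2 = 1 then (t (r + Fin.ofNat (m + 1) k)).reverse
      else t (r + Fin.ofNat (m + 1) k)).map (· - Fin.ofNat (m + 1) k) := by
  induction k generalizing r with
  | zero =>
    have : r.val / (m + 1) = 0 := Nat.div_eq_of_lt r.2
    simp [this]
  | succ k ih =>
    have hk : Fin.ofNat (m + 1) (k + 1) = Fin.ofNat (m + 1) k + 1 := by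
      ext
      simp [Fin.val_add]
    have hf : ((fun x : Fin (m + 1) => x - 1) ∘ fun x => x - Fin.ofNat (m + 1) k) =
        fun x => x - Fin.ofNat (m + 1) (k + 1) := by
      funext x
      simp only [Function.comp, hk]
      abel
    have hs : r + 1 + Fin.ofNat (m + 1) k = r + Fin.ofNat (m + 1) (k + 1) := by
      rw [hk]; abel
    rw [Function.iterate_succ_apply', rotate_apply, ih, hs]
    by_cases hr : r.val = m
    · have h1 : (r + 1).val = 0 := by
        have : r = Fin.last m := Fin.ext hr
        rw [this, Fin.last_add_one]
        rfl
      have h2 : (r.val + (k + 1)) / (m + 1) = k / (m + 1) + 1 := by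
        rw [hr, show m + (k + 1) = k + (m + 1) by ring, Nat.add_div_right _ (Nat.succ_pos m)]
      rw [h1, h2, if_pos hr, Nat.zero_add, ← List.map_reverse, List.map_map, hf]
      rcases Nat.mod_two_eq_zero_or_one (k / (m + 1)) with h3 | h3
      · rw [if_neg (by omega), if_pos (by omega)]
      · rw [if_pos h3, if_neg (by omega), List.reverse_reverse]
    · have h1 : (r + 1).val = r.val + 1 := Fin.val_add_one_of_lt (lt_of_le_of_ne (Fin.le_last r)
        fun e => hr (by rw [e]; rfl))
      rw [h1, if_neg hr, List.map_map, hf, show r.val + 1 + k = r.val + (k + 1) by ring]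

/-- In two full turns every line is reversed twice and gets its number back. -/
theorem iterate_rotate_period (t : Table (m + 1)) (j : ℕ) :
    rotate^[2 * (m + 1) * j] t = t := by
  funext r
  rw [iterate_rotate_apply]
  have h1 : Fin.ofNat (m + 1) (2 * (m + 1) * j) = 0 := by
    ext
    simp only [Fin.ofNat, Fin.val_zero]
    rw [show 2 * (m + 1) * j = (m + 1) * (2 * j) by ring]
    exact Nat.mul_mod_right _ _
  have h2 : (r.val + 2 * (m + 1) * j) / (m + 1) = 2 * j := by
    rw [show 2 * (m + 1) * j = (m + 1) * (2 * j) by ring,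
      Nat.add_mul_div_left _ _ (Nat.succ_pos m), Nat.div_eq_of_lt r.2, Nat.zero_add]
  rw [h1, h2]
  simp

theorem RowsOk.rotate {t : Table (m + 1)} (h : t.RowsOk) : t.rotate.RowsOk := by
  have hinj : Function.Injective fun x : Fin (m + 1) => x - 1 := sub_left_injective
  intro r
  rw [rotate_apply]
  constructor
  · apply List.Nodup.map hinj
    split_ifs
    · exact List.nodup_reverse.2 (h _).1
    · exact (h _).1
  · intro i
    have : ∀ l : List (Fin (m + 1)), (i ∈ l.map (· - 1) ↔ i + 1 ∈ l) := by
      intro l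
      rw [List.mem_map]
      constructor
      · rintro ⟨a, ha, rfl⟩
        simpa using ha
      · intro hi
        exact ⟨i + 1, hi, by simp⟩
    rw [this]
    split_ifs
    · rw [List.mem_reverse, (h _).2]; simp
    · rw [(h _).2]; simp

theorem pos_rotate {t : Table (m + 1)} (h : t.RowsOk) {r i : ℕ} (hr : r < m + 1) (hi : i < m + 1)
    (hir : i ≠ r) : t.rotate.pos r i =
      if r = m then m - 1 - t.pos 0 ((i + 1) % (m + 1))
      else t.pos (r + 1) ((i + 1) % (m + 1)) := by
  lift r to Fin (m + 1) using hr
  lift i to Fin (m + 1) using hi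
  have hinj : Function.Injective fun x : Fin (m + 1) => x - 1 := sub_left_injective
  have hi1 : (i.val + 1) % (m + 1) = (i + 1 : Fin (m + 1)).val := by
    simp [Fin.val_add]
  have e : ∀ l : List (Fin (m + 1)), (l.map (· - 1)).idxOf i = l.idxOf (i + 1) := by
    intro l
    have := List.idxOf_map_injective hinj (i + 1) l
    simpa using this
  rw [pos_val, rotate_apply, hi1, e]
  split_ifs with hr
  · have h1 : r + 1 = 0 := by
      have : r = Fin.last m := Fin.ext hr
      rw [this, Fin.last_add_one]
    have hmem : i + 1 ∈ t (r + 1) := by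
      rw [(h _).2]
      simpa [Fin.ext_iff] using hir
    have h2 := (h (r + 1)).1.idxOf_reverse hmem
    have h3 := h.length (r + 1)
    have h4 := t.pos_val 0 (i + 1)
    rw [h1] at h2 h3 ⊢
    simp only [Fin.val_zero] at h4
    rw [h4]
    omega
  · have h1 : (r + 1).val = r.val + 1 := Fin.val_add_one_of_lt (lt_of_le_of_ne (Fin.le_last r)
        fun e => hr (by rw [e]; rfl))
    rw [← h1, pos_val]

/-- Neighbours stay neighbours when a row is reversed, so only consistency for triples that contain
the renumbered line needs an argument. -/
theorem rotate_posArrangement {t : Table (m + 1)} (h : t.RowsOk) (hm : 2 ≤ m)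
    (hp : PosArrangement (m + 1) t.pos) : PosArrangement (m + 1) t.rotate.pos := by
  have key : ∀ {r i : ℕ}, r < m + 1 → i < m + 1 → i ≠ r →
      ∃ r' i', r' < m + 1 ∧ i' < m + 1 ∧ i' ≠ r' ∧ r' = (if r = m then 0 else r + 1) ∧
        i' = (if i = m then 0 else i + 1) ∧ t.pos r' i' + 1 < m + 1 ∧
        t.rotate.pos r i = if r = m then m - 1 - t.pos r' i' else t.pos r' i' := by
    intro r i hr hi hir
    have hi' : (i + 1) % (m + 1) = if i = m then 0 else i + 1 := by
      split_ifs with h1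
      · rw [h1, Nat.mod_self]
      · exact Nat.mod_eq_of_lt (by omega)
    have hne : (if i = m then 0 else i + 1) ≠ (if r = m then 0 else r + 1) := by
      split_ifs <;> omega
    have hlt1 : (if i = m then 0 else i + 1) < m + 1 := by split_ifs <;> omega
    have hlt2 : (if r = m then 0 else r + 1) < m + 1 := by split_ifs <;> omega
    refine ⟨_, _, hlt2, hlt1, hne, rfl, rfl, hp.lt hlt2 hlt1 hne, ?_⟩
    rw [pos_rotate h hr hi hir, hi']
    split_ifs <;> rfl
  constructor
  · constructor
    · intro r i hr hi hir
      obtain ⟨r', i', -, -, -, -, -, h1, h2⟩ := key hr hi hir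
      rw [h2]
      split_ifs <;> omega
    · intro r i j hr hi hj hir hjr he
      obtain ⟨r1, i1, a1, a2, a3, a4, a5, a6, a7⟩ := key hr hi hir
      obtain ⟨r2, j1, b1, b2, b3, b4, b5, b6, b7⟩ := key hr hj hjr
      obtain rfl : r1 = r2 := by rw [a4, b4]
      have e : t.pos r1 i1 = t.pos r1 j1 := by
        rw [a7, b7] at he
        split_ifs at he <;> omega
      have := hp.inj a1 a2 b2 a3 b3 e
      rw [a5, b5] at this
      split_ifs at this <;> omega
    · intro r k hr hk
      obtain ⟨i, hi, hir, pi⟩ := hp.surj (r := if r = m then 0 else r + 1)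
        (k := if r = m then m - 1 - k else k) (by split_ifs <;> omega) (by split_ifs <;> omega)
      have hlt : (if i = 0 then m else i - 1) < m + 1 := by split_ifs <;> omega
      have hne : (if i = 0 then m else i - 1) ≠ r := by split_ifs at hir ⊢ <;> omega
      refine ⟨if i = 0 then m else i - 1, hlt, hne, ?_⟩
      obtain ⟨r1, i1, a1, a2, a3, a4, a5, a6, a7⟩ := key hr hlt hne
      have hi1 : i1 = i := by rw [a5]; split_ifs <;> omega
      rw [← a4, ← hi1] at pi
      rw [a7, pi]
      split_ifs <;> omega
    · intro a b c hab hbc hc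
      obtain ⟨r1, i1, a1, a2, a3, a4, a5, a6, a7⟩ := key (r := a) (i := b) (by omega) (by omega)
        (by omega)
      obtain ⟨r2, i2, b1, b2, b3, b4, b5, b6, b7⟩ := key (r := a) (i := c) (by omega) (by omega)
        (by omega)
      obtain ⟨r3, i3, c1, c2, c3, c4, c5, c6, c7⟩ := key (r := b) (i := a) (by omega) (by omega)
        (by omega)
      obtain ⟨r4, i4, d1, d2, d3, d4, d5, d6, d7⟩ := key (r := b) (i := c) (by omega) (by omega)
        (by omega)
      obtain ⟨r5, i5, e1, e2, e3, e4, e5, e6, e7⟩ := key (r := c) (i := a) (by omega) (by omega)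
        (by omega)
      obtain ⟨r6, i6, f1, f2, f3, f4, f5, f6, f7⟩ := key (r := c) (i := b) (by omega) (by omega)
        (by omega)
      obtain rfl : r1 = a + 1 := by rw [a4, if_neg (by omega)]
      obtain rfl : r2 = a + 1 := by rw [b4, if_neg (by omega)]
      obtain rfl : r3 = b + 1 := by rw [c4, if_neg (by omega)]
      obtain rfl : r4 = b + 1 := by rw [d4, if_neg (by omega)]
      obtain rfl : i1 = b + 1 := by rw [a5, if_neg (by omega)]
      obtain rfl : i3 = a + 1 := by rw [c5, if_neg (by omega)]
      obtain rfl : i5 = a + 1 := by rw [e5, if_neg (by omega)]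
      obtain rfl : i6 = b + 1 := by rw [f5, if_neg (by omega)]
      rw [if_neg (by omega)] at a7 b7 c7 d7
      rw [a7, b7, c7, d7, e7, f7]
      -- If `c` is the renumbered line, the old triple is `0 < a + 1 < b + 1`, and the rotation
      -- negates all three conditions.
      by_cases hcm : c = m
      · rw [if_pos hcm] at b5 d5 e4 f4
        subst b5 d5 e4 f4
        rw [if_pos hcm, if_pos hcm]
        have h1 := hp.cons (a := 0) (b := a + 1) (c := b + 1) (by omega) (by omega) (by omega)
        have h2 := hp.ne (r := 0) (i := a + 1) (j := b + 1) (by omega) (by omega) (by omega)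
          (by omega) (by omega) (by omega)
        have h3 := hp.ne (r := a + 1) (i := 0) (j := b + 1) (by omega) (by omega) (by omega)
          (by omega) (by omega) (by omega)
        have h4 := hp.ne (r := b + 1) (i := 0) (j := a + 1) (by omega) (by omega) (by omega)
          (by omega) (by omega) (by omega)
        omega
      · rw [if_neg hcm] at b5 d5 e4 f4
        subst b5 d5 e4 f4
        rw [if_neg hcm, if_neg hcm]
        exact hp.cons (by omega) (by omega) (by omega)
  · intro r i j hr hi hj hir hjr he
    have hij : i ≠ j := by rintro rfl; omega
    obtain ⟨r1, i1, a1, a2, a3, a4, a5, a6, a7⟩ := key hr hi hir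
    obtain ⟨r2, j1, b1, b2, b3, b4, b5, b6, b7⟩ := key hr hj hjr
    obtain ⟨i2, r3, c1, c2, c3, c4, c5, c6, c7⟩ := key hi hr hir.symm
    obtain ⟨i3, j2, d1, d2, d3, d4, d5, d6, d7⟩ := key hi hj hij.symm
    obtain ⟨j3, r4, e1, e2, e3, e4, e5, e6, e7⟩ := key hj hr hjr.symm
    obtain ⟨j4, i4, f1, f2, f3, f4, f5, f6, f7⟩ := key hj hi hij
    obtain rfl : r2 = r1 := by rw [a4, b4]
    obtain rfl : r3 = r2 := by rw [b4, c5]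
    obtain rfl : r4 = r3 := by rw [b4, e5]
    obtain rfl : i2 = i1 := by rw [a5, c4]
    obtain rfl : i3 = i2 := by rw [a5, d4]
    obtain rfl : i4 = i3 := by rw [a5, f5]
    obtain rfl : j2 = j1 := by rw [b5, d5]
    obtain rfl : j3 = j2 := by rw [b5, e4]
    obtain rfl : j4 = j3 := by rw [b5, f4]
    clear key a4 a5 b4 b5 c4 c5 d4 d5 e4 e5 f4 f5
    rw [c7, d7, e7, f7]
    rw [a7, b7] at he
    have := hp.adj a1 a2 b2 a3 b3
    have := hp.adj a1 b2 a2 b3 a3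
    split_ifs at he ⊢ <;> omega

theorem iterate_rotate_rowsOk {t : Table (m + 1)} (h : t.RowsOk) (k : ℕ) :
    (rotate^[k] t).RowsOk := by
  induction k with
  | zero => exact h
  | succ k ih =>
    rw [Function.iterate_succ_apply']
    exact ih.rotate

theorem iterate_rotate_posArrangement {t : Table (m + 1)} (h : t.RowsOk) (hm : 2 ≤ m)
    (hp : PosArrangement (m + 1) t.pos) (k : ℕ) : PosArrangement (m + 1) (rotate^[k] t).pos := by
  induction k with
  | zero => exact hp
  | succ k ih =>
    rw [Function.iterate_succ_apply']
    exact rotate_posArrangement (iterate_rotate_rowsOk h k) hm ih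

theorem pos_iterate_rotate (t : Table (m + 1)) {x y : ℕ} (h : x + y < m + 1) :
    (rotate^[x] t).pos 0 y = t.pos x (x + y) := by
  have e0 := pos_val (rotate^[x] t) 0 ⟨y, by omega⟩
  have e1 := pos_val t ⟨x, by omega⟩ ⟨x + y, h⟩
  simp only [Fin.val_zero] at e0 e1
  have h2 : Fin.ofNat (m + 1) x = ⟨x, by omega⟩ := Fin.ext (Nat.mod_eq_of_lt (by omega))
  have h3 : (⟨y, by omega⟩ : Fin (m + 1)) = ⟨x + y, h⟩ - ⟨x, by omega⟩ := by
    rw [eq_sub_iff_add_eq]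
    ext
    simp [Fin.val_add, Nat.add_comm y x, Nat.mod_eq_of_lt h]
  rw [e0, e1, iterate_rotate_apply]
  rw [if_neg (by simp [Nat.div_eq_of_lt (show x < m + 1 by omega)]), zero_add, h2, h3]
  exact List.idxOf_map_injective sub_left_injective _ _

/-- A run involves only numbers from `x` to `x + 2 * d + 1 < m + 1`, so `x` rotations shift it to
line `0` without reversing a row or wrapping around. -/
theorem hasRun_iterate_rotate {t : Table (m + 1)} {x d : ℕ} (h : HasRun (m + 1) t.pos x d) :
    HasRun (m + 1) (Table.rotate^[x] t).pos 0 d := by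
  obtain ⟨h1, h2, h3⟩ := h
  refine ⟨by omega, ?_, ?_⟩
  · rw [pos_iterate_rotate t (by omega)]
    exact h2
  · intro j hj
    have := h3 j hj
    rw [pos_iterate_rotate t (by omega), pos_iterate_rotate t (by omega), ← this.1, ← this.2]
    constructor <;> congr 1 <;> ring

/-- Some choice of the starting line makes the run of line `0` the longest of all runs. -/
theorem exists_normalized {t : Table (m + 1)} (ht : t.IsOptimal) (hm : 2 ≤ m)
    (hodd : (m + 1) % 2 = 1) :
    ∃ k d, Normalized (m + 1) (rotate^[k] t).pos ∧ HasRun (m + 1) (rotate^[k] t).pos 0 d ∧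
      ∀ x < m + 1, ¬ HasRun (m + 1) (rotate^[k] t).pos x (d + 1) := by
  have hr := ht.1.rowsOk
  have hp := ht.posArrangement
  have h0 : ∃ d k, HasRun (m + 1) (rotate^[k] t).pos 0 d := by
    by_cases h1 : t.pos 0 1 = 0
    · exact ⟨0, 0, by omega, h1, by simp⟩
    · have h2 := hp.pos_one_two (by omega) h1
      refine ⟨0, 1, by omega, ?_, by simp⟩
      rw [pos_iterate_rotate t (by omega)]
      exact h2
  classical
  obtain ⟨d₀, hd₀⟩ := h0
  -- Take the longest run of line `0` over all rotations. A longer run of any line `x` would be one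
  -- of line `0` after `x` further rotations.
  obtain ⟨k, hk⟩ := Nat.findGreatest_spec (n := m)
    (P := fun d => ∃ k, HasRun (m + 1) (rotate^[k] t).pos 0 d)
    (by obtain ⟨k, hk⟩ := hd₀; have := hk.1; omega) hd₀
  refine ⟨k, _, ⟨iterate_rotate_posArrangement hr hm hp k, by omega, hodd, hk.2.1⟩, hk, ?_⟩
  intro x _ hx
  have h1 := hasRun_iterate_rotate hx
  rw [← Function.iterate_add_apply] at h1
  have := Nat.le_findGreatest (n := m)
    (P := fun d => ∃ k, HasRun (m + 1) (rotate^[k] t).pos 0 d)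
    (by have := h1.1; omega) ⟨_, h1⟩
  omega

/-! ### Straight lines -/

variable {n : ℕ}

/-- Consistency holds for straight lines: the abscissa where the steepest of three lines crosses
the flattest lies between the other two. -/
theorem abscissa_between {p q x y z : ℝ} (hp : 0 < p) (hq : 0 < q)
    (h : (p + q) * x = q * y + p * z) : (x < z ↔ y < z) ∧ (y < z ↔ y < x) := by
  have hpq : 0 < p + q := by positivity
  have h1 : (p + q) * (z - x) = q * (z - y) := by linear_combination -h
  have h2 : (p + q) * (x - y) = p * (z - y) := by linear_combination h
  have e1 := mul_pos_iff_of_pos_left (b := z - x) hpq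
  have e2 := mul_pos_iff_of_pos_left (b := z - y) hq
  have e3 := mul_pos_iff_of_pos_left (b := x - y) hpq
  have e4 := mul_pos_iff_of_pos_left (b := z - y) hp
  rw [h1, e2, sub_pos, sub_pos] at e1
  rw [h2, e4, sub_pos, sub_pos] at e3
  exact ⟨e1.symm, e3⟩

/-- Rows are sorted by abscissa, so precedence is comparison of abscissae. For three lines the
extreme slopes cross at a weighted mean of the other two abscissae, the weights being slope
differences. -/
theorem RowsOk.isArrangement_of_lines {t : Table n} (h : t.RowsOk) {s b : Fin n → ℝ}
    (hs : StrictAnti s)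
    (hrow : ∀ r, (t r).Pairwise fun i j => (b j - b r) / (s r - s j) < (b i - b r) / (s r - s i)) :
    t.IsArrangement where
  self_exclusion r hr := ((h r).2 r).1 hr rfl
  non_repetition r := (h r).1
  completeness r i hi := ((h r).2 i).2 hi
  consistency := by
    have key : ∀ r i j, i ≠ r → j ≠ r → i ≠ j →
        (t.After r i j ↔ (b j - b r) / (s r - s j) < (b i - b r) / (s r - s i)) := by
      have one : ∀ r i j, i ≠ r → j ≠ r → t.After r i j →
          (b j - b r) / (s r - s j) < (b i - b r) / (s r - s i) := by
        intro r i j hi hj hij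
        have hi' := List.idxOf_lt_length_iff.2 (((h r).2 i).2 hi)
        have hj' := List.idxOf_lt_length_iff.2 (((h r).2 j).2 hj)
        have := List.pairwise_iff_getElem.1 (hrow r) _ _ hi' hj' hij
        rwa [List.getElem_idxOf, List.getElem_idxOf] at this
      intro r i j hi hj hij
      refine ⟨one r i j hi hj, fun hlt => ?_⟩
      by_contra hc
      have hmem := ((h r).2 i).2 hi
      have : t.After r j i := by
        refine lt_of_le_of_ne (not_lt.1 hc) fun e => hij ?_
        exact ((List.idxOf_inj hmem).1 e.symm)
      exact lt_asymm hlt (one r j i hj hi this)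
    intro x y z hxy hyz
    have h1 := hs hxy
    have h2 := hs hyz
    rw [key x y z hxy.ne' (hxy.trans hyz).ne' hyz.ne, key y x z hxy.ne hyz.ne' (hxy.trans hyz).ne,
      key z x y (hxy.trans hyz).ne hyz.ne hxy.ne]
    have e1 : (b x - b y) / (s y - s x) = (b y - b x) / (s x - s y) := by
      rw [← neg_sub (b y), ← neg_sub (s x), neg_div_neg_eq]
    have e2 : (b x - b z) / (s z - s x) = (b z - b x) / (s x - s z) := by
      rw [← neg_sub (b z), ← neg_sub (s x), neg_div_neg_eq]
    have e3 : (b y - b z) / (s z - s y) = (b z - b y) / (s y - s z) := by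
      rw [← neg_sub (b z), ← neg_sub (s y), neg_div_neg_eq]
    rw [e1, e2, e3]
    refine abscissa_between (sub_pos.2 h1) (sub_pos.2 h2) ?_
    have n1 : s x - s y ≠ 0 := (sub_pos.2 h1).ne'
    have n2 : s y - s z ≠ 0 := (sub_pos.2 h2).ne'
    have n3 : s x - s z ≠ 0 := (sub_pos.2 (h2.trans h1)).ne'
    rw [mul_div_cancel₀ _ n1, mul_div_cancel₀ _ n2, sub_add_sub_cancel, mul_div_cancel₀ _ n3]
    ring

/-! ### Tables as lists of numbers, and inequivalence -/

/-- The table with the given rows. -/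
def ofRows (m : ℕ) (rows : List (List ℕ)) : Table (m + 1) := fun r =>
  (rows.getD r.val []).map (Fin.ofNat (m + 1))

/-- The rows of the mirror image. -/
def reflectRows (n : ℕ) (rows : List (List ℕ)) : List (List ℕ) :=
  rows.reverse.map fun row => row.map (n - 1 - ·)

/-- Row `r` after `k` rotations. -/
def rotateRow (n : ℕ) (rows : List (List ℕ)) (k r : ℕ) : List ℕ :=
  ((if (r + k) / n % 2 = 1 then (rows.getD ((r + k) % n) []).reverse
    else rows.getD ((r + k) % n) [])).map fun x => (x + (n - k % n)) % n

/-- All entries are smaller than `n`. -/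
def RowsLt (n : ℕ) (rows : List (List ℕ)) : Prop := ∀ r, ∀ x ∈ rows.getD r [], x < n

theorem map_val_ofRows {rows : List (List ℕ)} (h : RowsLt (m + 1) rows) (r : Fin (m + 1)) :
    (ofRows m rows r).map Fin.val = rows.getD r [] := by
  rw [ofRows, List.map_map]
  conv_rhs => rw [← List.map_id (rows.getD r.val [])]
  apply List.map_congr_left
  intro x hx
  exact Nat.mod_eq_of_lt (h r x hx)

theorem map_val_iterate_rotate {rows : List (List ℕ)} (h : RowsLt (m + 1) rows) (k : ℕ)
    (r : Fin (m + 1)) :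
    (rotate^[k] (ofRows m rows) r).map Fin.val = rotateRow (m + 1) rows k r := by
  have e : (r + Fin.ofNat (m + 1) k).val = (r.val + k) % (m + 1) := by
    simp [Fin.val_add]
  have e2 := map_val_ofRows h (r + Fin.ofNat (m + 1) k)
  rw [e] at e2
  rw [iterate_rotate_apply, rotateRow, ← e2, ← List.map_reverse, ← apply_ite (List.map Fin.val),
    List.map_map, List.map_map]
  apply List.map_congr_left
  intro x _
  simp only [Function.comp, Fin.sub_def, Fin.ofNat]
  rw [Nat.add_comm]

theorem getD_reflectRows {rows : List (List ℕ)} {r : ℕ} (hr : r < rows.length) :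
    (reflectRows n rows).getD r [] = (rows.getD (rows.length - 1 - r) []).map (n - 1 - ·) := by
  rw [reflectRows, List.getD_eq_getElem _ _ (by simpa), List.getElem_map, List.getElem_reverse,
    List.getD_eq_getElem _ _ (by omega)]

theorem rowsLt_reflectRows (m : ℕ) (rows : List (List ℕ)) :
    RowsLt (m + 1) (reflectRows (m + 1) rows) := by
  intro r x hx
  by_cases hr : r < rows.length
  · rw [getD_reflectRows hr] at hx
    obtain ⟨y, _, rfl⟩ := List.mem_map.1 hx
    omega
  · rw [List.getD_eq_default _ _ (by simpa [reflectRows] using hr)] at hx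
    simp at hx

theorem eq_of_map_val {s t : Table n} (h : ∀ r, (s r).map Fin.val = (t r).map Fin.val) : s = t :=
  funext fun r => List.map_injective_iff.2 Fin.val_injective (h r)

theorem ofRows_reflectRows {rows : List (List ℕ)} (h : RowsLt (m + 1) rows)
    (hl : rows.length = m + 1) :
    ofRows m (reflectRows (m + 1) rows) = (ofRows m rows).reflect := by
  apply eq_of_map_val
  intro r
  rw [map_val_ofRows (rowsLt_reflectRows m rows), getD_reflectRows (by rw [hl]; exact r.2), reflect]
  have e := map_val_ofRows h r.rev
  have e1 : rows.length - 1 - r.val = r.rev.val := by rw [Fin.val_rev, hl]; omega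
  rw [e1, ← e, List.map_map, List.map_map]
  apply List.map_congr_left
  intro x _
  simp only [Function.comp, Fin.val_rev]
  omega

/-- Rotation is undone by completing double turns, so that equivalence, which allows only forward
iterates, follows from equality of two rotated tables. -/
theorem eq_iterate_of_iterate_eq {s t : Table (m + 1)} {j k : ℕ}
    (h : rotate^[j] t = rotate^[k] s) : t = rotate^[2 * (m + 1) * j - j + k] s := by
  have hj : 2 * (m + 1) * j - j + j = 2 * (m + 1) * j := by
    apply Nat.sub_add_cancel
    exact Nat.le_mul_of_pos_left _ (by omega)
  rw [Function.iterate_add_apply, ← h, ← Function.iterate_add_apply, hj, iterate_rotate_period]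

theorem iterate_rotate_mod (t : Table (m + 1)) (k : ℕ) :
    rotate^[k] t = rotate^[k % (2 * (m + 1))] t := by
  conv_lhs => rw [← Nat.mod_add_div k (2 * (m + 1)), Function.iterate_add_apply,
    iterate_rotate_period]

/-- No rotation of the first table is the second table. -/
def Unrotatable (n : ℕ) (rows rows' : List (List ℕ)) : Prop :=
  ∀ k < 2 * n, ∃ r < n, rotateRow n rows k r ≠ rows'.getD r []

instance (n : ℕ) (rows rows' : List (List ℕ)) : Decidable (Unrotatable n rows rows') :=
  inferInstanceAs (Decidable (∀ k < 2 * n, ∃ r < n, _))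

/-- By periodicity `2 * (m + 1)` rotations cover all exponents. -/
theorem Unrotatable.ne {rows rows' : List (List ℕ)} (h : RowsLt (m + 1) rows)
    (h' : RowsLt (m + 1) rows') (hu : Unrotatable (m + 1) rows rows') (k : ℕ) :
    ofRows m rows' ≠ rotate^[k] (ofRows m rows) := by
  intro e
  obtain ⟨r, hr, hne⟩ := hu _ (Nat.mod_lt k (y := 2 * (m + 1)) (by omega))
  apply hne
  have h1 := map_val_iterate_rotate h (k % (2 * (m + 1))) ⟨r, hr⟩
  have h2 := map_val_ofRows h' ⟨r, hr⟩
  rw [← iterate_rotate_mod, ← e, h2] at h1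
  exact h1.symm

theorem not_sameArrangement {rows rows' : List (List ℕ)} (h : RowsLt (m + 1) rows)
    (h' : RowsLt (m + 1) rows') (hl : rows.length = m + 1)
    (h1 : Unrotatable (m + 1) rows rows')
    (h2 : Unrotatable (m + 1) (reflectRows (m + 1) rows) rows') :
    ¬ (ofRows m rows).SameArrangement (ofRows m rows') := by
  rintro ⟨k, e | e⟩
  · exact h1.ne h h' k e
  · rw [← ofRows_reflectRows h hl] at e
    exact h2.ne (rowsLt_reflectRows m rows) h' k e

/-! ### Tables certified by integer slopes and intercepts -/

/-- The rows of a table, with straight lines that have this table. -/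
structure LineData where
  rows : List (List ℕ)
  slope : List ℤ
  icept : List ℤ

namespace LineData

/-- Lines `a` and `b` are neighbours in the row. -/
def Adjacent (row : List ℕ) (a b : ℕ) : Prop :=
  row.idxOf b = row.idxOf a + 1 ∨ row.idxOf a = row.idxOf b + 1

instance (row : List ℕ) (a b : ℕ) : Decidable (Adjacent row a b) :=
  inferInstanceAs (Decidable (_ ∨ _))

/-- The crossing with line `i` lies to the right of the crossing with line `j` on line `r`. -/
def RightOf (d : LineData) (r i j : ℕ) : Prop :=
  let u := d.icept.getD i 0 - d.icept.getD r 0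
  let v := d.slope.getD r 0 - d.slope.getD i 0
  let x := d.icept.getD j 0 - d.icept.getD r 0
  let y := d.slope.getD r 0 - d.slope.getD j 0
  -- This is `x / y < u / v` multiplied by the squares of both denominators, so their signs do not
  -- matter.
  x * y * (v * v) < u * v * (y * y)

instance (d : LineData) (r i j : ℕ) : Decidable (d.RightOf r i j) :=
  inferInstanceAs (Decidable (_ < _))

/-- The conditions on row `r`. -/
def RowOk (n : ℕ) (d : LineData) (r : ℕ) : Prop :=
  let row := d.rows.getD r []
  row.length + 1 = n ∧ row.Nodup ∧ (∀ x ∈ row, x < n ∧ x ≠ r) ∧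
    -- Consecutive entries suffice: the order of abscissae is transitive, and triangles concern only
    -- neighbours.
    row.IsChain (fun i j => d.RightOf r i j ∧ Adjacent (d.rows.getD i []) r j ∧
      Adjacent (d.rows.getD j []) r i)

instance (n : ℕ) (d : LineData) (r : ℕ) : Decidable (d.RowOk n r) :=
  inferInstanceAs (Decidable (_ ∧ _ ∧ _ ∧ _))

/-- The table is optimal, and it is the table of the lines. -/
def Ok (n : ℕ) (d : LineData) : Prop :=
  d.rows.length = n ∧ (∀ r < n, d.RowOk n r) ∧
    ∀ r < n - 1, d.slope.getD (r + 1) 0 < d.slope.getD r 0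

instance (n : ℕ) (d : LineData) : Decidable (d.Ok n) :=
  inferInstanceAs (Decidable (_ ∧ _ ∧ _))

/-- The table that the data describe. -/
def table (m : ℕ) (d : LineData) : Table (m + 1) := ofRows m d.rows

theorem Ok.rowsLt {d : LineData} (h : d.Ok n) : RowsLt n d.rows := by
  intro r x hx
  rcases Nat.lt_or_ge r n with hr | hr
  · exact ((h.2.1 r hr).2.2.1 x hx).1
  · rw [List.getD_eq_default _ _ (by rw [h.1]; exact hr)] at hx
    simp at hx

theorem Ok.rowsOk {d : LineData} (h : d.Ok (m + 1)) : (d.table m).RowsOk := by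
  intro r
  obtain ⟨h1, h2, h3, -⟩ := h.2.1 r r.2
  have e := map_val_ofRows h.rowsLt r
  rw [← e] at h1 h2 h3
  have hnd : (ofRows m d.rows r).Nodup := h2.of_map
  refine ⟨hnd, fun i => ⟨?_, ?_⟩⟩
  · rintro hi rfl
    exact (h3 i (List.mem_map_of_mem hi)).2 rfl
  · intro hi
    have hsub : (ofRows m d.rows r).toFinset ⊆ Finset.univ.erase r := by
      intro x hx
      simp only [Finset.mem_erase, Finset.mem_univ, and_true]
      rintro rfl
      exact (h3 x (List.mem_map_of_mem (List.mem_toFinset.1 hx))).2 rfl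
    have hcard : (Finset.univ.erase r).card ≤ (ofRows m d.rows r).toFinset.card := by
      rw [List.toFinset_card_of_nodup hnd, Finset.card_erase_of_mem (Finset.mem_univ r),
        Finset.card_univ, Fintype.card_fin]
      simp at h1
      omega
    have := Finset.eq_of_subset_of_card_le hsub hcard
    rw [Finset.ext_iff] at this
    have hi' := this i
    change i ∈ ofRows m d.rows r
    simpa only [Finset.mem_erase, hi, ne_eq, not_false_iff, Finset.mem_univ, and_self, iff_true,
      List.mem_toFinset] using hi'

theorem Ok.slope_strictAnti {d : LineData} (h : d.Ok (m + 1)) :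
    StrictAnti fun i : Fin (m + 1) => (d.slope.getD i.val 0 : ℝ) := by
  rw [Fin.strictAnti_iff_succ_lt]
  intro i
  have := h.2.2 i.val (by simp)
  simpa using this

theorem Ok.pairwise {d : LineData} (h : d.Ok (m + 1)) (r : Fin (m + 1)) :
    (d.table m r).Pairwise fun i j : Fin (m + 1) =>
      ((d.icept.getD j.val 0 : ℝ) - (d.icept.getD r.val 0 : ℝ)) /
        ((d.slope.getD r.val 0 : ℝ) - (d.slope.getD j.val 0 : ℝ)) <
      ((d.icept.getD i.val 0 : ℝ) - (d.icept.getD r.val 0 : ℝ)) /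
        ((d.slope.getD r.val 0 : ℝ) - (d.slope.getD i.val 0 : ℝ)) := by
  obtain ⟨h1, h2, h3, h4⟩ := h.2.1 r r.2
  have hinj := h.slope_strictAnti.injective
  rw [← map_val_ofRows h.rowsLt r, List.isChain_map] at h4
  set f : Fin (m + 1) → ℝ := fun i => ((d.icept.getD i.val 0 : ℝ) - (d.icept.getD r.val 0 : ℝ)) /
        ((d.slope.getD r.val 0 : ℝ) - (d.slope.getD i.val 0 : ℝ))
  have hne : ∀ i, i ∈ ofRows m d.rows r →
      (d.slope.getD r.val 0 : ℝ) - (d.slope.getD i.val 0 : ℝ) ≠ 0 := by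
    intro i hi e
    exact ((h.rowsOk r).2 i).1 hi (hinj (sub_eq_zero.1 e)).symm
  have hc : (ofRows m d.rows r).IsChain fun i j => f j < f i := by
    rw [List.isChain_iff_getElem] at h4 ⊢
    intro i hi
    have h5 := (h4 i hi).1
    have n1 := hne _ (List.getElem_mem (Nat.lt_of_succ_lt hi))
    have n2 := hne _ (List.getElem_mem hi)
    simp only [RightOf] at h5
    simp only [f]
    generalize (ofRows m d.rows r)[i] = x at *
    generalize (ofRows m d.rows r)[i + 1] = y at *
    rw [← mul_div_mul_right _ _ n2, ← mul_div_mul_right (_ - _) _ n1,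
      div_lt_div_iff₀ (mul_self_pos.2 n2) (mul_self_pos.2 n1)]
    exact_mod_cast h5
  have : IsTrans (Fin (m + 1)) fun i j => f j < f i := ⟨fun _ _ _ a b => b.trans a⟩
  exact List.isChain_iff_pairwise.1 hc

theorem Ok.isTableOfLines {d : LineData} (h : d.Ok (m + 1)) :
    ∃ s b : Fin (m + 1) → ℝ, (d.table m).IsTableOfLines s b :=
  ⟨_, fun i => (d.icept.getD i.val 0 : ℝ), h.slope_strictAnti,
    h.rowsOk.isArrangement_of_lines h.slope_strictAnti h.pairwise, h.pairwise⟩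

theorem idxOf_table {d : LineData} (h : d.Ok (m + 1)) (r i : Fin (m + 1)) :
    (d.rows.getD r.val []).idxOf i.val = (d.table m).pos r i := by
  rw [← map_val_ofRows h.rowsLt r, pos_val]
  exact List.idxOf_map_injective Fin.val_injective _ _

/-- The chain condition of `RowOk` contains the triangle property of every segment, which is what
`IsArrangement.isOptimal` needs. -/
theorem Ok.isOptimal {d : LineData} (h : d.Ok (m + 1)) : (d.table m).IsOptimal := by
  obtain ⟨s, b, h1⟩ := h.isTableOfLines
  refine h1.2.1.isOptimal ?_
  intro r i j hi hj hij
  obtain ⟨-, -, -, h4⟩ := h.2.1 r r.2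
  rw [List.isChain_iff_getElem] at h4
  have hmi := List.idxOf_lt_length_iff.2 (((h.rowsOk r).2 i).2 hi)
  have hmj := List.idxOf_lt_length_iff.2 (((h.rowsOk r).2 j).2 hj)
  rw [pos_val, pos_val] at hij
  have hlen : (d.rows.getD r.val []).length = (d.table m r).length := by
    rw [← map_val_ofRows h.rowsLt r, List.length_map]
    rfl
  have h5 := (h4 ((d.table m r).idxOf i) (by rw [hlen, ← hij]; exact hmj)).2
  have e1 : (d.rows.getD r.val [])[(d.table m r).idxOf i]'(by rw [hlen]; exact hmi) = i.val := by
    have := map_val_ofRows h.rowsLt r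
    simp only [← this, List.getElem_map]
    exact congrArg Fin.val (List.getElem_idxOf hmi)
  have e2 : (d.rows.getD r.val [])[(d.table m r).idxOf i + 1]'(by
      rw [hlen, ← hij]; exact hmj) = j.val := by
    have := map_val_ofRows h.rowsLt r
    simp only [← this, List.getElem_map, ← hij]
    exact congrArg Fin.val (List.getElem_idxOf hmj)
  rw [e1, e2] at h5
  simpa only [Adjacent, idxOf_table h] using h5

end LineData

/-! ### Completeness of a list -/

/-- The lines of the state form, for some triple `(i, k, f)` of the list, the `k`-th rotation of
the `i`-th table or, if `f` is true, of its mirror image. -/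
def knownLeaf (n : ℕ) (ds : List LineData) (certs : List (ℕ × ℕ × Bool)) (bs : List Block)
    (z : Strand) : Bool :=
  certs.any fun c =>
    match ds[c.1]? with
    | none => false
    | some d => (lines bs ++ [z]).all fun s => s.row.beq (encode
        ((rotateRow n (bif c.2.2 then reflectRows n d.rows else d.rows) c.2.1 s.lab).map (1 + ·)))

theorem lt_of_mem_rotateRow {n k r x : ℕ} {rows : List (List ℕ)} (hn : 0 < n)
    (hx : x ∈ rotateRow n rows k r) : x < n := by
  obtain ⟨y, _, rfl⟩ := List.mem_map.1 hx
  exact Nat.mod_lt _ hn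

/-- A complete strand encodes its whole row, and numbers in base `64` with nonzero digits determine
their digits; `m < 30` keeps the digits below `64`. -/
theorem eq_iterate_rotate_of_codes {u : Table (m + 1)} (hu : u.RowsOk) (hm : m < 30)
    {rows : List (List ℕ)} (hrows : RowsLt (m + 1) rows) {k : ℕ}
    (h : ∀ x < m + 1, ∃ s, s.lab = x ∧ StrandOk (m + 1) u.pos m s ∧
      s.row = encode ((rotateRow (m + 1) rows k s.lab).map (1 + ·))) :
    u = rotate^[k] (ofRows m rows) := by
  apply eq_of_map_val
  intro r
  obtain ⟨s, hs, hok, hrow⟩ := h r r.2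
  obtain ⟨l, hl, hc, hi⟩ := hok.row.exists_list
  rw [map_val_iterate_rotate hrows, ← hs]
  have e : l = rotateRow (m + 1) rows k s.lab := by
    have hinj : Function.Injective fun x : ℕ => 1 + x := fun a b h => Nat.add_left_cancel h
    apply List.map_injective_iff.2 hinj
    apply encode_injective
    · intro v hv
      obtain ⟨w, hw, rfl⟩ := List.mem_map.1 hv
      obtain ⟨i, h, rfl⟩ := List.getElem_of_mem hw
      have := (hi i h).1
      omega
    · intro v hv
      obtain ⟨w, hw, rfl⟩ := List.mem_map.1 hv
      have := lt_of_mem_rotateRow (Nat.succ_pos m) hw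
      omega
    · rw [← hc, hrow]
  rw [← e]
  have hlen := hu.length r
  apply List.ext_getElem
  · rw [List.length_map, hl]; omega
  · intro i h1 h2
    obtain ⟨h3, h4, h5⟩ := hi i h2
    rw [hs] at h4 h5
    have e2 := u.pos_val r ⟨l[i], h3⟩
    rw [h5] at e2
    have hmem := ((hu r).2 ⟨l[i], h3⟩).2 (by simpa [Fin.ext_iff] using h4)
    have e3 := List.getElem_idxOf (List.idxOf_lt_length_iff.2 hmem)
    simp only [← e2] at e3
    rw [List.getElem_map, e3]

/-- Normalize the table by rotating it. The sweep for the length of its longest run meets it at an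
accepted leaf, hence as a rotation of a listed table or of a mirror image, and the normalizing
rotation is undone. -/
theorem exists_sameArrangement {ds : List LineData} {certs : List (ℕ × ℕ × Bool)}
    (hds : ∀ d ∈ ds, d.Ok (m + 1)) (hm : 2 ≤ m) (hm' : m < 30) (hodd : (m + 1) % 2 = 1)
    (hs : ∀ d < (m + 1) / 2, sweep (m + 1) (knownLeaf (m + 1) ds certs) d = true)
    {t : Table (m + 1)} (ht : t.IsOptimal) :
    ∃ s ∈ ds.map (LineData.table m), s.SameArrangement t := by
  obtain ⟨j, d, hN, hd, hrun⟩ := exists_normalized ht hm hodd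
  obtain ⟨bs, z, hleaf, hall⟩ := sweep_sound hN (by omega) _ hd hrun
    (hs d (by have := hd.1; omega))
  obtain ⟨⟨i, k, f⟩, -, hc⟩ := List.any_eq_true.1 hleaf
  cases hi : ds[i]? with
  | none => simp [hi] at hc
  | some a =>
    simp only [hi, List.all_eq_true] at hc
    have ha := List.mem_of_getElem? hi
    have hok := hds a ha
    refine ⟨a.table m, List.mem_map_of_mem ha, ?_⟩
    have key : ∀ rows : List (List ℕ), RowsLt (m + 1) rows →
        (bif f then reflectRows (m + 1) a.rows else a.rows) = rows →
        t = rotate^[2 * (m + 1) * j - j + k] (ofRows m rows) := by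
      intro rows h1 h2
      apply eq_iterate_of_iterate_eq
      apply eq_iterate_rotate_of_codes (iterate_rotate_rowsOk ht.1.rowsOk j) hm' h1
      intro x hx
      obtain ⟨s, hs, hsx, hsok⟩ := hall x hx
      refine ⟨s, hsx, hsok, ?_⟩
      rw [← h2]
      exact Nat.eq_of_beq_eq_true (hc s hs)
    cases f with
    | false => exact ⟨_, Or.inl (key a.rows hok.rowsLt rfl)⟩
    | true =>
      refine ⟨2 * (m + 1) * j - j + k, Or.inr ?_⟩
      rw [LineData.table, ← ofRows_reflectRows hok.rowsLt hok.1]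
      exact key _ (rowsLt_reflectRows m a.rows) rfl

/-- The tables are optimal tables of straight lines, and no two of them are equivalent. -/
def Irredundant (n : ℕ) (ds : List LineData) : Prop :=
  (∀ d ∈ ds, d.Ok n) ∧ ds.Pairwise fun d e =>
    Unrotatable n d.rows e.rows ∧ Unrotatable n (reflectRows n d.rows) e.rows

instance (n : ℕ) (ds : List LineData) : Decidable (Irredundant n ds) :=
  inferInstanceAs (Decidable (_ ∧ _))

/-- Every sweep ends in a table of the list. -/
def Exhaustive (n : ℕ) (ds : List LineData) (certs : List (ℕ × ℕ × Bool)) : Prop :=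
  ∀ d < n / 2, sweep n (knownLeaf n ds certs) d = true

instance (n : ℕ) (ds : List LineData) (certs : List (ℕ × ℕ × Bool)) :
    Decidable (Exhaustive n ds certs) :=
  inferInstanceAs (Decidable (∀ d < _, _))

theorem exists_complete_list {ds : List LineData} {certs : List (ℕ × ℕ × Bool)} (hm : 2 ≤ m)
    (hm' : m < 30) (hodd : (m + 1) % 2 = 1) (h1 : Irredundant (m + 1) ds)
    (h2 : Exhaustive (m + 1) ds certs) :
    ∃ L : List (Table (m + 1)), L.length = ds.length ∧ (∀ t ∈ L, t.IsOptimal) ∧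
      (∀ t ∈ L, ∃ s b : Fin (m + 1) → ℝ, t.IsTableOfLines s b) ∧
      L.Pairwise (fun s t => ¬ s.SameArrangement t) ∧
      ∀ t : Table (m + 1), t.IsOptimal → ∃ s ∈ L, s.SameArrangement t := by
  refine ⟨ds.map (LineData.table m), by simp, ?_, ?_, ?_,
    fun t ht => exists_sameArrangement h1.1 hm hm' hodd h2 ht⟩
  · intro t ht
    obtain ⟨d, hd, rfl⟩ := List.mem_map.1 ht
    exact (h1.1 d hd).isOptimal
  · intro t ht
    obtain ⟨d, hd, rfl⟩ := List.mem_map.1 ht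
    exact (h1.1 d hd).isTableOfLines
  · rw [List.pairwise_map]
    refine h1.2.imp_of_mem ?_
    intro d e hd he h
    exact not_sameArrangement (h1.1 d hd).rowsLt (h1.1 e he).rowsLt (h1.1 d hd).1 h.1 h.2

/-! ### The lists and the computations -/

/-- Optimal tables with three lines. -/
def optimalThree : List LineData := [
  ⟨[[1, 2], [0, 2], [0, 1]],
    [2, 0, -2],
    [-2, -1, -2]⟩]

/-- The places where the sweeps end: index of the table, number of rotations, and whether it is
mirrored first. Soundness does not depend on this list, since `knownLeaf` compares all rows. -/
def leavesThree : List (ℕ × ℕ × Bool) := [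
  (0, 0, false)]

set_option maxRecDepth 100000 in
theorem irredundant_optimalThree : Irredundant 3 optimalThree := by
  decide +kernel

set_option maxRecDepth 100000 in
theorem exhaustive_optimalThree : Exhaustive 3 optimalThree leavesThree := by
  decide +kernel

/-- Optimal tables with five lines. -/
def optimalFive : List LineData := [
  ⟨[[1, 3, 2, 4], [0, 3, 4, 2], [3, 0, 4, 1], [2, 0, 1, 4], [0, 2, 1, 3]],
    [3, 1, 0, -1, -3],
    [-3, 1, -1, 0, -3]⟩]

def leavesFive : List (ℕ × ℕ × Bool) := [
  (0, 0, false)]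

set_option maxRecDepth 100000 in
theorem irredundant_optimalFive : Irredundant 5 optimalFive := by
  decide +kernel

set_option maxRecDepth 100000 in
theorem exhaustive_optimalFive : Exhaustive 5 optimalFive leavesFive := by
  decide +kernel

/-- Optimal tables with nine lines. -/
def optimalNine : List LineData := [
  ⟨[[1, 3, 2, 5, 4, 7, 6, 8], [0, 3, 7, 5, 8, 4, 6, 2], [3, 0, 5, 7, 4, 8, 6, 1],
     [2, 0, 1, 7, 8, 5, 6, 4], [5, 0, 7, 2, 8, 1, 6, 3], [4, 0, 2, 7, 1, 8, 3, 6],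
     [7, 0, 8, 2, 1, 4, 3, 5], [6, 0, 4, 2, 5, 1, 3, 8], [0, 6, 2, 4, 1, 5, 3, 7]],
    [9, 3, 2, 1, 0, -1, -2, -5, -21],
    [-8, -1, -2, 0, -2, -1, -3, 0, -4]⟩]

def leavesNine : List (ℕ × ℕ × Bool) := [
  (0, 0, false)]

set_option maxRecDepth 100000 in
theorem irredundant_optimalNine : Irredundant 9 optimalNine := by
  decide +kernel

set_option maxRecDepth 100000 in
theorem exhaustive_optimalNine : Exhaustive 9 optimalNine leavesNine := by
  decide +kernel

/-- Optimal tables with fifteen lines. -/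
def optimalFifteen : List LineData := [
  ⟨[[1, 3, 2, 5, 4, 7, 6, 9, 8, 11, 10, 13, 12, 14],
     [0, 3, 7, 5, 13, 9, 11, 4, 8, 6, 14, 10, 12, 2],
     [3, 0, 5, 7, 4, 9, 6, 11, 8, 13, 10, 14, 12, 1],
     [2, 0, 1, 7, 13, 5, 11, 9, 14, 8, 12, 6, 10, 4],
     [5, 0, 7, 2, 9, 13, 11, 1, 8, 14, 6, 12, 10, 3],
     [4, 0, 2, 7, 1, 13, 3, 11, 14, 9, 12, 8, 10, 6],
     [7, 0, 9, 2, 11, 13, 8, 1, 14, 4, 12, 3, 10, 5],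
     [6, 0, 4, 2, 5, 1, 3, 13, 14, 11, 12, 9, 10, 8],
     [9, 0, 11, 2, 13, 6, 1, 4, 14, 3, 12, 5, 10, 7],
     [8, 0, 6, 2, 4, 13, 1, 11, 3, 14, 5, 12, 7, 10],
     [11, 0, 13, 2, 14, 1, 12, 4, 3, 6, 5, 8, 7, 9],
     [10, 0, 8, 2, 6, 13, 4, 1, 9, 3, 5, 14, 7, 12],
     [13, 0, 14, 2, 1, 10, 4, 6, 3, 8, 5, 9, 7, 11],
     [12, 0, 10, 2, 8, 6, 11, 4, 9, 1, 5, 3, 7, 14],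
     [0, 12, 2, 10, 1, 6, 4, 8, 3, 9, 5, 11, 7, 13]],
    [57, 16, 9, 6, 4, 2, 1, 0, -1, -2, -3, -5, -8, -14, -39],
    [-59, 18, 3, 12, 4, 7, -1, 8, -3, -1, -14, -5, -23, -12, -66]⟩,
  ⟨[[1, 3, 2, 5, 4, 7, 6, 9, 8, 11, 10, 13, 12, 14],
     [0, 3, 13, 7, 14, 9, 11, 5, 8, 4, 10, 6, 12, 2],
     [3, 0, 5, 7, 4, 9, 6, 11, 8, 13, 10, 14, 12, 1],
     [2, 0, 1, 13, 14, 7, 11, 9, 12, 8, 10, 5, 6, 4],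
     [5, 0, 7, 2, 9, 13, 11, 14, 8, 1, 10, 12, 6, 3],
     [4, 0, 2, 7, 13, 9, 14, 11, 1, 8, 12, 10, 3, 6],
     [7, 0, 9, 2, 11, 13, 8, 14, 10, 1, 12, 4, 3, 5],
     [6, 0, 4, 2, 5, 13, 1, 14, 3, 11, 12, 9, 10, 8],
     [9, 0, 11, 2, 13, 6, 14, 4, 1, 5, 12, 3, 10, 7],
     [8, 0, 6, 2, 4, 13, 5, 14, 1, 11, 3, 12, 7, 10],
     [11, 0, 13, 2, 14, 6, 1, 4, 12, 5, 3, 8, 7, 9],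
     [10, 0, 8, 2, 6, 13, 4, 14, 5, 1, 9, 3, 7, 12],
     [13, 0, 14, 2, 1, 6, 4, 10, 5, 8, 3, 9, 7, 11],
     [12, 0, 10, 2, 8, 6, 11, 4, 9, 5, 7, 1, 3, 14],
     [0, 12, 2, 10, 6, 8, 4, 11, 5, 9, 1, 7, 3, 13]],
    [226, 86, 50, 32, 21, 13, 5, -2, -8, -15, -24, -36, -57, -106, -414],
    [-535, 91, -55, 89, 3, 29, -29, 62, -23, 11, -68, -6, -146, 30, -256]⟩,
  ⟨[[1, 3, 2, 5, 4, 7, 6, 9, 8, 11, 10, 13, 12, 14],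
     [0, 3, 13, 7, 11, 5, 9, 4, 10, 8, 14, 6, 12, 2],
     [3, 0, 5, 7, 4, 11, 9, 13, 8, 10, 6, 14, 12, 1],
     [2, 0, 1, 13, 14, 11, 12, 9, 10, 7, 8, 5, 6, 4],
     [5, 0, 7, 2, 11, 13, 9, 1, 10, 14, 8, 12, 6, 3],
     [4, 0, 2, 7, 13, 11, 1, 9, 14, 10, 12, 8, 3, 6],
     [7, 0, 9, 11, 8, 13, 10, 2, 14, 1, 12, 4, 3, 5],
     [6, 0, 4, 2, 5, 13, 1, 11, 14, 9, 12, 10, 3, 8],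
     [9, 0, 11, 6, 13, 2, 10, 1, 14, 4, 12, 5, 3, 7],
     [8, 0, 6, 11, 2, 13, 4, 1, 5, 14, 7, 12, 3, 10],
     [11, 0, 13, 6, 2, 8, 1, 4, 14, 5, 12, 7, 3, 9],
     [10, 0, 8, 6, 9, 2, 4, 13, 5, 1, 7, 14, 3, 12],
     [13, 0, 14, 2, 1, 6, 4, 8, 5, 10, 7, 9, 3, 11],
     [12, 0, 10, 6, 8, 2, 9, 4, 11, 5, 7, 1, 3, 14],
     [0, 12, 2, 6, 1, 8, 4, 10, 5, 9, 7, 11, 3, 13]],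
    [44, 20, 12, 8, 5, 3, 1, -1, -2, -4, -7, -11, -17, -34, -330],
    [-66, -4, -8, 14, -2, 2, -5, 4, -3, 2, -2, 7, -9, 18, -10]⟩,
  ⟨[[1, 3, 2, 5, 4, 9, 7, 11, 8, 10, 6, 13, 12, 14],
     [0, 3, 9, 5, 11, 4, 10, 7, 13, 8, 14, 6, 12, 2],
     [3, 0, 5, 9, 4, 11, 7, 10, 8, 13, 6, 14, 12, 1],
     [2, 0, 1, 9, 13, 11, 14, 10, 12, 7, 8, 5, 6, 4],
     [5, 0, 9, 2, 11, 1, 10, 13, 7, 14, 8, 12, 6, 3],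
     [4, 0, 2, 9, 1, 11, 13, 10, 14, 7, 12, 8, 3, 6],
     [7, 9, 8, 11, 10, 0, 13, 2, 14, 1, 12, 4, 3, 5],
     [6, 9, 0, 11, 2, 10, 1, 13, 4, 14, 5, 12, 3, 8],
     [9, 6, 11, 0, 10, 2, 13, 1, 14, 4, 12, 5, 3, 7],
     [8, 6, 7, 0, 4, 2, 5, 1, 3, 13, 14, 11, 12, 10],
     [11, 6, 0, 8, 2, 7, 1, 4, 13, 5, 14, 3, 12, 9],
     [10, 6, 8, 0, 7, 2, 4, 1, 5, 13, 3, 14, 9, 12],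
     [13, 0, 14, 2, 1, 6, 4, 8, 5, 7, 3, 10, 9, 11],
     [12, 0, 6, 2, 8, 1, 7, 4, 10, 5, 11, 3, 9, 14],
     [0, 12, 2, 6, 1, 8, 4, 7, 5, 10, 3, 11, 9, 13]],
    [54, 19, 11, 7, 4, 3, 1, 0, -1, -3, -5, -7, -11, -20, -66],
    [-99, 4, -7, 22, 2, 6, -13, 0, -6, 14, -1, 5, -30, -8, -73]⟩]

def leavesFifteen : List (ℕ × ℕ × Bool) := [
  (1, 19, true), (3, 5, true), (0, 12, false), (1, 11, true), (1, 12, false), (1, 22, false),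
  (3, 0, false), (0, 19, true), (0, 22, false), (0, 0, false), (0, 29, true), (1, 0, false),
  (1, 29, true), (2, 0, false), (2, 11, true), (2, 18, false), (2, 29, true)]

set_option maxRecDepth 100000 in
theorem irredundant_optimalFifteen : Irredundant 15 optimalFifteen := by
  decide +kernel

set_option maxRecDepth 100000 in
theorem exhaustive_optimalFifteen : Exhaustive 15 optimalFifteen leavesFifteen := by
  decide +kernel

/-- Optimal tables with seventeen lines. -/
def optimalSeventeen : List LineData := [
  ⟨[[1, 3, 2, 5, 4, 7, 6, 9, 8, 11, 10, 13, 12, 15, 14, 16],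
     [0, 3, 7, 5, 9, 4, 11, 6, 13, 8, 15, 10, 16, 12, 14, 2],
     [3, 0, 5, 7, 4, 9, 6, 11, 8, 13, 10, 15, 12, 16, 14, 1],
     [2, 0, 1, 7, 15, 9, 16, 11, 13, 5, 10, 8, 14, 6, 12, 4],
     [5, 0, 7, 2, 9, 1, 11, 15, 13, 16, 8, 10, 6, 14, 12, 3],
     [4, 0, 2, 7, 1, 9, 15, 11, 16, 13, 3, 10, 14, 8, 12, 6],
     [7, 0, 9, 2, 11, 1, 13, 15, 8, 16, 10, 4, 14, 3, 12, 5],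
     [6, 0, 4, 2, 5, 1, 3, 15, 16, 9, 13, 11, 14, 10, 12, 8],
     [9, 0, 11, 2, 13, 1, 15, 6, 16, 4, 10, 3, 14, 5, 12, 7],
     [8, 0, 6, 2, 4, 1, 5, 15, 3, 16, 7, 13, 14, 11, 12, 10],
     [11, 0, 13, 2, 15, 1, 16, 6, 4, 8, 3, 5, 14, 7, 12, 9],
     [10, 0, 8, 2, 6, 1, 4, 15, 5, 16, 3, 13, 7, 14, 9, 12],
     [13, 0, 15, 2, 16, 1, 14, 4, 3, 6, 5, 8, 7, 10, 9, 11],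
     [12, 0, 10, 2, 8, 1, 6, 15, 4, 16, 5, 3, 11, 7, 9, 14],
     [15, 0, 16, 2, 1, 12, 4, 6, 3, 8, 5, 10, 7, 11, 9, 13],
     [14, 0, 12, 2, 10, 1, 8, 6, 13, 4, 11, 5, 9, 3, 7, 16],
     [0, 14, 2, 12, 1, 10, 6, 8, 4, 13, 5, 11, 3, 9, 7, 15]],
    [72, 32, 20, 13, 9, 7, 4, 2, 0, -2, -4, -6, -8, -12, -27, -52, -396],
    [-1247, -123, -140, 63, -15, 43, -24, 85, -21, 81, -29, 35, -146, 25, -198, 144, -244]⟩,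
  ⟨[[1, 3, 2, 5, 4, 7, 6, 9, 8, 11, 10, 13, 12, 15, 14, 16],
     [0, 3, 7, 5, 11, 9, 15, 13, 16, 8, 10, 6, 12, 4, 14, 2],
     [3, 0, 5, 7, 4, 9, 6, 11, 8, 13, 10, 15, 12, 16, 14, 1],
     [2, 0, 1, 7, 15, 11, 16, 9, 13, 5, 10, 8, 12, 6, 14, 4],
     [5, 0, 7, 2, 9, 11, 6, 13, 8, 15, 10, 16, 12, 1, 14, 3],
     [4, 0, 2, 7, 1, 11, 15, 9, 16, 13, 3, 10, 12, 8, 14, 6],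
     [7, 0, 9, 2, 11, 4, 13, 15, 8, 16, 10, 1, 12, 3, 14, 5],
     [6, 0, 4, 2, 5, 1, 3, 15, 16, 11, 13, 9, 12, 10, 14, 8],
     [9, 0, 11, 2, 13, 4, 15, 6, 16, 1, 10, 3, 12, 5, 14, 7],
     [8, 0, 6, 2, 4, 11, 1, 15, 5, 16, 3, 13, 7, 12, 14, 10],
     [11, 0, 13, 2, 15, 4, 16, 6, 1, 8, 3, 5, 12, 7, 14, 9],
     [10, 0, 8, 2, 6, 4, 9, 1, 5, 15, 3, 16, 7, 13, 14, 12],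
     [13, 0, 15, 2, 16, 4, 1, 6, 3, 8, 5, 10, 7, 9, 14, 11],
     [12, 0, 10, 2, 8, 4, 6, 15, 1, 16, 5, 3, 9, 7, 11, 14],
     [15, 0, 16, 2, 1, 4, 3, 6, 5, 8, 7, 10, 9, 12, 11, 13],
     [14, 0, 12, 2, 10, 4, 8, 6, 13, 1, 9, 5, 11, 3, 7, 16],
     [0, 14, 2, 12, 4, 10, 6, 8, 1, 13, 5, 9, 3, 11, 7, 15]],
    [167, 50, 28, 19, 13, 9, 5, 3, 0, -2, -5, -8, -12, -18, -27, -47, -134],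
    [-118, 40, 0, 23, 4, 13, 1, 11, -2, 5, -7, 1, -19, -9, -60, -27, -103]⟩,
  ⟨[[1, 3, 2, 5, 4, 7, 6, 9, 8, 11, 10, 13, 12, 15, 14, 16],
     [0, 3, 7, 5, 13, 11, 15, 9, 16, 8, 14, 10, 12, 4, 6, 2],
     [3, 0, 5, 7, 4, 11, 9, 13, 8, 15, 10, 16, 12, 14, 6, 1],
     [2, 0, 1, 7, 15, 13, 16, 11, 14, 9, 12, 8, 10, 5, 6, 4],
     [5, 0, 7, 2, 11, 13, 9, 15, 8, 16, 10, 14, 12, 1, 6, 3],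
     [4, 0, 2, 7, 1, 13, 15, 11, 16, 9, 14, 8, 12, 10, 3, 6],
     [7, 0, 9, 11, 8, 13, 10, 15, 12, 16, 14, 2, 1, 4, 3, 5],
     [6, 0, 4, 2, 5, 1, 3, 15, 16, 13, 14, 11, 12, 9, 10, 8],
     [9, 0, 11, 6, 13, 2, 15, 4, 16, 1, 14, 5, 12, 3, 10, 7],
     [8, 0, 6, 11, 2, 13, 4, 15, 1, 16, 5, 14, 3, 12, 7, 10],
     [11, 0, 13, 6, 15, 2, 16, 4, 14, 1, 12, 5, 3, 8, 7, 9],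
     [10, 0, 8, 6, 9, 2, 4, 13, 1, 15, 5, 16, 3, 14, 7, 12],
     [13, 0, 15, 6, 16, 2, 14, 4, 1, 10, 5, 8, 3, 9, 7, 11],
     [12, 0, 10, 6, 8, 2, 9, 4, 11, 1, 5, 15, 3, 16, 7, 14],
     [15, 0, 16, 6, 2, 12, 4, 10, 1, 8, 5, 9, 3, 11, 7, 13],
     [14, 0, 12, 6, 10, 2, 8, 4, 9, 1, 11, 5, 13, 3, 7, 16],
     [0, 14, 6, 12, 2, 10, 4, 8, 1, 9, 5, 11, 3, 13, 7, 15]],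
    [575, 268, 168, 117, 84, 60, 41, -1, -15, -30, -47, -67, -94, -131, -195, -331, -966],
    [-307, 42, -16, 55, -4, 25, -32, 48, -10, 1, -27, 11, -47, 9, -59, -14, -147]⟩,
  ⟨[[1, 3, 2, 5, 4, 7, 6, 9, 8, 11, 10, 13, 12, 15, 14, 16],
     [0, 3, 7, 5, 15, 11, 13, 9, 16, 8, 14, 6, 12, 4, 10, 2],
     [3, 0, 5, 7, 4, 11, 9, 15, 8, 13, 6, 16, 12, 14, 10, 1],
     [2, 0, 1, 7, 15, 5, 13, 11, 16, 9, 14, 8, 12, 6, 10, 4],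
     [5, 0, 7, 2, 11, 15, 9, 13, 8, 16, 6, 14, 12, 1, 10, 3],
     [4, 0, 2, 7, 1, 15, 3, 13, 16, 11, 14, 9, 12, 8, 10, 6],
     [7, 0, 9, 11, 8, 15, 13, 2, 16, 4, 14, 1, 12, 3, 10, 5],
     [6, 0, 4, 2, 5, 1, 3, 15, 16, 13, 14, 11, 12, 9, 10, 8],
     [9, 0, 11, 6, 15, 2, 13, 4, 16, 1, 14, 3, 12, 5, 10, 7],
     [8, 0, 6, 11, 2, 15, 4, 13, 1, 16, 3, 14, 5, 12, 7, 10],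
     [11, 0, 13, 15, 12, 16, 14, 2, 1, 4, 3, 6, 5, 8, 7, 9],
     [10, 0, 8, 6, 9, 2, 4, 15, 1, 13, 3, 16, 5, 14, 7, 12],
     [13, 0, 15, 10, 16, 2, 14, 4, 1, 6, 3, 8, 5, 9, 7, 11],
     [12, 0, 10, 15, 6, 2, 8, 4, 9, 1, 11, 3, 5, 16, 7, 14],
     [15, 0, 16, 10, 2, 12, 4, 6, 1, 8, 3, 9, 5, 11, 7, 13],
     [14, 0, 12, 10, 13, 6, 8, 2, 9, 4, 11, 1, 5, 3, 7, 16],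
     [0, 14, 10, 12, 2, 6, 4, 8, 1, 9, 3, 11, 5, 13, 7, 15]],
    [607, 149, 97, 69, 50, 35, 16, 8, 0, -8, -17, -26, -49, -70, -100, -155, -309],
    [-666, 355, 133, 233, 83, 149, -8, 138, -13, -4, -161, -8, -188, -119, -324, -219, -731]⟩,
  ⟨[[1, 3, 2, 5, 4, 7, 6, 9, 8, 11, 10, 13, 12, 15, 14, 16],
     [0, 3, 11, 7, 15, 9, 13, 5, 16, 8, 10, 6, 12, 4, 14, 2],
     [3, 0, 5, 7, 4, 9, 6, 11, 8, 13, 10, 15, 12, 16, 14, 1],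
     [2, 0, 1, 11, 15, 7, 13, 9, 16, 5, 10, 8, 12, 6, 14, 4],
     [5, 0, 7, 2, 9, 11, 6, 13, 8, 15, 10, 16, 12, 1, 14, 3],
     [4, 0, 2, 7, 11, 9, 15, 13, 1, 16, 3, 10, 12, 8, 14, 6],
     [7, 0, 9, 2, 11, 4, 13, 15, 8, 16, 10, 1, 12, 3, 14, 5],
     [6, 0, 4, 2, 5, 11, 1, 15, 3, 13, 16, 9, 12, 10, 14, 8],
     [9, 0, 11, 2, 13, 4, 15, 6, 16, 1, 10, 3, 12, 5, 14, 7],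
     [8, 0, 6, 2, 4, 11, 5, 15, 1, 13, 3, 16, 7, 12, 14, 10],
     [11, 0, 13, 2, 15, 4, 16, 6, 1, 8, 3, 5, 12, 7, 14, 9],
     [10, 0, 8, 2, 6, 4, 9, 5, 7, 1, 3, 15, 16, 13, 14, 12],
     [13, 0, 15, 2, 16, 4, 1, 6, 3, 8, 5, 10, 7, 9, 14, 11],
     [12, 0, 10, 2, 8, 4, 6, 15, 5, 1, 9, 3, 7, 16, 11, 14],
     [15, 0, 16, 2, 1, 4, 3, 6, 5, 8, 7, 10, 9, 12, 11, 13],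
     [14, 0, 12, 2, 10, 4, 8, 6, 13, 5, 9, 1, 7, 3, 11, 16],
     [0, 14, 2, 12, 4, 10, 6, 8, 1, 5, 3, 9, 7, 13, 11, 15]],
    [57, 24, 15, 10, 7, 5, 3, 1, 0, -2, -4, -6, -8, -12, -19, -35, -192],
    [-80, 3, -12, 5, -3, 3, -1, 5, -1, 4, -2, 6, -6, 4, -27, 6, -23]⟩,
  ⟨[[1, 3, 2, 5, 4, 7, 6, 9, 8, 11, 10, 13, 12, 15, 14, 16],
     [0, 3, 15, 7, 13, 5, 11, 9, 16, 8, 10, 4, 12, 6, 14, 2],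
     [3, 0, 5, 7, 4, 9, 6, 11, 8, 13, 10, 15, 12, 16, 14, 1],
     [2, 0, 1, 15, 16, 13, 14, 11, 12, 9, 10, 7, 8, 5, 6, 4],
     [5, 0, 7, 2, 9, 13, 11, 15, 8, 16, 10, 1, 12, 14, 6, 3],
     [4, 0, 2, 7, 15, 13, 1, 11, 16, 9, 14, 10, 12, 8, 3, 6],
     [7, 0, 9, 2, 11, 13, 8, 15, 10, 16, 12, 1, 14, 4, 3, 5],
     [6, 0, 4, 2, 5, 15, 1, 13, 16, 11, 14, 9, 12, 10, 3, 8],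
     [9, 0, 11, 2, 13, 6, 15, 4, 16, 1, 10, 14, 12, 5, 3, 7],
     [8, 0, 6, 2, 4, 13, 15, 11, 1, 16, 5, 14, 7, 12, 3, 10],
     [11, 0, 13, 2, 15, 6, 16, 4, 1, 8, 14, 5, 12, 7, 3, 9],
     [10, 0, 8, 2, 6, 13, 4, 15, 9, 1, 5, 16, 7, 14, 3, 12],
     [13, 0, 15, 2, 16, 6, 1, 4, 14, 8, 5, 10, 7, 9, 3, 11],
     [12, 0, 10, 2, 8, 6, 11, 4, 9, 15, 5, 1, 7, 16, 3, 14],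
     [15, 0, 16, 2, 1, 6, 4, 12, 8, 10, 5, 9, 7, 11, 3, 13],
     [14, 0, 12, 2, 10, 6, 8, 4, 11, 9, 13, 5, 7, 1, 3, 16],
     [0, 14, 2, 12, 6, 10, 4, 8, 1, 9, 5, 11, 7, 13, 3, 15]],
    [148, 66, 40, 26, 18, 12, 7, 3, -2, -6, -11, -17, -24, -35, -55, -105, -644],
    [-910, 23, -160, 250, -29, 32, -52, 65, -29, 16, -39, 26, -90, 60, -171, 162, -219]⟩,
  ⟨[[1, 3, 2, 5, 4, 7, 6, 9, 8, 11, 10, 13, 12, 15, 14, 16],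
     [0, 3, 15, 7, 11, 5, 13, 9, 16, 8, 12, 4, 10, 6, 14, 2],
     [3, 0, 5, 7, 4, 11, 9, 15, 8, 13, 6, 12, 10, 16, 14, 1],
     [2, 0, 1, 15, 16, 11, 13, 7, 12, 9, 14, 8, 10, 5, 6, 4],
     [5, 0, 7, 2, 11, 15, 9, 13, 8, 16, 12, 1, 10, 14, 6, 3],
     [4, 0, 2, 7, 15, 11, 1, 13, 16, 9, 12, 8, 14, 10, 3, 6],
     [7, 0, 9, 11, 8, 15, 13, 2, 12, 16, 10, 1, 14, 4, 3, 5],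
     [6, 0, 4, 2, 5, 15, 1, 11, 16, 13, 3, 12, 14, 9, 10, 8],
     [9, 0, 11, 6, 15, 2, 13, 4, 16, 1, 12, 5, 14, 3, 10, 7],
     [8, 0, 6, 11, 2, 15, 4, 13, 1, 16, 5, 12, 3, 14, 7, 10],
     [11, 0, 13, 15, 12, 2, 16, 6, 1, 4, 14, 5, 3, 8, 7, 9],
     [10, 0, 8, 6, 9, 2, 4, 15, 5, 1, 7, 16, 3, 13, 14, 12],
     [13, 0, 15, 10, 2, 6, 16, 4, 1, 8, 5, 9, 3, 7, 14, 11],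
     [12, 0, 10, 15, 6, 2, 8, 4, 9, 1, 5, 16, 7, 3, 11, 14],
     [15, 0, 16, 2, 1, 6, 4, 10, 5, 8, 3, 9, 7, 12, 11, 13],
     [14, 0, 12, 10, 13, 6, 8, 2, 9, 4, 11, 5, 7, 1, 3, 16],
     [0, 14, 2, 10, 6, 12, 4, 8, 1, 9, 5, 13, 7, 11, 3, 15]],
    [156, 34, 18, 12, 8, 6, 4, 2, 0, -1, -3, -5, -7, -10, -15, -25, -61],
    [-48, 40, 10, 26, 7, 9, -1, 8, -1, 0, -9, 0, -11, -9, -32, -15, -73]⟩,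
  ⟨[[1, 3, 2, 5, 4, 7, 6, 9, 8, 11, 10, 13, 12, 15, 14, 16],
     [0, 3, 11, 5, 13, 7, 15, 9, 16, 8, 12, 10, 14, 4, 6, 2],
     [3, 0, 5, 11, 7, 13, 9, 15, 8, 16, 10, 12, 4, 14, 6, 1],
     [2, 0, 1, 11, 15, 13, 16, 7, 12, 9, 14, 8, 10, 5, 6, 4],
     [5, 0, 7, 11, 9, 13, 8, 15, 10, 16, 12, 2, 14, 1, 6, 3],
     [4, 0, 2, 11, 1, 13, 15, 7, 16, 9, 12, 8, 14, 10, 3, 6],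
     [7, 0, 9, 11, 8, 13, 10, 15, 12, 16, 14, 2, 1, 4, 3, 5],
     [6, 0, 4, 11, 2, 13, 1, 15, 5, 16, 3, 12, 14, 9, 10, 8],
     [9, 0, 11, 6, 13, 4, 15, 2, 16, 1, 12, 5, 14, 3, 10, 7],
     [8, 0, 6, 11, 4, 13, 2, 15, 1, 16, 5, 12, 3, 14, 7, 10],
     [11, 0, 13, 6, 15, 4, 16, 2, 12, 1, 14, 5, 3, 8, 7, 9],
     [10, 0, 8, 6, 9, 4, 7, 2, 5, 1, 3, 15, 16, 13, 14, 12],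
     [13, 0, 15, 6, 16, 4, 2, 10, 1, 8, 5, 9, 3, 7, 14, 11],
     [12, 0, 10, 6, 8, 4, 9, 2, 7, 1, 5, 15, 3, 16, 11, 14],
     [15, 0, 16, 6, 2, 4, 1, 10, 5, 8, 3, 9, 7, 12, 11, 13],
     [14, 0, 12, 6, 10, 4, 8, 2, 9, 1, 7, 5, 13, 3, 11, 16],
     [0, 14, 6, 12, 4, 10, 2, 8, 1, 9, 5, 7, 3, 13, 11, 15]],
    [279, 78, 54, 40, 29, 20, 13, 0, -6, -12, -20, -38, -52, -73, -113, -219, -1953],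
    [-1223, 11, -26, 133, -63, 52, -88, 56, -11, 18, -55, 124, -69, 117, -275, 101, -173]⟩,
  ⟨[[1, 3, 2, 5, 4, 7, 6, 9, 8, 15, 11, 13, 10, 14, 12, 16],
     [0, 3, 15, 5, 16, 7, 13, 9, 14, 8, 11, 6, 12, 4, 10, 2],
     [3, 0, 5, 15, 7, 16, 9, 13, 8, 14, 6, 11, 4, 12, 10, 1],
     [2, 0, 1, 15, 16, 5, 13, 7, 14, 9, 11, 8, 12, 6, 10, 4],
     [5, 0, 7, 15, 9, 16, 8, 13, 6, 14, 11, 2, 12, 1, 10, 3],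
     [4, 0, 2, 15, 1, 16, 3, 13, 14, 7, 11, 9, 12, 8, 10, 6],
     [7, 0, 9, 15, 8, 16, 13, 4, 14, 2, 11, 1, 12, 3, 10, 5],
     [6, 0, 4, 15, 2, 16, 1, 13, 3, 14, 5, 11, 12, 9, 10, 8],
     [9, 0, 15, 6, 16, 4, 13, 2, 14, 1, 11, 3, 12, 5, 10, 7],
     [8, 0, 6, 15, 4, 16, 2, 13, 1, 14, 3, 11, 5, 12, 7, 10],
     [11, 15, 13, 0, 14, 16, 12, 2, 1, 4, 3, 6, 5, 8, 7, 9],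
     [10, 15, 0, 13, 16, 14, 4, 2, 6, 1, 8, 3, 9, 5, 7, 12],
     [13, 15, 14, 0, 16, 10, 2, 4, 1, 6, 3, 8, 5, 9, 7, 11],
     [12, 15, 10, 0, 11, 16, 6, 4, 8, 2, 9, 1, 7, 3, 5, 14],
     [15, 12, 0, 10, 16, 11, 4, 6, 2, 8, 1, 9, 3, 7, 5, 13],
     [14, 12, 13, 10, 11, 0, 8, 6, 9, 4, 7, 2, 5, 1, 3, 16],
     [0, 12, 10, 14, 11, 13, 6, 8, 4, 9, 2, 7, 1, 5, 3, 15]],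
    [202, 105, 68, 47, 34, 19, 11, 4, -2, -9, -16, -30, -43, -61, -91, -159, -543],
    [-299, 92, 25, 102, 0, 70, -8, 52, -6, 9, -92, -33, -99, -22, -59, 135, -94]⟩,
  ⟨[[1, 3, 2, 5, 4, 9, 7, 11, 8, 10, 6, 13, 12, 15, 14, 16],
     [0, 3, 15, 9, 11, 5, 13, 7, 10, 4, 12, 8, 16, 6, 14, 2],
     [3, 0, 5, 9, 4, 11, 7, 15, 10, 13, 8, 12, 6, 16, 14, 1],
     [2, 0, 1, 15, 16, 11, 13, 9, 12, 10, 14, 7, 8, 5, 6, 4],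
     [5, 0, 9, 2, 11, 15, 7, 13, 10, 1, 12, 16, 8, 14, 6, 3],
     [4, 0, 2, 9, 15, 11, 1, 13, 16, 10, 12, 7, 14, 8, 3, 6],
     [7, 9, 8, 11, 10, 0, 13, 15, 12, 2, 16, 1, 14, 4, 3, 5],
     [6, 9, 0, 11, 2, 15, 4, 13, 1, 10, 16, 12, 5, 14, 3, 8],
     [9, 6, 11, 0, 10, 15, 13, 2, 12, 1, 16, 4, 14, 5, 3, 7],
     [8, 6, 7, 0, 4, 2, 5, 15, 1, 11, 16, 13, 3, 12, 14, 10],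
     [11, 6, 0, 8, 15, 2, 13, 4, 1, 7, 16, 5, 12, 3, 14, 9],
     [10, 6, 8, 0, 7, 2, 4, 15, 5, 1, 9, 16, 3, 13, 14, 12],
     [13, 0, 15, 6, 2, 8, 1, 4, 16, 7, 5, 10, 3, 9, 14, 11],
     [12, 0, 6, 15, 8, 2, 10, 4, 7, 1, 5, 16, 9, 3, 11, 14],
     [15, 0, 16, 2, 1, 6, 4, 8, 5, 7, 3, 10, 9, 12, 11, 13],
     [14, 0, 12, 6, 13, 8, 10, 2, 7, 4, 11, 5, 9, 1, 3, 16],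
     [0, 14, 2, 6, 1, 8, 4, 12, 7, 10, 5, 13, 9, 11, 3, 15]],
    [72, 27, 16, 10, 7, 5, 3, 1, 0, -2, -3, -5, -8, -11, -17, -31, -112],
    [-114, 3, -10, 24, 0, 5, -15, 1, -5, 11, -1, 9, -5, 2, -34, 22, -73]⟩]

def leavesSeventeen : List (ℕ × ℕ × Bool) := [
  (2, 13, true), (6, 20, false), (7, 14, false), (0, 14, false), (6, 14, false), (8, 12, false),
  (8, 24, false), (9, 0, false), (9, 6, false), (9, 13, true), (9, 14, false), (9, 19, true),
  (9, 20, false), (9, 33, true), (0, 21, true), (2, 24, false), (3, 24, false), (8, 0, false),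
  (0, 0, false), (0, 33, true), (1, 0, false), (1, 14, false), (2, 0, false), (2, 33, true),
  (3, 0, false), (4, 0, false), (4, 14, false), (4, 19, true), (4, 33, true), (5, 0, false),
  (5, 13, true), (5, 20, false), (5, 33, true), (6, 0, false), (7, 0, false)]

set_option maxRecDepth 100000 in
theorem irredundant_optimalSeventeen : Irredundant 17 optimalSeventeen := by
  decide +kernel

set_option maxRecDepth 100000 in
theorem exhaustive_optimalSeventeen : Exhaustive 17 optimalSeventeen leavesSeventeen := by
  decide +kernel

end Table

theorem mainTheorem4 (n c : ℕ)
    (h : (n = 3 ∧ c = 1) ∨ (n = 5 ∧ c = 1) ∨ (n = 9 ∧ c = 1) ∨ (n = 15 ∧ c = 4) ∨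
      (n = 17 ∧ c = 10)) :
    ∃ L : List (Table n),
      L.length = c ∧
      (∀ t ∈ L, t.IsOptimal) ∧
      (∀ t ∈ L, ∃ m b : Fin n → ℝ, t.IsTableOfLines m b) ∧
      L.Pairwise (fun s t => ¬ s.SameArrangement t) ∧
      ∀ t : Table n, t.IsOptimal → ∃ s ∈ L, s.SameArrangement t := by
  rcases h with ⟨rfl, rfl⟩ | ⟨rfl, rfl⟩ | ⟨rfl, rfl⟩ | ⟨rfl, rfl⟩ | ⟨rfl, rfl⟩
  · exact Table.exists_complete_list (m := 2) (by norm_num) (by norm_num) rfl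
      Table.irredundant_optimalThree Table.exhaustive_optimalThree
  · exact Table.exists_complete_list (m := 4) (by norm_num) (by norm_num) rfl
      Table.irredundant_optimalFive Table.exhaustive_optimalFive
  · exact Table.exists_complete_list (m := 8) (by norm_num) (by norm_num) rfl
      Table.irredundant_optimalNine Table.exhaustive_optimalNine
  · exact Table.exists_complete_list (m := 14) (by norm_num) (by norm_num) rfl
      Table.irredundant_optimalFifteen Table.exhaustive_optimalFifteen
  · exact Table.exists_complete_list (m := 16) (by norm_num) (by norm_num) rfl
      Table.irredundant_optimalSeventeen Table.exhaustive_optimalSeventeen
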